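/- **Setting.** Let $d\ge1$, $T>0$, $\mathbb T^d=\mathbb R^d/\mathbb Z^d$, and let $F=F(\rho,q):[0,\infty)\times\mathbb R^d\to\mathbb R$ be $C^\infty$ on $(0,\infty)\times\mathbb R^d$. Derivatives of $F$ and of functions of $(\rho,q)$ are taken within $[0,\infty)\times\mathbb R^d$ (one-sided in $\rho$ at $\rho=0$). Put $$s=\rho F_\rho+q\cdot F_q-F,\qquad r=\rho F_q,\qquad H=q\otimes F_q ,$$ and for $G\in\{F,s,r_k,H_{ij}\}$ $$G(\rho,q\,|\,\bar\rho,\bar q)=G(\rho,q)-G(\bar\rho,\bar q)-G_\rho(\bar\rho,\bar q)(\rho-\bar\rho)-G_q(\bar\rho,\bar q)\cdot(q-\bar q).$$ The Euler–Korteweg system is $$\rho_t+\operatorname{div}m=0,\qquad m_t+\operatorname{div}\Big(\frac{m\otimes m}{\rho}\Big)=\operatorname{div}S,\qquad S=-s(\rho,\nabla\rho)\,\mathbb I+\operatorname{div}\big(r(\rho,\nabla\rho)\big)\,\mathbb I-H(\rho,\nabla\rho),$$ with $m=\rho u$; equivalently, for smooth solutions with $\rho>0$, $(\rho u)_t+\operatorname{div}(\rho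 u\otimes u)=-\rho\nabla\big(F_\rho-\operatorname{div}F_q\big)$. Here $(\nabla u)_{ij}=\partial_{x_j}u_i$, $(\operatorname{div}S)_i=\partial_{x_j}S_{ij}$ and $A:B=\sum_{ij}A_{ij}B_{ij}$. **Weak solutions.** Let $\rho\in C([0,\infty);L^1(\mathbb T^d))$, $\rho\ge0$, $m\in C([0,\infty);L^1(\mathbb T^d)^d)$, and $\rho(t,\cdot)\in W^{1,1}(\mathbb T^d)$ for every $t\ge 0$. The pair $(\rho,m)$ is a weak solution if $m=0$ a.e. on $\{\rho=0\}$ (with $\frac{m\otimes m}{\rho}=0$ there), if $\frac{m\otimes m}\rho$, $S$, $s(\rho,\nabla\rho)$, $r(\rho,\nabla\rho)$, $H(\rho,\nabla\rho)\in L^1_{loc}([0,\infty)\times\mathbb T^d)$, where the formula for $S$ holds in the sense of distributions, and if for all compactly supported $C^1$ test functions $\psi,\varphi$ on $[0,\infty)\times\mathbb T^d$ (scalar, resp. $\mathbb R^d$-valued) $$-\iint\big(\rho\psi_t+m\cdot\nabla\psi\big)\,dx\,dt=\int\rho(0,x)\psi(0,x)\,dx,$$ $$-\iint\Big(m\cdot\varphi_t+\frac{m\otimes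 m}{\rho}:\nabla\varphi-S:\nabla\varphi\Big)\,dx\,dt=\int m(0,x)\cdot\varphi(0,x)\,dx .$$ It is *dissipative* if in addition, for every $t\ge0$, $m(t,\cdot)=0$ a.e. on $\{\rho(t,\cdot)=0\}$, if $\eta:=\frac12\frac{|m|^2}{\rho}+F(\rho,\nabla\rho)\in C([0,\infty);L^1(\mathbb T^d))$, and if $$-\iint\eta\,\dot\theta\,dx\,dt\le\theta(0)\int\eta(0,x)\,dx$$ for all non-negative Lipschitz $\theta$ on $[0,\infty)$ with compact support; it is *conservative* if this holds with equality. **Hypotheses.** * **(H1)** $(\rho,m)$ is a dissipative or conservative weak solution, and for some constants $K_1,K_2$ $$\sup_{(0,T)}\int_{\mathbb T^d}\rho\,dx\le K_1<\infty,\qquad \sup_{(0,T)}\int_{\mathbb T^d}\Big(\frac12\frac{|m|^2}{\rho}+F(\rho,\nabla\rho)\Big)dx\le K_2<\infty .$$ * **(A)** $\rho\in C([0,T];L^1(\mathbb T^d))$ and $\nabla\rho\in C([0,T];L^1(\mathbb T^d))$. * **(H2)** $(\bar\rho,\bar u)$ is a strong conservative solution on $(0,T)\times\mathbb T^d$ with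 $\bar\rho\ge0$, that is: $\bar\rho,\bar u,\partial_t\bar\rho,\nabla\bar\rho,\partial_t\nabla\bar\rho,\nabla^2\bar\rho,\nabla^3\bar\rho,\partial_t\bar u,\nabla\bar u,\nabla\operatorname{div}\bar u\in L^\infty((0,T)\times\mathbb T^d)$ as weak derivatives, where $\bar\rho,\nabla\bar\rho,\bar u$ denote the continuous representatives on $[0,T]\times\mathbb T^d$; almost everywhere in $(0,T)\times\mathbb T^d$ $$\bar\rho_t+\operatorname{div}(\bar\rho\bar u)=0,\qquad \partial_t\bar u+(\bar u\cdot\nabla)\bar u=-\nabla\big(F_\rho(\bar\rho,\nabla\bar\rho)-\operatorname{div}F_q(\bar\rho,\nabla\bar\rho)\big);$$ and the energy equality for $(\bar\rho,\bar m)$, $\bar m=\bar\rho\bar u$, holds for all non-negative Lipschitz $\theta$ with compact support in $[0,T)$. Moreover, either $\bar\rho>0$ on $[0,T]\times\mathbb T^d$, or $F$ is $C^\infty$ on $[0,\infty)\times\mathbb R^d$ up to the boundary. **Theorem.** Under (H1), (H2) and (A), for every $t\in[0,T]$ all integrands below are integrable and $$\begin{aligned} \int_{\mathbb T^d}\Big(\tfrac12\rho\Big|\frac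 m\rho-\bar u\Big|^2&+F(\rho,\nabla\rho\,|\,\bar\rho,\nabla\bar\rho)\Big)dx\Big|_t\le\int_{\mathbb T^d}\Big(\tfrac12\rho\Big|\frac m\rho-\bar u\Big|^2+F(\rho,\nabla\rho\,|\,\bar\rho,\nabla\bar\rho)\Big)dx\Big|_0\\ &-\iint_{[0,t)\times\mathbb T^d}\Big[\rho\Big(\frac m\rho-\bar u\Big)\otimes\Big(\frac m\rho-\bar u\Big):\nabla\bar u+(\operatorname{div}\bar u)\,s(\rho,\nabla\rho\,|\,\bar\rho,\nabla\bar\rho)\Big]dx\,d\tau\\ &-\iint_{[0,t)\times\mathbb T^d}\Big[\nabla\bar u:H(\rho,\nabla\rho\,|\,\bar\rho,\nabla\bar\rho)+\nabla\operatorname{div}\bar u\cdot r(\rho,\nabla\rho\,|\,\bar\rho,\nabla\bar\rho)\Big]dx\,d\tau , \end{aligned}$$ where the terms containing $\rho\,(m/\rho-\bar u)$ are $0$ where $\rho=0$. -/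

import Mathlib

open MeasureTheory Set Filter Topology
open scoped ContDiff

noncomputable section

namespace EulerKorteweg

/-- The space `ℝ^d` with its Euclidean norm. Functions on the torus `𝕋^d = ℝ^d / ℤ^d` are
functions on `ℝ^d` that are `1`-periodic in each coordinate; integrals over `𝕋^d` are integrals
over the unit cell. -/
abbrev E (d : ℕ) : Type := EuclideanSpace ℝ (Fin d)

/-- The `i`-th unit vector. -/
abbrev e {d : ℕ} (i : Fin d) : E d := EuclideanSpace.single i (1 : ℝ)

/-- The unit cell `[0,1)^d`. -/
def cell (d : ℕ) : Set (E d) := {x | ∀ i, 0 ≤ x i ∧ x i < 1}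

/-- Periodicity in space of a function of `(t, x)`. -/
def Periodic {d : ℕ} {V : Type*} (f : ℝ → E d → V) : Prop :=
  ∀ (t : ℝ) (x : E d) (i : Fin d), f t (x + e i) = f t x

/-! ### Function spaces and weak derivatives -/

/-- `C¹` periodic test functions whose support, within `[0,∞) × 𝕋^d`, is contained in `K × 𝕋^d`
for a compact subset `K` of the time set `I`. -/
def IsTest {d : ℕ} {V : Type*} [NormedAddCommGroup V] [NormedSpace ℝ V]
    (I : Set ℝ) (φ : ℝ → E d → V) : Prop :=
  ContDiff ℝ 1 (fun z : ℝ × E d => φ z.1 z.2) ∧ Periodic φ ∧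
    ∃ K : Set ℝ, IsCompact K ∧ K ⊆ I ∧ ∀ t, 0 ≤ t → t ∉ K → ∀ x, φ t x = 0

/-- Time derivative of a (smooth) function of `(t, x)`. -/
def dt {d : ℕ} {V : Type*} [NormedAddCommGroup V] [NormedSpace ℝ V]
    (φ : ℝ → E d → V) (t : ℝ) (x : E d) : V := deriv (fun τ => φ τ x) t

/-- Partial derivative `∂/∂x_i` of a (smooth) function of `(t, x)`. -/
def dx {d : ℕ} {V : Type*} [NormedAddCommGroup V] [NormedSpace ℝ V]
    (i : Fin d) (φ : ℝ → E d → V) (t : ℝ) (x : E d) : V := fderiv ℝ (φ t) x (e i)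

/-- `f ∈ C(I; L¹(𝕋^d))`. -/
def ContL1 {d : ℕ} {V : Type*} [NormedAddCommGroup V] (I : Set ℝ) (f : ℝ → E d → V) : Prop :=
  (∀ t ∈ I, IntegrableOn (f t) (cell d)) ∧
    ∀ t₀ ∈ I, Tendsto (fun t => ∫ x in cell d, ‖f t x - f t₀ x‖) (𝓝[I] t₀) (𝓝 0)

/-- `f ∈ L¹_loc([0,∞) × 𝕋^d)`. -/
def L1Loc {d : ℕ} (f : ℝ → E d → ℝ) : Prop :=
  ∀ R : ℝ, IntegrableOn (fun z : ℝ × E d => f z.1 z.2) (Ioo 0 R ×ˢ cell d)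

/-- `f ∈ L^∞((0,T) × 𝕋^d)`. -/
def LInf {d : ℕ} (T : ℝ) (f : ℝ → E d → ℝ) : Prop :=
  MemLp (fun z : ℝ × E d => f z.1 z.2) ⊤ (volume.restrict (Ioo 0 T ×ˢ cell d))

/-- `g ∈ L¹(𝕋^d)` is the weak gradient of `f ∈ L¹(𝕋^d)`, so that `f ∈ W^{1,1}(𝕋^d)`. -/
def IsWeakGrad {d : ℕ} (f : E d → ℝ) (g : E d → E d) : Prop :=
  IntegrableOn f (cell d) ∧ IntegrableOn g (cell d) ∧
    ∀ φ : E d → ℝ, ContDiff ℝ 1 φ → (∀ x i, φ (x + e i) = φ x) → ∀ i,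
      ∫ x in cell d, f x * fderiv ℝ φ x (e i) = - ∫ x in cell d, g x i * φ x

/-- `g ∈ L^∞((0,T) × 𝕋^d)` is the weak time derivative of `f` on `(0,T) × 𝕋^d`. -/
def IsWeakDt {d : ℕ} (T : ℝ) (f g : ℝ → E d → ℝ) : Prop :=
  LInf T g ∧ ∀ φ : ℝ → E d → ℝ, IsTest (Ioo 0 T) φ →
    ∫ z in Ioo 0 T ×ˢ cell d, f z.1 z.2 * dt φ z.1 z.2
      = - ∫ z in Ioo 0 T ×ˢ cell d, g z.1 z.2 * φ z.1 z.2

/-- `g ∈ L^∞((0,T) × 𝕋^d)` is the weak derivative `∂f/∂x_i` on `(0,T) × 𝕋^d`. -/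
def IsWeakDx {d : ℕ} (T : ℝ) (i : Fin d) (f g : ℝ → E d → ℝ) : Prop :=
  LInf T g ∧ ∀ φ : ℝ → E d → ℝ, IsTest (Ioo 0 T) φ →
    ∫ z in Ioo 0 T ×ˢ cell d, f z.1 z.2 * dx i φ z.1 z.2
      = - ∫ z in Ioo 0 T ×ˢ cell d, g z.1 z.2 * φ z.1 z.2

/-! ### The constitutive functions

The potential energy `F (ρ, q)` is a function on `[0,∞) × ℝ^d`; its values for `ρ < 0` play no
role. Derivatives are taken within `[0,∞) × ℝ^d`: they are the usual ones for `ρ > 0` and one-sided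
in `ρ` at `ρ = 0`. -/

/-- The phase space `[0,∞) × ℝ^d`. -/
def phase (d : ℕ) : Set (ℝ × E d) := Ici 0 ×ˢ univ

/-- `F_ρ`. -/
def Fρ {d : ℕ} (F : ℝ × E d → ℝ) (z : ℝ × E d) : ℝ := fderivWithin ℝ F (phase d) z (1, 0)

/-- `F_{q_k}`. -/
def Fq {d : ℕ} (F : ℝ × E d → ℝ) (k : Fin d) (z : ℝ × E d) : ℝ :=
  fderivWithin ℝ F (phase d) z (0, e k)

/-- `s(ρ,q) = ρ F_ρ + q · F_q - F`. -/
def s {d : ℕ} (F : ℝ × E d → ℝ) (z : ℝ × E d) : ℝ :=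
  z.1 * Fρ F z + (∑ k, z.2 k * Fq F k z) - F z

/-- `r(ρ,q) = ρ F_q`. -/
def r {d : ℕ} (F : ℝ × E d → ℝ) (k : Fin d) (z : ℝ × E d) : ℝ := z.1 * Fq F k z

/-- `H(ρ,q) = q ⊗ F_q`. -/
def H {d : ℕ} (F : ℝ × E d → ℝ) (i j : Fin d) (z : ℝ × E d) : ℝ := z.2 i * Fq F j z

/-- The relative function `G(ρ,q | ρ̄,q̄) = G(ρ,q) - G(ρ̄,q̄) - G_ρ(ρ̄,q̄)(ρ-ρ̄) - G_q(ρ̄,q̄)·(q-q̄)`. -/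
def rel {d : ℕ} (G : ℝ × E d → ℝ) (z zb : ℝ × E d) : ℝ :=
  G z - G zb - fderivWithin ℝ G (phase d) zb (z - zb)

/-! ### Weak solutions -/

/-- `S = -s(ρ,∇ρ) I + (div r(ρ,∇ρ)) I - H(ρ,∇ρ)` in the sense of distributions on
`(0,∞) × 𝕋^d`, where `q = ∇ρ`. -/
structure IsStress {d : ℕ} (F : ℝ × E d → ℝ) (ρ : ℝ → E d → ℝ) (q : ℝ → E d → E d)
    (S : ℝ → E d → Matrix (Fin d) (Fin d) ℝ) : Prop where
  s_loc : L1Loc fun t x => s F (ρ t x, q t x)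
  r_loc : ∀ k, L1Loc fun t x => r F k (ρ t x, q t x)
  H_loc : ∀ i j, L1Loc fun t x => H F i j (ρ t x, q t x)
  eq : ∀ φ : ℝ → E d → ℝ, IsTest (Ioi 0) φ → ∀ i j,
    ∫ z in Ioi 0 ×ˢ cell d, S z.1 z.2 i j * φ z.1 z.2
      = ∫ z in Ioi 0 ×ˢ cell d,
          ((if i = j then
              - s F (ρ z.1 z.2, q z.1 z.2) * φ z.1 z.2
                - ∑ k, r F k (ρ z.1 z.2, q z.1 z.2) * dx k φ z.1 z.2
            else 0)
            - H F i j (ρ z.1 z.2, q z.1 z.2) * φ z.1 z.2)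

/-- `(ρ, m)`, with `q = ∇ρ` and stress `S`, is a weak solution on `[0,∞) × 𝕋^d` of
`ρ_t + div m = 0`, `m_t + div (m ⊗ m / ρ) = div S`, where `(div S)_i = ∂_j S_{ij}`. -/
structure IsWeakSolution {d : ℕ} (F : ℝ × E d → ℝ) (ρ : ℝ → E d → ℝ) (q m : ℝ → E d → E d)
    (S : ℝ → E d → Matrix (Fin d) (Fin d) ℝ) : Prop where
  periodic_ρ : Periodic ρ
  periodic_q : Periodic q
  periodic_m : Periodic m
  meas_ρ : AEStronglyMeasurable (fun z : ℝ × E d => ρ z.1 z.2)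
    (volume.restrict (Ioi 0 ×ˢ cell d))
  meas_q : AEStronglyMeasurable (fun z : ℝ × E d => q z.1 z.2)
    (volume.restrict (Ioi 0 ×ˢ cell d))
  meas_m : AEStronglyMeasurable (fun z : ℝ × E d => m z.1 z.2)
    (volume.restrict (Ioi 0 ×ˢ cell d))
  cont_ρ : ContL1 (Ici 0) ρ
  cont_m : ContL1 (Ici 0) m
  nonneg : ∀ t, 0 ≤ t → ∀ᵐ x ∂(volume.restrict (cell d)), 0 ≤ ρ t x
  grad : ∀ t, 0 ≤ t → IsWeakGrad (ρ t) (q t)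
  /-- `m ⊗ m / ρ` is finite almost everywhere: the momentum vanishes in the vacuum. -/
  vacuum : ∀ᵐ z ∂(volume.restrict (Ioi (0 : ℝ) ×ˢ cell d)), ρ z.1 z.2 = 0 → m z.1 z.2 = 0
  conv_loc : ∀ i j, L1Loc fun t x => m t x i * m t x j / ρ t x
  S_loc : ∀ i j, L1Loc fun t x => S t x i j
  stress : IsStress F ρ q S
  mass : ∀ ψ : ℝ → E d → ℝ, IsTest (Ici 0) ψ →
    - ∫ z in Ioi 0 ×ˢ cell d,
        (ρ z.1 z.2 * dt ψ z.1 z.2 + ∑ i, m z.1 z.2 i * dx i ψ z.1 z.2)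
      = ∫ x in cell d, ρ 0 x * ψ 0 x
  momentum : ∀ φ : ℝ → E d → E d, IsTest (Ici 0) φ →
    - ∫ z in Ioi 0 ×ˢ cell d,
        ((∑ i, m z.1 z.2 i * dt φ z.1 z.2 i)
          + (∑ i, ∑ j, m z.1 z.2 i * m z.1 z.2 j / ρ z.1 z.2 * dx j φ z.1 z.2 i)
          - ∑ i, ∑ j, S z.1 z.2 i j * dx j φ z.1 z.2 i)
      = ∫ x in cell d, ∑ i, m 0 x i * φ 0 x i

/-- The energy density `½ |m|² / ρ + F(ρ, ∇ρ)`, with `q = ∇ρ`; the kinetic part is `0` where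
`ρ = 0` and `m = 0`. -/
def energy {d : ℕ} (F : ℝ × E d → ℝ) (ρ : ℝ → E d → ℝ) (q m : ℝ → E d → E d)
    (t : ℝ) (x : E d) : ℝ :=
  1 / 2 * (‖m t x‖ ^ 2 / ρ t x) + F (ρ t x, q t x)

/-- Non-negative Lipschitz functions of time on `[0,∞)` with compact support in `I`. -/
def IsTimeTest (I : Set ℝ) (θ : ℝ → ℝ) : Prop :=
  (∃ K, LipschitzWith K θ) ∧ (∀ t, 0 ≤ t → 0 ≤ θ t) ∧
    ∃ K : Set ℝ, IsCompact K ∧ K ⊆ I ∧ ∀ t, 0 ≤ t → t ∉ K → θ t = 0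

/-- The integrated energy inequality `-∬ η θ' ≤ ∫ η(0) θ(0)` for an energy density `η`. -/
def EnergyInequality {d : ℕ} (I : Set ℝ) (η : ℝ → E d → ℝ) : Prop :=
  ∀ θ, IsTimeTest I θ →
    - ∫ t in Ioi 0, (∫ x in cell d, η t x) * deriv θ t ≤ (∫ x in cell d, η 0 x) * θ 0

/-- The integrated energy equality `-∬ η θ' = ∫ η(0) θ(0)` for an energy density `η`. -/
def EnergyEquality {d : ℕ} (I : Set ℝ) (η : ℝ → E d → ℝ) : Prop :=
  ∀ θ, IsTimeTest I θ →
    - ∫ t in Ioi 0, (∫ x in cell d, η t x) * deriv θ t = (∫ x in cell d, η 0 x) * θ 0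

/-- The energy is finite at each time (so that `m = 0` a.e. in the vacuum) and belongs to
`C([0,∞); L¹(𝕋^d))`. -/
structure HasContinuousEnergy {d : ℕ} (F : ℝ × E d → ℝ) (ρ : ℝ → E d → ℝ)
    (q m : ℝ → E d → E d) : Prop where
  vacuum : ∀ t, 0 ≤ t → ∀ᵐ x ∂(volume.restrict (cell d)), ρ t x = 0 → m t x = 0
  cont : ContL1 (Ici 0) (energy F ρ q m)

/-- Dissipative weak solution. -/
structure IsDissipativeWeakSolution {d : ℕ} (F : ℝ × E d → ℝ) (ρ : ℝ → E d → ℝ)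
    (q m : ℝ → E d → E d) (S : ℝ → E d → Matrix (Fin d) (Fin d) ℝ) : Prop where
  weak : IsWeakSolution F ρ q m S
  contEnergy : HasContinuousEnergy F ρ q m
  balance : EnergyInequality (Ici 0) (energy F ρ q m)

/-- Conservative weak solution. -/
structure IsConservativeWeakSolution {d : ℕ} (F : ℝ × E d → ℝ) (ρ : ℝ → E d → ℝ)
    (q m : ℝ → E d → E d) (S : ℝ → E d → Matrix (Fin d) (Fin d) ℝ) : Prop where
  weak : IsWeakSolution F ρ q m S
  contEnergy : HasContinuousEnergy F ρ q m
  balance : EnergyEquality (Ici 0) (energy F ρ q m)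

/-! ### Strong solutions -/

/-- `(ρ, u)` is a strong conservative solution on `(0,T) × 𝕋^d`, with `q = ∇ρ`,
`Du i j = ∂u_i/∂x_j` and `G = ∇ div u`. The functions `ρ`, `∇ρ`, `u`, which are in
`W^{1,∞}((0,T) × 𝕋^d)`, are represented by their continuous versions on `[0,T] × 𝕋^d`.
The momentum equation is written as `∂_t u + (u · ∇) u = -∇ (F_ρ - div F_q)`; where `ρ > 0` this
is, by the continuity equation, the same as
`(ρ u)_t + div (ρ u ⊗ u) = -ρ ∇ (F_ρ - div F_q)`. -/
structure IsStrongSolution {d : ℕ} (F : ℝ × E d → ℝ) (T : ℝ) (ρ : ℝ → E d → ℝ)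
    (q u : ℝ → E d → E d) (Du : ℝ → E d → Matrix (Fin d) (Fin d) ℝ)
    (G : ℝ → E d → E d) : Prop where
  periodic_ρ : Periodic ρ
  periodic_q : Periodic q
  periodic_u : Periodic u
  cont_ρ : ContinuousOn (fun z : ℝ × E d => ρ z.1 z.2) (Icc 0 T ×ˢ univ)
  cont_q : ContinuousOn (fun z : ℝ × E d => q z.1 z.2) (Icc 0 T ×ˢ univ)
  cont_u : ContinuousOn (fun z : ℝ × E d => u z.1 z.2) (Icc 0 T ×ˢ univ)
  nonneg : ∀ t ∈ Icc 0 T, ∀ x, 0 ≤ ρ t x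
  grad_ρ : ∀ i, IsWeakDx T i ρ (fun t x => q t x i)
  dtq : ∃ qt : ℝ → E d → E d, ∀ i, IsWeakDt T (fun t x => q t x i) (fun t x => qt t x i)
  third : ∃ A : Fin d → Fin d → ℝ → E d → ℝ, ∃ B : Fin d → Fin d → Fin d → ℝ → E d → ℝ,
    (∀ i j, IsWeakDx T j (fun t x => q t x i) (A i j)) ∧
      ∀ i j k, IsWeakDx T k (A i j) (B i j k)
  grad_u : ∀ i j, IsWeakDx T j (fun t x => u t x i) (fun t x => Du t x i j)
  grad_div_u : ∀ k, IsWeakDx T k (fun t x => ∑ i, Du t x i i) (fun t x => G t x k)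
  /-- Continuity equation `ρ_t + div (ρ u) = 0`. -/
  continuity : ∃ ρt : ℝ → E d → ℝ, IsWeakDt T ρ ρt ∧
    ∀ᵐ z ∂(volume.restrict (Ioo 0 T ×ˢ cell d)),
      ρt z.1 z.2 + (∑ i, (q z.1 z.2 i * u z.1 z.2 i + ρ z.1 z.2 * Du z.1 z.2 i i)) = 0
  /-- Momentum equation; `D k = ∂_k F_{q_k}(ρ,∇ρ)` and `P = ∇ (F_ρ - div F_q)`. -/
  momentum : ∃ (ut : ℝ → E d → E d) (D : Fin d → ℝ → E d → ℝ) (P : ℝ → E d → E d),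
    (∀ i, IsWeakDt T (fun t x => u t x i) (fun t x => ut t x i)) ∧
    (∀ k, IsWeakDx T k (fun t x => Fq F k (ρ t x, q t x)) (D k)) ∧
    (∀ i, IsWeakDx T i (fun t x => Fρ F (ρ t x, q t x) - ∑ k, D k t x) (fun t x => P t x i)) ∧
    ∀ᵐ z ∂(volume.restrict (Ioo 0 T ×ˢ cell d)), ∀ i,
      ut z.1 z.2 i + (∑ j, u z.1 z.2 j * Du z.1 z.2 i j) = - P z.1 z.2 i
  /-- Conservation of energy, with `m = ρ u`. -/
  conservative : EnergyEquality (Ico 0 T) (energy F ρ q fun t x => ρ t x • u t x)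

/-! ### The relative energy and the relative stress terms -/

/-- `½ ρ |m/ρ - ū|² + F(ρ,∇ρ | ρ̄,∇ρ̄)`. -/
def relEnergy {d : ℕ} (F : ℝ × E d → ℝ) (ρ : ℝ → E d → ℝ) (q m : ℝ → E d → E d)
    (ρb : ℝ → E d → ℝ) (qb ub : ℝ → E d → E d) (t : ℝ) (x : E d) : ℝ :=
  1 / 2 * ρ t x * ‖(ρ t x)⁻¹ • m t x - ub t x‖ ^ 2
    + rel F (ρ t x, q t x) (ρb t x, qb t x)

/-- `ρ (m/ρ - ū) ⊗ (m/ρ - ū) : ∇ū + (div ū) s(ρ,∇ρ | ρ̄,∇ρ̄)`, with `Dub i j = ∂ū_i/∂x_j`. -/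
def convTerm {d : ℕ} (F : ℝ × E d → ℝ) (ρ : ℝ → E d → ℝ) (q m : ℝ → E d → E d)
    (ρb : ℝ → E d → ℝ) (qb ub : ℝ → E d → E d) (Dub : ℝ → E d → Matrix (Fin d) (Fin d) ℝ)
    (t : ℝ) (x : E d) : ℝ :=
  (∑ i, ∑ j, ρ t x * (m t x i / ρ t x - ub t x i) * (m t x j / ρ t x - ub t x j) * Dub t x i j)
    + (∑ i, Dub t x i i) * rel (s F) (ρ t x, q t x) (ρb t x, qb t x)

/-- `∇ū : H(ρ,∇ρ | ρ̄,∇ρ̄) + ∇ div ū · r(ρ,∇ρ | ρ̄,∇ρ̄)`, with `Dub i j = ∂ū_i/∂x_j` and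
`Gb = ∇ div ū`. -/
def stressTerm {d : ℕ} (F : ℝ × E d → ℝ) (ρ : ℝ → E d → ℝ) (q : ℝ → E d → E d)
    (ρb : ℝ → E d → ℝ) (qb : ℝ → E d → E d) (Dub : ℝ → E d → Matrix (Fin d) (Fin d) ℝ)
    (Gb : ℝ → E d → E d) (t : ℝ) (x : E d) : ℝ :=
  (∑ i, ∑ j, Dub t x i j * rel (H F i j) (ρ t x, q t x) (ρb t x, qb t x))
    + ∑ k, Gb t x k * rel (r F k) (ρ t x, q t x) (ρb t x, qb t x)

end EulerKorteweg

end

set_option linter.unusedSectionVars false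

/-! Write $z=(\rho,q)$ and $\bar z=(\bar\rho,\nabla\bar\rho)$. Since $F(z\,|\,\bar z)=F(z)+s(\bar
z)-DF(\bar z)z$ and $\frac12\rho|m/\rho-\bar u|^2=\frac12|m|^2/\rho+\frac12\rho|\bar u|^2-m\cdot\bar
u$, the relative energy is the energy of the weak solution plus `StrongRep.linear`, which is affine
in $(\rho,q,m)$ with coefficients made from the strong solution (`StrongRep.relEnergy_eq`). The
energy inequality controls the first part. The second evolves by an exact identity
(`StrongRep.relative_identity`): the mass equation is tested with $\frac12|\bar u|^2$, with
$F_\rho(\bar z)$ and with $\operatorname{div}F_q(\bar z)$, the momentum equation with $\bar u$, and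
$s(\bar z)$ contributes its own time derivative.

The pointwise core is `PhaseDomain.relative_flux`. The continuity equation and its gradient give the
transport law $\partial_t\bar z+(\operatorname{div}\bar u)\bar z+(0,(\nabla\bar u)^T\bar
q+\bar\rho\nabla\operatorname{div}\bar u)+(\bar u\cdot\nabla)\bar z=0$ (`StrongRep.transport`).
Pairing it with $D^2F(\bar z)(z-\bar z)$ produces the linear parts of $s$, $H$ and $r$ at $\bar z$,
because $Ds(\bar z)w=D^2F(\bar z)(w,\bar z)$ and similarly for the Hessian terms of $DH$ and $Dr$.
With the momentum equation for $\bar u$, everything that is left over is a divergence: that of $\bar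
u\,s(\bar z)$ (`divergence_identity`), and that of $\rho$ times the Lie bracket $[\bar u,V]=(\bar
u\cdot\nabla)V-(V\cdot\nabla)\bar u$, where $V=F_q(\bar z)$ (`commutator_identity`). As
$\operatorname{div}[\bar u,V]=\bar
u\cdot\nabla\operatorname{div}V-V\cdot\nabla\operatorname{div}\bar u$, only gradients of divergences
occur. These are bounded: $\nabla\operatorname{div}\bar u$ by assumption, and
$\nabla\operatorname{div}V$ as the difference of $\nabla F_\rho(\bar z)$ and
$P=\nabla(F_\rho-\operatorname{div}F_q)$.

The coefficients have only bounded weak derivatives and so are not admissible test functions. They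
are mollified and multiplied by a cutoff $\theta(t)$ supported in $(0,T)$. On the support of
$\theta$ fine mollification commutes with weak derivatives (`WD.fderiv_moll`), and the limit is
taken by dominated convergence, since the fields of the weak solution are integrable and the
mollified coefficients are bounded and converge almost everywhere (`BddTendsto.int`). Smoothness of
$F$ up to $\rho=0$ from one side is enough, because mollification keeps $\bar z$ in a compact convex
set (`WD.comp`).

There results an inequality for all $\theta\ge0$. Continuity in time of the energy and of the
integral of `StrongRep.linear` turns it into the inequality at every $t\in[0,T]$, endpoints included
(`le_of_forall_timeCutoff`). -/

namespace EulerKorteweg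

/-! ### Mollification and the calculus of bounded weak derivatives. -/

section Mollification

open scoped Convolution

variable {X : Type*} [NormedAddCommGroup X] [NormedSpace ℝ X] [FiniteDimensional ℝ X]
  [MeasureSpace X] [BorelSpace X] [(volume : Measure X).IsAddHaarMeasure]
  {V : Type*} [NormedAddCommGroup V] [NormedSpace ℝ V] [CompleteSpace V]
  {W : Type*} [NormedAddCommGroup W] [NormedSpace ℝ W] [CompleteSpace W]

/-- Bounded measurable functions. -/
structure BddMeas (f : X → V) : Prop where
  meas : StronglyMeasurable f
  bdd : ∃ C, ∀ x, ‖f x‖ ≤ C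

theorem BddMeas.exists_bound {f : X → V} (hf : BddMeas f) : ∃ C, 0 ≤ C ∧ ∀ x, ‖f x‖ ≤ C := by
  obtain ⟨C, hC⟩ := hf.bdd
  exact ⟨max C 0, le_max_right _ _, fun x => (hC x).trans (le_max_left _ _)⟩

theorem BddMeas.locallyIntegrable {f : X → V} (hf : BddMeas f) :
    LocallyIntegrable f := by
  obtain ⟨C, hC⟩ := hf.bdd
  exact (locallyIntegrable_const C).mono hf.meas.aestronglyMeasurable
    (Eventually.of_forall fun x => (hC x).trans (le_abs_self C))

/-- A bump function with outer radius `1/(n+1)`. -/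
noncomputable def bump (X : Type*) [NormedAddCommGroup X] (n : ℕ) : ContDiffBump (0 : X) where
  rIn := 1 / (2 * (n + 1))
  rOut := 1 / (n + 1)
  rIn_pos := by positivity
  rIn_lt_rOut := by
    apply one_div_lt_one_div_of_lt <;> [positivity; (have : (0:ℝ) ≤ n := n.cast_nonneg; linarith)]

/-- Mollification by the `n`-th bump function. -/
noncomputable def moll (n : ℕ) (f : X → V) : X → V :=
  (bump X n).normed volume ⋆[ContinuousLinearMap.lsmul ℝ ℝ, volume] f

theorem moll_apply (n : ℕ) (f : X → V) (x : X) :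
    moll n f x = ∫ y, (bump X n).normed volume y • f (x - y) := rfl

theorem moll_apply' (n : ℕ) (f : X → V) (x : X) :
    moll n f x = ∫ y, (bump X n).normed volume (x - y) • f y := by
  rw [moll_apply, ← integral_sub_left_eq_self _ _ x]
  simp

theorem moll_integrable (n : ℕ) {f : X → V} (hf : BddMeas f) (x : X) :
    Integrable fun y => (bump X n).normed volume y • f (x - y) := by
  obtain ⟨C, hC⟩ := hf.bdd
  refine (bump X n).integrable_normed.smul_bdd (C := C) ?_ (Eventually.of_forall fun y => hC _)
  exact (hf.meas.comp_measurable (measurable_const.sub measurable_id)).aestronglyMeasurable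

theorem moll_contDiff (n : ℕ) {f : X → V} (hf : BddMeas f) : ContDiff ℝ ∞ (moll n f) :=
  (bump X n).hasCompactSupport_normed.contDiff_convolution_left _
    (bump X n).contDiff_normed hf.locallyIntegrable

theorem moll_continuous (n : ℕ) {f : X → V} (hf : BddMeas f) : Continuous (moll n f) :=
  (moll_contDiff n hf).continuous

theorem moll_differentiable (n : ℕ) {f : X → V} (hf : BddMeas f) :
    Differentiable ℝ (moll n f) :=
  (moll_contDiff n hf).differentiable (by simp)

theorem moll_norm_le (n : ℕ) {f : X → V} {C : ℝ} (hC : ∀ x, ‖f x‖ ≤ C) (x : X) :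
    ‖moll n f x‖ ≤ C := by
  calc ‖moll n f x‖ ≤ ∫ y, (bump X n).normed volume y * C := by
        refine norm_integral_le_of_norm_le ((bump X n).integrable_normed.mul_const C)
          (Eventually.of_forall fun y => ?_)
        rw [ContinuousLinearMap.lsmul_apply, norm_smul, Real.norm_of_nonneg ((bump X n).nonneg_normed y)]
        exact mul_le_mul_of_nonneg_left (hC _) ((bump X n).nonneg_normed y)
    _ = C := by rw [integral_mul_const, (bump X n).integral_normed, one_mul]

theorem moll_tendsto {f : X → V} (hf : BddMeas f) :
    ∀ᵐ x : X, Tendsto (fun n => moll n f x) atTop (𝓝 (f x)) := by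
  -- The outer radius of `bump` is twice the inner one; Lebesgue differentiation needs this ratio
  -- bounded in `n`.
  refine ContDiffBump.ae_convolution_tendsto_right_of_locallyIntegrable (K := 2)
    (φ := fun n => bump X n) tendsto_one_div_add_atTop_nhds_zero_nat
    (Eventually.of_forall fun n => ?_) hf.locallyIntegrable
  simp only [bump]
  rw [one_div, one_div, mul_inv]
  linarith

theorem moll_sum {ι : Type*} (s : Finset ι) (n : ℕ) {f : ι → X → V} (hf : ∀ i, BddMeas (f i))
    (x : X) : moll n (fun y => ∑ i ∈ s, f i y) x = ∑ i ∈ s, moll n (f i) x := by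
  simp only [moll_apply, Finset.smul_sum]
  exact integral_finsetSum _ fun i _ => moll_integrable n (hf i) x

theorem moll_add_period (n : ℕ) {f : X → V} {a : X} (h : ∀ x, f (x + a) = f x) (x : X) :
    moll n f (x + a) = moll n f x := by
  simp only [moll_apply]
  congr 1; funext y
  rw [show x + a - y = x - y + a by abel, h]

/-- A mollification is an average against a probability measure, and closed convex sets contain the
averages of their elements. This keeps mollified states in the region where the constitutive
functions are smooth. -/
theorem moll_mem_of_convex (n : ℕ) {f : X → V} (hf : BddMeas f) {K : Set V}
    (hK : Convex ℝ K) (hKc : IsClosed K) {x : X}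
    (h : ∀ y, dist y x < 1 / (n + 1) → f y ∈ K) : moll n f x ∈ K := by
  set b : X → NNReal := fun y => ⟨(bump X n).normed volume y, (bump X n).nonneg_normed y⟩ with hb
  have hbm : Measurable b := ((bump X n).continuous_normed.subtype_mk _).measurable
  have hbc : ∀ y, ((b y : NNReal) : ℝ) = (bump X n).normed volume y := fun y => rfl
  have hprob : IsProbabilityMeasure ((volume : Measure X).withDensity fun y => b y) := by
    constructor
    rw [withDensity_apply _ MeasurableSet.univ, Measure.restrict_univ]
    have h1 := ofReal_integral_eq_lintegral_ofReal ((bump X n).integrable_normed (μ := volume))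
      (Eventually.of_forall fun y => (bump X n).nonneg_normed y)
    rw [(bump X n).integral_normed, ENNReal.ofReal_one] at h1
    rw [h1]
    congr 1; funext y
    rw [← hbc, ENNReal.ofReal_coe_nnreal]
  have h1 : moll n f x = ∫ y, f (x - y) ∂((volume : Measure X).withDensity fun y => b y) := by
    rw [integral_withDensity_eq_integral_smul hbm]; rfl
  rw [h1]
  refine hK.integral_mem hKc ?_ ?_
  · rw [ae_withDensity_iff hbm.coe_nnreal_ennreal]
    refine Eventually.of_forall fun y hy => h _ ?_
    have : y ∈ Function.support ((bump X n).normed volume) := by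
      intro h0
      apply hy
      have : b y = 0 := NNReal.eq (by rw [hbc, h0]; rfl)
      simp [this]
    rw [ContDiffBump.support_normed_eq, mem_ball_zero_iff] at this
    simpa [dist_eq_norm, bump] using this
  · rw [integrable_withDensity_iff_integrable_smul hbm]
    exact moll_integrable n hf x

/-! ### Weak directional derivatives on an open set -/

/-- `g` is the weak derivative of `f` in the direction `v` on the open set `O`. -/
def WD (O : Set X) (f g : X → V) (v : X) : Prop :=
  ∀ φ : X → ℝ, ContDiff ℝ ∞ φ → HasCompactSupport φ → tsupport φ ⊆ O →
    ∫ x, fderiv ℝ φ x v • f x = - ∫ x, φ x • g x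

theorem moll_fderiv_apply (n : ℕ) {f : X → V} (hf : BddMeas f) (x v : X) :
    fderiv ℝ (moll n f) x v = ∫ y, fderiv ℝ ((bump X n).normed volume) (x - y) v • f y := by
  have h1 := (bump X n).hasCompactSupport_normed.hasFDerivAt_convolution_left
    (ContinuousLinearMap.lsmul ℝ ℝ : ℝ →L[ℝ] V →L[ℝ] V)
    ((bump X n).contDiff_normed (μ := volume) (n := 1)) hf.locallyIntegrable x
  have h2 : HasFDerivAt (moll n f) _ x := h1
  rw [h2.fderiv, convolution_def]
  have hint : Integrable fun t =>
      ((ContinuousLinearMap.lsmul ℝ ℝ : ℝ →L[ℝ] V →L[ℝ] V).precompL X)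
        (fderiv ℝ ((bump X n).normed volume) t) (f (x - t)) := by
    refine HasCompactSupport.convolutionExists_left _
      ((bump X n).hasCompactSupport_normed.fderiv ℝ) ?_ hf.locallyIntegrable x
    exact ((bump X n).contDiff_normed (μ := volume) (n := 1)).continuous_fderiv (by simp)
  rw [ContinuousLinearMap.integral_apply hint, ← integral_sub_left_eq_self _ _ x]
  simp

/-- The reflected bump `y ↦ b (x - y)` is an admissible test function as soon as its ball lies in
`O`; the sign from the reflection cancels the sign in the definition of `WD`. -/
theorem WD.fderiv_moll {O : Set X} {f g : X → V} {v : X} (h : WD O f g v) (hf : BddMeas f)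
    (n : ℕ) {x : X} (hx : Metric.closedBall x (1 / (n + 1)) ⊆ O) :
    fderiv ℝ (moll n f) x v = moll n g x := by
  set b := (bump X n).normed volume with hb
  have hbc : ContDiff ℝ ∞ b := (bump X n).contDiff_normed
  have hs : tsupport (fun y => b (x - y)) ⊆ Metric.closedBall x (1 / (n + 1)) := by
    refine closure_minimal (fun y hy => ?_) Metric.isClosed_closedBall
    have : x - y ∈ Function.support b := hy
    rw [hb, ContDiffBump.support_normed_eq, mem_ball_zero_iff] at this
    rw [Metric.mem_closedBall, dist_comm, dist_eq_norm]
    exact this.le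
  have h1 := h (fun y => b (x - y)) (hbc.comp (contDiff_const.sub contDiff_id))
    ((isCompact_closedBall x _).of_isClosed_subset (isClosed_tsupport _) hs) (hs.trans hx)
  have h2 : ∀ y, fderiv ℝ (fun y => b (x - y)) y v = - fderiv ℝ b (x - y) v := by
    intro y
    have h3 : HasFDerivAt (fun y => b (x - y)) _ y :=
      ((hbc.differentiable (by simp)) (x - y)).hasFDerivAt.comp y
        ((hasFDerivAt_id y).const_sub x)
    rw [h3.fderiv]; simp
  rw [moll_fderiv_apply n hf, moll_apply']
  simp only [h2, neg_smul, integral_neg, neg_inj] at h1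
  exact h1

/-- A compact subset of `O` has positive distance from the complement, so one threshold in `n`
serves all its points. -/
theorem exists_margin {S O : Set X} (hS : IsCompact S) (hO : IsOpen O) (h : S ⊆ O) :
    ∀ᶠ n : ℕ in atTop, ∀ x ∈ S, Metric.closedBall x (1 / (n + 1 : ℝ)) ⊆ O := by
  obtain ⟨δ, hδ, hd⟩ := hS.exists_cthickening_subset_open hO h
  filter_upwards [tendsto_one_div_add_atTop_nhds_zero_nat.eventually (gt_mem_nhds hδ)] with n hn
  intro x hx
  refine (Metric.closedBall_subset_cthickening hx _).trans ?_
  exact (Metric.cthickening_mono hn.le _).trans hd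

/-- Classical integration by parts for the approximants, then dominated convergence. The hypotheses
are local to compact sets because mollification commutes with weak derivatives only away from the
boundary of `O`. The product and chain rules follow from it. -/
theorem WD.of_limit {O : Set X} {h k : ℕ → X → V} {f g : X → V} {v : X}
    (H : ∀ S, IsCompact S → S ⊆ O → ∃ C, ∀ᶠ n in atTop, ContinuousOn (h n) S ∧
      ContinuousOn (k n) S ∧ ∀ x ∈ S, HasLineDerivAt ℝ (h n) (k n x) x v ∧
        ‖h n x‖ ≤ C ∧ ‖k n x‖ ≤ C)
    (hf : ∀ᵐ x, x ∈ O → Tendsto (fun n => h n x) atTop (𝓝 (f x)))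
    (hg : ∀ᵐ x, x ∈ O → Tendsto (fun n => k n x) atTop (𝓝 (g x))) : WD O f g v := by
  intro φ hφ hφc hφO
  obtain ⟨C, hC⟩ := H _ hφc hφO
  have hφ' : Continuous fun x => fderiv ℝ φ x v :=
    (hφ.continuous_fderiv (by simp)).clm_apply continuous_const
  have hφ0 : ∀ x, x ∉ tsupport φ → φ x = 0 := fun x hx => image_eq_zero_of_notMem_tsupport hx
  have hφ0' : ∀ x, x ∉ tsupport φ → fderiv ℝ φ x v = 0 := fun x hx => by
    rw [image_eq_zero_of_notMem_tsupport (fun h => hx (tsupport_fderiv_subset ℝ h))]; rfl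
  have key : ∀ (a : X → ℝ) (w : ℕ → X → V) (w' : X → V), Continuous a →
      (∀ x, x ∉ tsupport φ → a x = 0) →
      (∀ᶠ n in atTop, ContinuousOn (w n) (tsupport φ) ∧ ∀ x ∈ tsupport φ, ‖w n x‖ ≤ C) →
      (∀ᵐ x, x ∈ O → Tendsto (fun n => w n x) atTop (𝓝 (w' x))) →
      (∀ᶠ n in atTop, Integrable fun x => a x • w n x) ∧
      Tendsto (fun n => ∫ x, a x • w n x) atTop (𝓝 (∫ x, a x • w' x)) := by
    intro a w w' ha ha0 hw hlim
    have hint : ∀ᶠ n in atTop, Integrable fun x => a x • w n x := by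
      filter_upwards [hw] with n hn
      rw [← integrableOn_iff_integrable_of_support_subset (s := tsupport φ)]
      · exact (ha.continuousOn.smul hn.1).integrableOn_compact hφc
      · intro x hx
        by_contra hxs
        exact hx (by simp [ha0 x hxs])
    refine ⟨hint, tendsto_integral_filter_of_dominated_convergence (fun x => ‖a x‖ * C)
      (hint.mono fun n hn => hn.aestronglyMeasurable) ?_ ?_ ?_⟩
    · filter_upwards [hw] with n hn
      refine Eventually.of_forall fun x => ?_
      by_cases hx : x ∈ tsupport φ
      · rw [norm_smul]
        exact mul_le_mul_of_nonneg_left (hn.2 x hx) (norm_nonneg _)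
      · simp [ha0 x hx]
    · refine Integrable.mul_const (Continuous.integrable_of_hasCompactSupport ha.norm ?_) C
      exact HasCompactSupport.norm (HasCompactSupport.intro hφc ha0)
    · filter_upwards [hlim] with x hx
      by_cases hxs : x ∈ tsupport φ
      · exact (hx (hφO hxs)).const_smul (a x)
      · simp [ha0 x hxs]
  obtain ⟨i1, t1⟩ := key (fun x => fderiv ℝ φ x v) h f hφ' hφ0'
    (hC.mono fun n hn => ⟨hn.1, fun x hx => (hn.2.2 x hx).2.1⟩) hf
  obtain ⟨i2, t2⟩ := key φ k g hφ.continuous hφ0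
    (hC.mono fun n hn => ⟨hn.2.1, fun x hx => (hn.2.2 x hx).2.2⟩) hg
  obtain ⟨i3, -⟩ := key φ h f hφ.continuous hφ0
    (hC.mono fun n hn => ⟨hn.1, fun x hx => (hn.2.2 x hx).2.1⟩) hf
  refine tendsto_nhds_unique t1 (t2.neg.congr' ?_)
  filter_upwards [hC, i1, i2, i3] with n hn j1 j2 j3
  rw [neg_eq_iff_eq_neg]
  exact integral_bilinear_hasLineDerivAt_right_eq_neg_left_of_integrable
    (B := (ContinuousLinearMap.lsmul ℝ ℝ : ℝ →L[ℝ] V →L[ℝ] V)) j1 j2 j3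
    (fun x _ => ((hφ.differentiable (by simp)) x).hasFDerivAt.hasLineDerivAt v)
    (fun x hx => (hn.2.2 x hx).1)

theorem WD.mul {O : Set X} (hO : IsOpen O) {f g f' g' : X → ℝ} {v : X} (hf : BddMeas f)
    (hg : BddMeas g) (hf' : BddMeas f') (hg' : BddMeas g') (h1 : WD O f f' v) (h2 : WD O g g' v) :
    WD O (fun x => f x * g x) (fun x => f' x * g x + f x * g' x) v := by
  refine WD.of_limit (h := fun n x => moll n f x * moll n g x)
    (k := fun n x => moll n f' x * moll n g x + moll n f x * moll n g' x) ?_ ?_ ?_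
  · intro S hS hSO
    obtain ⟨A, hA, hA'⟩ := hf.exists_bound
    obtain ⟨B, hB, hB'⟩ := hg.exists_bound
    obtain ⟨A1, hA1, hA1'⟩ := hf'.exists_bound
    obtain ⟨B1, hB1, hB1'⟩ := hg'.exists_bound
    refine ⟨A * B + (A1 * B + A * B1), ?_⟩
    filter_upwards [exists_margin hS hO hSO] with n hn
    refine ⟨((moll_continuous n hf).mul (moll_continuous n hg)).continuousOn,
      (((moll_continuous n hf').mul (moll_continuous n hg)).add
        ((moll_continuous n hf).mul (moll_continuous n hg'))).continuousOn, fun x hx => ⟨?_, ?_, ?_⟩⟩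
    · have := (((moll_differentiable n hf) x).hasFDerivAt.mul
        ((moll_differentiable n hg) x).hasFDerivAt).hasLineDerivAt v
      convert! this using 1
      simp only [add_apply, smul_apply, smul_eq_mul]
      rw [h1.fderiv_moll hf n (hn x hx), h2.fderiv_moll hg n (hn x hx)]
      ring
    all_goals
      have e1 := moll_norm_le n hA' x
      have e2 := moll_norm_le n hB' x
      have e3 := moll_norm_le n hA1' x
      have e4 := moll_norm_le n hB1' x
    · rw [norm_mul]
      have := mul_le_mul e1 e2 (norm_nonneg _) hA
      have := mul_nonneg hA1 hB
      have := mul_nonneg hA hB1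
      linarith
    · refine (norm_add_le _ _).trans ?_
      rw [norm_mul, norm_mul]
      have := mul_le_mul e3 e2 (norm_nonneg _) hA1
      have := mul_le_mul e1 e4 (norm_nonneg _) hA
      have := mul_nonneg hA hB
      linarith
  · filter_upwards [moll_tendsto hf, moll_tendsto hg] with x a b _
    exact a.mul b
  · filter_upwards [moll_tendsto hf, moll_tendsto hg, moll_tendsto hf', moll_tendsto hg']
      with x a b c d _
    exact (c.mul b).add (a.mul d)

/-- The set `Ω` need not be open. Mollified fields stay in the convex compact set `K ⊆ Ω`, so
derivatives of `G` within `Ω` suffice for the classical chain rule before the limit. -/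
theorem WD.comp {O : Set X} (hO : IsOpen O) {Ω K : Set W} {Z Z' : X → W} {G : W → ℝ} {v : X}
    (hΩ : UniqueDiffOn ℝ Ω) (hG : ContDiffOn ℝ 1 G Ω) (hK : Convex ℝ K) (hKc : IsCompact K)
    (hKΩ : K ⊆ Ω) (hZK : ∀ x ∈ O, Z x ∈ K) (hZ : BddMeas Z) (hZ' : BddMeas Z')
    (h : WD O Z Z' v) :
    WD O (fun x => G (Z x)) (fun x => fderivWithin ℝ G Ω (Z x) (Z' x)) v := by
  have hG' : ContinuousOn (fderivWithin ℝ G Ω) Ω := hG.continuousOn_fderivWithin hΩ le_rfl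
  have hmem : ∀ n : ℕ, ∀ x, Metric.closedBall x (1 / (n + 1 : ℝ)) ⊆ O → moll n Z x ∈ K :=
    fun n x hx => moll_mem_of_convex n hZ hK hKc.isClosed
      fun y hy => hZK y (hx (Metric.mem_closedBall.2 hy.le))
  refine WD.of_limit (h := fun n x => G (moll n Z x))
    (k := fun n x => fderivWithin ℝ G Ω (moll n Z x) (moll n Z' x)) ?_ ?_ ?_
  · intro S hS hSO
    obtain ⟨A, hA⟩ := hKc.exists_bound_of_continuousOn (hG.continuousOn.mono hKΩ)
    obtain ⟨B, hB⟩ := hKc.exists_bound_of_continuousOn (hG'.mono hKΩ)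
    obtain ⟨D, hD, hD'⟩ := hZ'.exists_bound
    refine ⟨|A| + |B| * D, ?_⟩
    -- The chain rule at a point of `S` needs the mollified field to lie in `Ω` on a whole
    -- neighbourhood, hence the margin for a thickening of `S`.
    obtain ⟨δ, hδ, hd⟩ := hS.exists_cthickening_subset_open hO hSO
    filter_upwards [exists_margin (hS.cthickening (r := δ)) hO hd] with n hn
    have hSn : ∀ x ∈ S, x ∈ Metric.cthickening δ S := fun x hx =>
      Metric.self_subset_cthickening S hx
    have hmS : MapsTo (moll n Z) S Ω := fun x hx => hKΩ (hmem n x (hn x (hSn x hx)))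
    refine ⟨hG.continuousOn.comp (moll_continuous n hZ).continuousOn hmS,
      (hG'.comp (moll_continuous n hZ).continuousOn hmS).clm_apply
        (moll_continuous n hZ').continuousOn, fun x hx => ⟨?_, ?_, ?_⟩⟩
    · have h1 : HasFDerivWithinAt G (fderivWithin ℝ G Ω (moll n Z x)) Ω (moll n Z x) :=
        ((hG.differentiableOn one_ne_zero) _ (hmS hx)).hasFDerivWithinAt
      have h2 : ∀ᶠ y in 𝓝 x, moll n Z y ∈ Ω := by
        filter_upwards [Metric.ball_mem_nhds x hδ] with y hy
        refine hKΩ (hmem n y (hn y ?_))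
        exact Metric.closedBall_subset_cthickening hx δ (Metric.mem_closedBall.2 (le_of_lt hy))
      have h3 := (h1.comp_hasFDerivAt x ((moll_differentiable n hZ) x).hasFDerivAt h2).hasLineDerivAt v
      rw [ContinuousLinearMap.comp_apply, h.fderiv_moll hZ n (hn x (hSn x hx))] at h3
      exact h3
    · have := hA _ (hmem n x (hn x (hSn x hx)))
      have h0 : 0 ≤ |B| * D := by positivity
      linarith [le_abs_self A]
    · have h1 := (fderivWithin ℝ G Ω (moll n Z x)).le_opNorm (moll n Z' x)
      have h2 := (hB _ (hmem n x (hn x (hSn x hx)))).trans (le_abs_self B)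
      have h3 := mul_le_mul h2 (moll_norm_le n hD' x) (norm_nonneg _) (abs_nonneg B)
      linarith [abs_nonneg A]
  · filter_upwards [moll_tendsto hZ] with x a hx
    have hev : ∀ᶠ n : ℕ in atTop, moll n Z x ∈ Ω := by
      filter_upwards [exists_margin isCompact_singleton hO (singleton_subset_iff.2 hx)] with n hn
      exact hKΩ (hmem n x (hn x rfl))
    exact ((hG.continuousOn _ (hKΩ (hZK x hx))).tendsto).comp
      (tendsto_nhdsWithin_iff.2 ⟨a, hev⟩)
  · filter_upwards [moll_tendsto hZ, moll_tendsto hZ'] with x a b hx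
    have hev : ∀ᶠ n : ℕ in atTop, moll n Z x ∈ Ω := by
      filter_upwards [exists_margin isCompact_singleton hO (singleton_subset_iff.2 hx)] with n hn
      exact hKΩ (hmem n x (hn x rfl))
    have h1 : Tendsto (fun n => fderivWithin ℝ G Ω (moll n Z x)) atTop
        (𝓝 (fderivWithin ℝ G Ω (Z x))) :=
      ((hG' _ (hKΩ (hZK x hx))).tendsto).comp (tendsto_nhdsWithin_iff.2 ⟨a, hev⟩)
    exact ((isBoundedBilinearMap_apply (𝕜 := ℝ) (E := W) (F := ℝ)).continuous.tendsto
      (fderivWithin ℝ G Ω (Z x), Z' x)).comp (h1.prodMk_nhds b)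

/-- Near a point of `O` both candidates have the same fine mollifications, namely the derivative of
that of `f`, and these converge almost everywhere. -/
theorem WD.unique {O : Set X} (hO : IsOpen O) {f g g' : X → V} {v : X} (hf : BddMeas f)
    (hg : BddMeas g) (hg' : BddMeas g') (h : WD O f g v) (h' : WD O f g' v) :
    ∀ᵐ x, x ∈ O → g x = g' x := by
  filter_upwards [moll_tendsto hg, moll_tendsto hg'] with x a b hx
  refine tendsto_nhds_unique (a.congr' ?_) b
  filter_upwards [exists_margin isCompact_singleton hO (singleton_subset_iff.2 hx)] with n hn
  rw [← h.fderiv_moll hf n (hn x rfl), h'.fderiv_moll hf n (hn x rfl)]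

theorem WD.congr {O : Set X} {f f' g g' : X → V} {v : X} (h : WD O f g v)
    (hf : ∀ᵐ x, x ∈ O → f x = f' x) (hg : ∀ᵐ x, x ∈ O → g x = g' x) : WD O f' g' v := by
  intro φ hφ hφc hφO
  have hφ0' : ∀ x, x ∉ O → fderiv ℝ φ x v = 0 := fun x hx => by
    rw [image_eq_zero_of_notMem_tsupport (fun h => hx (hφO (tsupport_fderiv_subset ℝ h)))]; rfl
  have hφ0 : ∀ x, x ∉ O → φ x = 0 := fun x hx =>
    image_eq_zero_of_notMem_tsupport fun h => hx (hφO h)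
  have h1 : ∫ x, fderiv ℝ φ x v • f' x = ∫ x, fderiv ℝ φ x v • f x := by
    refine integral_congr_ae (hf.mono fun x hx => ?_)
    by_cases hxO : x ∈ O
    · simp only [hx hxO]
    · simp only [hφ0' x hxO, zero_smul]
  have h2 : ∫ x, φ x • g' x = ∫ x, φ x • g x := by
    refine integral_congr_ae (hg.mono fun x hx => ?_)
    by_cases hxO : x ∈ O
    · simp only [hx hxO]
    · simp only [hφ0 x hxO, zero_smul]
  rw [h1, h2]
  exact h φ hφ hφc hφO

theorem WD.integrable_test {f : X → V} (hf : BddMeas f) {a : X → ℝ} (ha : Continuous a)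
    (hac : HasCompactSupport a) : Integrable fun x => a x • f x := by
  obtain ⟨C, hC⟩ := hf.bdd
  exact (ha.integrable_of_hasCompactSupport hac).smul_bdd (C := C) hf.meas.aestronglyMeasurable
    (Eventually.of_forall hC)

theorem hasCompactSupport_fderiv_apply {φ : X → ℝ} (h : HasCompactSupport φ) (v : X) :
    HasCompactSupport fun x => fderiv ℝ φ x v :=
  (h.fderiv ℝ).comp_left (g := fun L : X →L[ℝ] ℝ => L v) rfl

theorem WD.sub {O : Set X} {f f' g g' : X → V} {v : X} (hf : BddMeas f) (hg : BddMeas g)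
    (hf' : BddMeas f') (hg' : BddMeas g') (h : WD O f f' v) (h' : WD O g g' v) :
    WD O (fun x => f x - g x) (fun x => f' x - g' x) v := by
  intro φ hφ hφc hφO
  have hφ' : Continuous fun x => fderiv ℝ φ x v :=
    (hφ.continuous_fderiv (by simp)).clm_apply continuous_const
  have hc := hasCompactSupport_fderiv_apply hφc v
  simp only [smul_sub]
  rw [integral_sub (WD.integrable_test hf hφ' hc) (WD.integrable_test hg hφ' hc),
    integral_sub (WD.integrable_test hf' hφ.continuous hφc)
      (WD.integrable_test hg' hφ.continuous hφc), h φ hφ hφc hφO, h' φ hφ hφc hφO]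
  abel

theorem WD.sum {ι : Type*} (s : Finset ι) {O : Set X} {f f' : ι → X → V} {v : X}
    (hf : ∀ i, BddMeas (f i)) (hf' : ∀ i, BddMeas (f' i)) (h : ∀ i, WD O (f i) (f' i) v) :
    WD O (fun x => ∑ i ∈ s, f i x) (fun x => ∑ i ∈ s, f' i x) v := by
  intro φ hφ hφc hφO
  have hφ' : Continuous fun x => fderiv ℝ φ x v :=
    (hφ.continuous_fderiv (by simp)).clm_apply continuous_const
  have hc := hasCompactSupport_fderiv_apply hφc v
  simp only [Finset.smul_sum]
  rw [integral_finsetSum _ fun i _ => WD.integrable_test (hf i) hφ' hc,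
    integral_finsetSum _ fun i _ => WD.integrable_test (hf' i) hφ.continuous hφc,
    ← Finset.sum_neg_distrib]
  exact Finset.sum_congr rfl fun i _ => h i φ hφ hφc hφO

/-- Weak derivatives in two directions commute. -/
theorem WD.swap {O : Set X} {f g h k : X → V} {v w : X} (hg : WD O f g v)
    (hh : WD O f h w) (hk : WD O g k w) : WD O h k v := by
  intro φ hφ hφc hφO
  have hsm : ∀ u : X, ContDiff ℝ ∞ fun x => fderiv ℝ φ x u := fun u =>
    (hφ.fderiv_right (m := ∞) (by simp)).clm_apply contDiff_const
  have hsub : ∀ u : X, tsupport (fun x => fderiv ℝ φ x u) ⊆ O := fun u =>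
    (tsupport_fderiv_apply_subset ℝ u).trans hφO
  have e1 := hh _ (hsm v) (hasCompactSupport_fderiv_apply hφc v) (hsub v)
  have e2 := hg _ (hsm w) (hasCompactSupport_fderiv_apply hφc w) (hsub w)
  have e3 := hk φ hφ hφc hφO
  -- All the symmetry comes from the smooth test function; `f` is integrated against the same mixed
  -- derivative in both orders.
  have hsymm : ∀ x, fderiv ℝ (fun x => fderiv ℝ φ x v) x w
      = fderiv ℝ (fun x => fderiv ℝ φ x w) x v := by
    intro x
    have hd : DifferentiableAt ℝ (fderiv ℝ φ) x :=
      ((hφ.fderiv_right (m := ∞) (by simp)).differentiable (by simp)) x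
    have hs : IsSymmSndFDerivAt ℝ φ x :=
      hφ.contDiffAt.isSymmSndFDerivAt (by
        rw [minSmoothness_of_isRCLikeNormedField]
        exact WithTop.coe_le_coe.2 (le_top : (2 : ℕ∞) ≤ ⊤))
    rw [fderiv_clm_apply hd (differentiableAt_const v), fderiv_clm_apply hd (differentiableAt_const w)]
    simpa using hs w v
  simp only [hsymm] at e1
  rw [e1] at e2
  rw [neg_inj] at e2
  rw [e2, e3]

end Mollification

/-! ### The torus as the unit cell: periodization and periodic representatives. -/

section Torus

variable {d : ℕ}

instance isAddHaarMeasure_spaceTime : (volume : Measure (ℝ × E d)).IsAddHaarMeasure :=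
  inferInstanceAs ((volume : Measure ℝ).prod (volume : Measure (E d))).IsAddHaarMeasure

/-- Periodicity in space of a function on space-time. -/
def SpacePeriodic {V : Type*} (f : ℝ × E d → V) : Prop :=
  ∀ (z : ℝ × E d) (i : Fin d), f (z.1, z.2 + e i) = f z

/-- The lattice vector with integer coordinates `n`. -/
noncomputable def lattice (n : Fin d → ℤ) : E d := WithLp.toLp 2 fun i => (n i : ℝ)

theorem lattice_eq_sum (n : Fin d → ℤ) : lattice n = ∑ i, n i • (e i : E d) := by
  ext j
  simp [lattice, Finset.sum_apply, Pi.single_apply]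

theorem SpacePeriodic.lattice {V : Type*} {f : ℝ × E d → V} (h : SpacePeriodic f)
    (n : Fin d → ℤ) (z : ℝ × E d) : f (z.1, z.2 + lattice n) = f z := by
  have h1 : ∀ i, Function.Periodic (fun x => f (z.1, x)) (e i : E d) := fun i x => h (z.1, x) i
  have h2 : ∀ s : Finset (Fin d),
      Function.Periodic (fun x => f (z.1, x)) (∑ i ∈ s, n i • (e i : E d)) := by
    intro s
    induction s using Finset.induction_on with
    | empty => intro x; simp
    | insert a s ha ih =>
      rw [Finset.sum_insert ha]
      exact ((h1 a).zsmul (n a)).add_period ih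
  rw [lattice_eq_sum]
  exact h2 Finset.univ z.2

/-- The integer part of a point. -/
noncomputable def floorVec (x : E d) : Fin d → ℤ := fun i => ⌊x i⌋

/-- The fractional part of a point, which lies in the unit cell. -/
noncomputable def fractVec (x : E d) : E d := WithLp.toLp 2 fun i => Int.fract (x i)

theorem fractVec_mem (x : E d) : fractVec x ∈ cell d :=
  fun i => ⟨Int.fract_nonneg _, Int.fract_lt_one _⟩

theorem fractVec_add_lattice (x : E d) : fractVec x + lattice (floorVec x) = x := by
  ext i
  simp [fractVec, EulerKorteweg.lattice, floorVec]

theorem fractVec_eq_self {x : E d} (hx : x ∈ cell d) : fractVec x = x := by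
  ext i
  exact Int.fract_eq_self.2 (hx i)

theorem fractVec_add_e (x : E d) (i : Fin d) : fractVec (x + e i) = fractVec x := by
  ext j
  by_cases h : j = i
  · subst h; simp [fractVec]
  · simp [fractVec, h]

theorem sub_lattice_mem_cell {x : E d} {n : Fin d → ℤ} :
    x - lattice n ∈ cell d ↔ floorVec x = n := by
  rw [funext_iff]
  refine forall_congr' fun i => ?_
  simp only [floorVec, Int.floor_eq_iff, EulerKorteweg.lattice, PiLp.sub_apply]
  constructor <;> intro h <;> constructor <;> linarith [h.1, h.2]

theorem measurable_fractVec : Measurable (fractVec : E d → E d) := by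
  refine (MeasurableEquiv.toLp 2 (Fin d → ℝ)).measurable.comp (measurable_pi_lambda _ fun i => ?_)
  exact measurable_fract.comp
    (EuclideanSpace.proj i : E d →L[ℝ] ℝ).continuous.measurable

theorem measurableSet_cell : MeasurableSet (cell d) := by
  have : cell d = ⋂ i, (fun x : E d => x i) ⁻¹' Ico 0 1 := by
    ext x; simp [cell]
  rw [this]
  refine MeasurableSet.iInter fun i => ?_
  exact (EuclideanSpace.proj i : E d →L[ℝ] ℝ).continuous.measurable
    measurableSet_Ico

theorem norm_lt_of_mem_cell {x : E d} (hx : x ∈ cell d) : ‖x‖ < d + 1 := by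
  have h1 : ‖x‖ ^ 2 ≤ d := by
    rw [EuclideanSpace.norm_sq_eq]
    calc ∑ i, ‖x i‖ ^ 2 ≤ ∑ _i : Fin d, (1 : ℝ) := by
          refine Finset.sum_le_sum fun i _ => ?_
          rw [Real.norm_eq_abs, sq_abs]
          nlinarith [(hx i).1, (hx i).2]
      _ = d := by simp
  have h2 : (0 : ℝ) ≤ d := d.cast_nonneg
  by_contra! h
  nlinarith [norm_nonneg x]

theorem volume_cell_lt_top : volume (cell d) < ⊤ :=
  (measure_mono fun x hx => mem_ball_zero_iff.2 (norm_lt_of_mem_cell hx)).trans_lt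
    (measure_ball_lt_top (x := (0 : E d)) (r := d + 1))

/-- The space-time cylinder over the unit cell. -/
abbrev Q (d : ℕ) (T : ℝ) : Set (ℝ × E d) := Ioo 0 T ×ˢ cell d

theorem measurableSet_Q (T : ℝ) : MeasurableSet (Q d T) := measurableSet_Ioo.prod measurableSet_cell

theorem volume_Q_lt_top (T : ℝ) : volume (Q d T) < ⊤ := by
  rw [Measure.volume_eq_prod, Measure.prod_prod]
  exact ENNReal.mul_lt_top (by simp) volume_cell_lt_top

instance isFiniteMeasure_restrict_Q (T : ℝ) :
    IsFiniteMeasure ((volume : Measure (ℝ × E d)).restrict (Q d T)) :=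
  ⟨by rw [Measure.restrict_apply_univ]; exact volume_Q_lt_top T⟩

instance isFiniteMeasure_restrict_cell :
    IsFiniteMeasure ((volume : Measure (E d)).restrict (cell d)) :=
  ⟨by rw [Measure.restrict_apply_univ]; exact volume_cell_lt_top⟩

/-- The level sets of `floorVec` are the lattice translates of the cell and partition space; each
piece is moved back by translation invariance. -/
theorem integral_eq_sum_cell {h : ℝ × E d → ℝ} (hi : Integrable h) (N : Finset (Fin d → ℤ))
    (hN : ∀ z, floorVec z.2 ∉ N → h z = 0) :
    ∫ z, h z = ∑ n ∈ N, ∫ z in univ ×ˢ cell d, h (z.1, z.2 + lattice n) := by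
  have hm : MeasurableSet ((univ : Set ℝ) ×ˢ cell d) := MeasurableSet.univ.prod measurableSet_cell
  have hmn : ∀ n : Fin d → ℤ, MeasurableSet {z : ℝ × E d | floorVec z.2 = n} := by
    intro n
    have : {z : ℝ × E d | floorVec z.2 = n}
        = (fun z => z - ((0 : ℝ), lattice n)) ⁻¹' ((univ : Set ℝ) ×ˢ cell d) := by
      ext z; simp [← sub_lattice_mem_cell]
    rw [this]
    exact (measurable_id.sub_const _) hm
  have h1 : h = fun z => ∑ n ∈ N, {z : ℝ × E d | floorVec z.2 = n}.indicator h z := by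
    funext z
    by_cases hz : floorVec z.2 ∈ N
    · rw [Finset.sum_eq_single_of_mem _ hz]
      · simp
      · intro n _ hn
        exact indicator_of_notMem (fun h => hn h.symm) _
    · rw [hN z hz, Finset.sum_eq_zero]
      intro n hn
      exact indicator_of_notMem (fun h => hz (by rw [show floorVec z.2 = n from h]; exact hn)) _
  rw [h1, integral_finsetSum _ fun n _ => hi.indicator (hmn n), ← h1]
  refine Finset.sum_congr rfl fun n _ => ?_
  rw [← integral_indicator hm, ← integral_add_right_eq_self _ ((0 : ℝ), lattice n)]
  congr 1; funext z
  by_cases hz : z ∈ (univ : Set ℝ) ×ˢ cell d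
  · rw [indicator_of_mem hz, indicator_of_mem]
    · simp [Prod.add_def]
    · show floorVec (z + ((0 : ℝ), lattice n)).2 = n
      rw [← sub_lattice_mem_cell]
      simpa using hz.2
  · rw [indicator_of_notMem hz, indicator_of_notMem]
    intro h
    apply hz
    have h' : floorVec (z + ((0 : ℝ), lattice n)).2 = n := h
    rw [← sub_lattice_mem_cell] at h'
    exact ⟨trivial, by simpa using h'⟩

/-- The sum of the lattice translates of a function. -/
noncomputable def periodize (φ : ℝ × E d → ℝ) (z : ℝ × E d) : ℝ :=
  ∑ᶠ n : Fin d → ℤ, φ (z.1, z.2 + lattice n)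

theorem periodize_periodic (φ : ℝ × E d → ℝ) : SpacePeriodic (periodize φ) := by
  intro z i
  unfold periodize
  conv_rhs => rw [← finsum_comp_equiv (Equiv.addRight (Pi.single i (1 : ℤ) : Fin d → ℤ))]
  congr 1; funext n
  congr 2
  have : lattice (n + Pi.single i 1) = lattice n + (e i : E d) := by
    ext j
    by_cases h : j = i
    · subst h; simp [EulerKorteweg.lattice]
    · simp [EulerKorteweg.lattice, h]
  simp only [Equiv.coe_addRight, this]
  abel

/-- If the support lies in the ball of radius `R`, a contributing lattice vector has norm at most `R
+ M`, hence coordinates bounded by `⌈R + M⌉`. So one finite set serves a whole ball of base points.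
-/
theorem exists_finset_lattice {φ : ℝ × E d → ℝ} (hc : HasCompactSupport φ) (M : ℝ) :
    ∃ N : Finset (Fin d → ℤ), ∀ z : ℝ × E d, ‖z.2‖ < M → ∀ n ∉ N,
      (z.1, z.2 + lattice n) ∉ tsupport φ := by
  obtain ⟨R, hR⟩ := hc.isBounded.exists_norm_le
  refine ⟨Fintype.piFinset fun _ => Finset.Icc (-⌈R + M⌉) ⌈R + M⌉, fun z hz n hn hmem => hn ?_⟩
  rw [Fintype.mem_piFinset]
  intro i
  have h1 : ‖z.2 + lattice n‖ ≤ R := (norm_snd_le _).trans (hR _ hmem)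
  have h2 : ‖lattice n‖ ≤ R + M := by
    have := norm_sub_le (z.2 + lattice n) z.2
    rw [add_sub_cancel_left] at this
    linarith
  have h3 : |(n i : ℝ)| ≤ R + M := (PiLp.norm_apply_le (lattice n) i).trans h2
  rw [abs_le] at h3
  rw [Finset.mem_Icc]
  constructor
  · have : ((-n i : ℤ) : ℝ) ≤ ⌈R + M⌉ := by
      push_cast; linarith [Int.le_ceil (R + M)]
    have := Int.cast_le.1 this
    linarith
  · exact Int.cast_le.1 (h3.2.trans (Int.le_ceil (R + M)))

theorem periodize_eq_sum {φ : ℝ × E d → ℝ} {N : Finset (Fin d → ℤ)} {z : ℝ × E d}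
    (hN : ∀ n ∉ N, (z.1, z.2 + lattice n) ∉ tsupport φ) :
    periodize φ z = ∑ n ∈ N, φ (z.1, z.2 + lattice n) := by
  refine finsum_eq_sum_of_support_subset _ fun n hn => ?_
  by_contra h
  exact hn (image_eq_zero_of_notMem_tsupport (hN n h))

theorem periodize_hasFDerivAt {φ : ℝ × E d → ℝ} (hφ : ContDiff ℝ ∞ φ) {N : Finset (Fin d → ℤ)}
    {M : ℝ} (hN : ∀ z : ℝ × E d, ‖z.2‖ < M → ∀ n ∉ N, (z.1, z.2 + lattice n) ∉ tsupport φ)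
    {z : ℝ × E d} (hz : ‖z.2‖ < M) :
    ContDiffAt ℝ ∞ (periodize φ) z ∧
      HasFDerivAt (periodize φ) (∑ n ∈ N, fderiv ℝ φ (z.1, z.2 + lattice n)) z := by
  have h1 : periodize φ =ᶠ[𝓝 z] fun z => ∑ n ∈ N, φ (z.1, z.2 + lattice n) := by
    have : ∀ᶠ y : ℝ × E d in 𝓝 z, ‖y.2‖ < M :=
      (continuous_snd.norm.tendsto z).eventually (gt_mem_nhds hz)
    filter_upwards [this] with y hy using periodize_eq_sum (hN y hy)
  have hsh : ∀ n : Fin d → ℤ, ContDiff ℝ ∞ fun z : ℝ × E d => (z.1, z.2 + lattice n) := fun n =>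
    contDiff_fst.prodMk (contDiff_snd.add contDiff_const)
  refine ⟨ContDiffAt.congr_of_eventuallyEq ?_ h1, HasFDerivAt.congr_of_eventuallyEq ?_ h1⟩
  · exact (ContDiff.sum fun n _ => hφ.comp (hsh n)).contDiffAt
  · refine HasFDerivAt.fun_sum fun n _ => ?_
    have h2 : HasFDerivAt (fun z : ℝ × E d => z + ((0 : ℝ), lattice n))
        (ContinuousLinearMap.id ℝ _) z := (hasFDerivAt_id z).add_const _
    have h3 := ((hφ.differentiable (by simp)) (z + ((0 : ℝ), lattice n))).hasFDerivAt.comp z h2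
    have e1 : ∀ y : ℝ × E d, y + ((0 : ℝ), lattice n) = (y.1, y.2 + lattice n) := fun y => by
      simp [Prod.add_def]
    simp only [ContinuousLinearMap.comp_id, e1] at h3
    refine h3.congr_of_eventuallyEq (Eventually.of_forall fun y => ?_)
    simp

/-- A weak derivative on the torus, tested with periodic functions, is a weak derivative on
the whole space. -/
theorem WD.of_torus {T : ℝ} {f g : ℝ × E d → ℝ} {v : ℝ × E d} (hf : BddMeas f) (hg : BddMeas g)
    (hfp : SpacePeriodic f) (hgp : SpacePeriodic g)
    (H : ∀ ψ : ℝ → E d → ℝ, IsTest (Ioo 0 T) ψ →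
      ∫ z in Q d T, f z * fderiv ℝ (fun z : ℝ × E d => ψ z.1 z.2) z v
        = - ∫ z in Q d T, g z * ψ z.1 z.2) :
    WD (Ioo 0 T ×ˢ univ) f g v := by
  intro φ hφ hφc hφO
  have hP : ContDiff ℝ ∞ (periodize φ) := by
    rw [contDiff_iff_contDiffAt]
    intro z
    obtain ⟨N, hN⟩ := exists_finset_lattice hφc (‖z.2‖ + 1)
    exact (periodize_hasFDerivAt hφ hN (lt_add_one _)).1
  have hP0 : ∀ z : ℝ × E d, z.1 ∉ Prod.fst '' tsupport φ → periodize φ z = 0 := by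
    intro z hz
    rw [periodize_eq_sum (N := ∅), Finset.sum_empty]
    intro n _ h
    exact hz ⟨_, h, rfl⟩
  have hK : IsCompact (Prod.fst '' tsupport φ) := hφc.isCompact.image continuous_fst
  have hKI : Prod.fst '' tsupport φ ⊆ Ioo 0 T := by
    rintro _ ⟨z, hz, rfl⟩; exact (hφO hz).1
  -- Periodization affects only the space variable, so the support in time stays in the projection
  -- of the support of `φ`.
  have hT : IsTest (Ioo 0 T) fun t x => periodize φ (t, x) :=
    ⟨(hP.of_le (by simp)), fun t x i => periodize_periodic φ (t, x) i, _, hK, hKI,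
      fun t _ ht x => hP0 (t, x) ht⟩
  have h1 := H _ hT
  obtain ⟨N, hN⟩ := exists_finset_lattice hφc (d + 1 : ℝ)
  have hcell : ∀ z ∈ (univ : Set ℝ) ×ˢ cell d, ‖z.2‖ < (d + 1 : ℝ) := fun z hz =>
    norm_lt_of_mem_cell hz.2
  have hfl : ∀ z : ℝ × E d, floorVec z.2 ∉ N → z ∉ tsupport φ := by
    intro z hz
    have := hN (z.1, fractVec z.2) (norm_lt_of_mem_cell (fractVec_mem _)) _ hz
    simpa [fractVec_add_lattice] using this
  -- Unfolding: against a periodic weight, integrating `a` over the whole space amounts to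
  -- integrating its periodization over the cell. It is used for `φ` and for its directional
  -- derivative.
  have main : ∀ (a b : ℝ × E d → ℝ) (w : ℝ × E d → ℝ), BddMeas w → SpacePeriodic w →
      Continuous a → HasCompactSupport a → (∀ z, z ∉ tsupport φ → a z = 0) →
      (∀ z ∈ (univ : Set ℝ) ×ˢ cell d, b z = ∑ n ∈ N, a (z.1, z.2 + lattice n)) →
      (∀ z, z.1 ∉ Ioo 0 T → b z = 0) →
      ∫ z, a z • w z = ∫ z in Q d T, w z * b z := by
    intro a b w hw hwp ha hac ha0 hb hb0
    have hi := WD.integrable_test hw ha hac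
    have hm : MeasurableSet ((univ : Set ℝ) ×ˢ cell d) := MeasurableSet.univ.prod measurableSet_cell
    rw [integral_eq_sum_cell hi N (fun z hz => by rw [ha0 z (hfl z hz), zero_smul]),
      ← integral_finsetSum]
    · rw [← setIntegral_eq_of_subset_of_forall_sdiff_eq_zero (s := Q d T)
        (t := (univ : Set ℝ) ×ˢ cell d) (f := fun z => w z * b z) hm
        (prod_mono (subset_univ _) subset_rfl)]
      · refine setIntegral_congr_fun hm fun z hz => ?_
        simp only [smul_eq_mul]
        rw [hb z hz, Finset.mul_sum]
        refine Finset.sum_congr rfl fun n _ => ?_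
        rw [hwp.lattice, mul_comm]
      · intro z hz
        rw [hb0 z fun h => hz.2 ⟨h, hz.1.2⟩, mul_zero]
    · intro n _
      have : Integrable fun z : ℝ × E d => (fun z => a z • w z) (z + ((0 : ℝ), lattice n)) :=
        hi.comp_add_right _
      refine (this.congr (Eventually.of_forall fun z => ?_)).integrableOn
      simp [Prod.add_def]
  rw [main (fun z => fderiv ℝ φ z v) (fun z => fderiv ℝ (periodize φ) z v) f hf hfp
      ((hφ.continuous_fderiv (by simp)).clm_apply continuous_const)
      (hasCompactSupport_fderiv_apply hφc v) ?_ ?_ ?_,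
    main φ (periodize φ) g hg hgp hφ.continuous hφc
      (fun z hz => image_eq_zero_of_notMem_tsupport hz)
      (fun z hz => periodize_eq_sum (hN z (hcell z hz))) ?_]
  · exact h1
  · intro z hz
    exact hP0 z fun h => hz (hKI h)
  · intro z hz
    rw [image_eq_zero_of_notMem_tsupport (fun h => hz (tsupport_fderiv_subset ℝ h))]; rfl
  · intro z hz
    rw [(periodize_hasFDerivAt hφ hN (hcell z hz)).2.fderiv]
    simp
  · intro z hz
    have : periodize φ =ᶠ[𝓝 z] 0 := by
      have h2 : ∀ᶠ y : ℝ × E d in 𝓝 z, y.1 ∉ Prod.fst '' tsupport φ :=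
        (hK.isClosed.isOpen_compl.preimage continuous_fst).mem_nhds fun h => hz (hKI h)
      filter_upwards [h2] with y hy using hP0 y hy
    rw [this.fderiv_eq]
    simp

/-- Weak derivatives are known only almost everywhere on one cell. A measurable representative is
truncated at the essential supremum and extended through the fractional part, so that it is bounded
and periodic everywhere and can be mollified. -/
theorem exists_bddMeas_periodic {T : ℝ} {f : ℝ → E d → ℝ} (hf : LInf T f) :
    ∃ g : ℝ × E d → ℝ, BddMeas g ∧ SpacePeriodic g ∧
      ∀ᵐ z ∂(volume.restrict (Q d T)), f z.1 z.2 = g z := by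
  set C := (eLpNorm (fun z : ℝ × E d => f z.1 z.2) ⊤ (volume.restrict (Q d T))).toReal with hC
  have hm := hf.1.stronglyMeasurable_mk
  refine ⟨fun z => max (-C) (min C (hf.1.mk _ (z.1, fractVec z.2))), ⟨?_, C, fun z => ?_⟩, ?_, ?_⟩
  · have : Measurable fun z : ℝ × E d => (z.1, fractVec z.2) :=
      measurable_fst.prodMk (measurable_fractVec.comp measurable_snd)
    exact (measurable_const.max (measurable_const.min (hm.measurable.comp this))).stronglyMeasurable
  · have : 0 ≤ C := ENNReal.toReal_nonneg
    rw [Real.norm_eq_abs, abs_le]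
    exact ⟨le_max_left _ _, max_le (by linarith) (min_le_left _ _)⟩
  · intro z i
    simp only [fractVec_add_e]
  · have h1 : ∀ᵐ z ∂(volume.restrict (Q d T)), ‖f z.1 z.2‖ ≤ C := by
      filter_upwards [ae_le_eLpNormEssSup (f := fun z : ℝ × E d => f z.1 z.2)
        (μ := volume.restrict (Q d T))] with z hz
      rw [hC, eLpNorm_exponent_top]
      have h2 := hf.2.ne
      rw [eLpNorm_exponent_top] at h2
      rw [← toReal_enorm]
      exact ENNReal.toReal_mono h2 hz
    filter_upwards [h1, hf.1.ae_eq_mk, ae_restrict_mem (measurableSet_Q T)] with z hz h2 h3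
    rw [fractVec_eq_self h3.2, ← h2]
    rw [Real.norm_eq_abs, abs_le] at hz
    rw [min_eq_right hz.2, max_eq_right hz.1]

/-- Continuous extension in time, constant outside `[0,T]`. -/
noncomputable def clampTime {V : Type*} (T : ℝ) (f : ℝ → E d → V) (z : ℝ × E d) : V :=
  f (max 0 (min T z.1)) z.2

theorem clampTime_eq {V : Type*} {T : ℝ} (f : ℝ → E d → V) {z : ℝ × E d} (hz : z.1 ∈ Icc 0 T) :
    clampTime T f z = f z.1 z.2 := by
  rw [clampTime, min_eq_right hz.2, max_eq_right hz.1]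

theorem clamp_mem {T : ℝ} (hT : 0 ≤ T) (t : ℝ) : max 0 (min T t) ∈ Icc 0 T :=
  ⟨le_max_left _ _, max_le hT (min_le_left _ _)⟩

theorem clampTime_continuous {V : Type*} [TopologicalSpace V] {T : ℝ} (hT : 0 ≤ T)
    {f : ℝ → E d → V}
    (hf : ContinuousOn (fun z : ℝ × E d => f z.1 z.2) (Icc 0 T ×ˢ univ)) :
    Continuous (clampTime T f) := by
  have h1 : Continuous fun z : ℝ × E d => (max 0 (min T z.1), z.2) := by fun_prop
  exact hf.comp_continuous h1 fun z => ⟨clamp_mem hT _, trivial⟩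

theorem clampTime_periodic {V : Type*} {T : ℝ} {f : ℝ → E d → V} (hf : Periodic f) :
    SpacePeriodic (clampTime T f) := fun _ i => hf _ _ i

/-- The closed ball of radius `d + 1` contains the unit cell, so by periodicity all values are
already taken over it. -/
theorem Periodic.exists_compact {V : Type*} [TopologicalSpace V] {T : ℝ}
    {f : ℝ → E d → V} (hp : Periodic f)
    (hf : ContinuousOn (fun z : ℝ × E d => f z.1 z.2) (Icc 0 T ×ˢ univ)) :
    ∃ S : Set (ℝ × E d), IsCompact S ∧ S ⊆ Icc 0 T ×ˢ univ ∧
      IsCompact ((fun z : ℝ × E d => f z.1 z.2) '' S) ∧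
      ∀ t ∈ Icc 0 T, ∀ x, f t x ∈ (fun z : ℝ × E d => f z.1 z.2) '' S := by
  have hS : IsCompact (Icc 0 T ×ˢ Metric.closedBall (0 : E d) (d + 1)) :=
    isCompact_Icc.prod (isCompact_closedBall _ _)
  have hsub : Icc 0 T ×ˢ Metric.closedBall (0 : E d) (d + 1) ⊆ Icc 0 T ×ˢ univ :=
    prod_mono subset_rfl (subset_univ _)
  refine ⟨_, hS, hsub, hS.image_of_continuousOn (hf.mono hsub), fun t ht x => ?_⟩
  refine ⟨(t, fractVec x), ⟨ht, ?_⟩, ?_⟩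
  · exact mem_closedBall_zero_iff.2 (norm_lt_of_mem_cell (fractVec_mem x)).le
  · have h1 : SpacePeriodic (fun z : ℝ × E d => f z.1 z.2) := fun z i => hp _ _ i
    have := h1.lattice (floorVec x) (t, fractVec x)
    simp only [fractVec_add_lattice] at this
    exact this.symm

theorem clampTime_bddMeas {V : Type*} [NormedAddCommGroup V] {T : ℝ} (hT : 0 ≤ T)
    {f : ℝ → E d → V} (hp : Periodic f)
    (hf : ContinuousOn (fun z : ℝ × E d => f z.1 z.2) (Icc 0 T ×ˢ univ)) :
    BddMeas (clampTime T f) := by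
  refine ⟨(clampTime_continuous hT hf).stronglyMeasurable, ?_⟩
  obtain ⟨S, -, -, hS, h⟩ := hp.exists_compact hf
  obtain ⟨C, hC⟩ := hS.isBounded.exists_norm_le
  exact ⟨C, fun z => hC _ (h _ (clamp_mem hT _) _)⟩

end Torus

/-! ### Convergence of integrals, time cutoffs, and slicing in time. -/

section Limits

variable {d : ℕ} {T : ℝ}

/-- Boundedly almost everywhere convergent sequences on `(0,T) × 𝕋^d`. -/
structure BddTendsto (T : ℝ) (g : ℕ → ℝ × E d → ℝ) (g' : ℝ × E d → ℝ) : Prop where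
  meas : ∀ n, AEStronglyMeasurable (g n) (volume.restrict (Q d T))
  bdd : ∃ C, ∀ n z, ‖g n z‖ ≤ C
  lim : ∀ᵐ z ∂(volume.restrict (Q d T)), Tendsto (fun n => g n z) atTop (𝓝 (g' z))

theorem BddTendsto.moll {f : ℝ × E d → ℝ} (hf : BddMeas f) :
    BddTendsto T (fun n => moll n f) f := by
  obtain ⟨C, hC⟩ := hf.bdd
  exact ⟨fun n => (moll_continuous n hf).aestronglyMeasurable, ⟨C, fun n => moll_norm_le n hC⟩,
    ae_restrict_of_ae (moll_tendsto hf)⟩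

theorem BddTendsto.const {f : ℝ × E d → ℝ} (hf : BddMeas f) : BddTendsto T (fun _ => f) f :=
  ⟨fun _ => hf.meas.aestronglyMeasurable, ⟨hf.bdd.choose, fun _ => hf.bdd.choose_spec⟩,
    Eventually.of_forall fun _ => tendsto_const_nhds⟩

theorem BddTendsto.mul {f g : ℕ → ℝ × E d → ℝ} {f' g' : ℝ × E d → ℝ} (hf : BddTendsto T f f')
    (hg : BddTendsto T g g') : BddTendsto T (fun n z => f n z * g n z) (fun z => f' z * g' z) := by
  obtain ⟨A, hA⟩ := hf.bdd
  obtain ⟨B, hB⟩ := hg.bdd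
  refine ⟨fun n => (hf.meas n).mul (hg.meas n), ⟨A * B, fun n z => ?_⟩, ?_⟩
  · rw [norm_mul]
    exact mul_le_mul (hA n z) (hB n z) (norm_nonneg _) ((norm_nonneg _).trans (hA n z))
  · filter_upwards [hf.lim, hg.lim] with z a b using a.mul b

theorem BddTendsto.add {f g : ℕ → ℝ × E d → ℝ} {f' g' : ℝ × E d → ℝ} (hf : BddTendsto T f f')
    (hg : BddTendsto T g g') : BddTendsto T (fun n z => f n z + g n z) (fun z => f' z + g' z) := by
  obtain ⟨A, hA⟩ := hf.bdd
  obtain ⟨B, hB⟩ := hg.bdd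
  refine ⟨fun n => (hf.meas n).add (hg.meas n), ⟨A + B, fun n z => ?_⟩, ?_⟩
  · exact (norm_add_le _ _).trans (add_le_add (hA n z) (hB n z))
  · filter_upwards [hf.lim, hg.lim] with z a b using a.add b

theorem BddTendsto.sub {f g : ℕ → ℝ × E d → ℝ} {f' g' : ℝ × E d → ℝ} (hf : BddTendsto T f f')
    (hg : BddTendsto T g g') : BddTendsto T (fun n z => f n z - g n z) (fun z => f' z - g' z) := by
  obtain ⟨A, hA⟩ := hf.bdd
  obtain ⟨B, hB⟩ := hg.bdd
  refine ⟨fun n => (hf.meas n).sub (hg.meas n), ⟨A + B, fun n z => ?_⟩, ?_⟩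
  · exact (norm_sub_le _ _).trans (add_le_add (hA n z) (hB n z))
  · filter_upwards [hf.lim, hg.lim] with z a b using a.sub b

theorem BddTendsto.sum {ι : Type*} (s : Finset ι) {f : ι → ℕ → ℝ × E d → ℝ}
    {f' : ι → ℝ × E d → ℝ} (hf : ∀ i, BddTendsto T (f i) (f' i)) :
    BddTendsto T (fun n z => ∑ i ∈ s, f i n z) (fun z => ∑ i ∈ s, f' i z) := by
  classical
  induction s using Finset.induction_on with
  | empty =>
    have h0 : BddMeas fun _ : ℝ × E d => (0 : ℝ) :=
      ⟨stronglyMeasurable_const, 0, fun _ => by simp⟩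
    simpa only [Finset.sum_empty] using BddTendsto.const h0
  | insert a s ha ih => simpa [Finset.sum_insert ha] using (hf a).add ih

/-- Sequences of integrable functions on `(0,T) × 𝕋^d` whose integrals converge. -/
structure IntTendsto (T : ℝ) (h : ℕ → ℝ × E d → ℝ) (h' : ℝ × E d → ℝ) : Prop where
  int : ∀ n, IntegrableOn (h n) (Q d T)
  int' : IntegrableOn h' (Q d T)
  lim : Tendsto (fun n => ∫ z in Q d T, h n z) atTop (𝓝 (∫ z in Q d T, h' z))

/-- Dominated convergence with dominating function a constant multiple of `|w|`. Here `w` is a field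
of the weak solution, merely integrable, and `g` a mollified coefficient of the strong one. -/
theorem BddTendsto.int {g : ℕ → ℝ × E d → ℝ} {g' w : ℝ × E d → ℝ}
    (hg : BddTendsto T g g') (hw : IntegrableOn w (Q d T)) :
    IntTendsto T (fun n z => w z * g n z) (fun z => w z * g' z) := by
  obtain ⟨C, hC⟩ := hg.bdd
  have hm : AEStronglyMeasurable g' (volume.restrict (Q d T)) :=
    aestronglyMeasurable_of_tendsto_ae atTop hg.meas hg.lim
  have hC' : ∀ᵐ z ∂(volume.restrict (Q d T)), ‖g' z‖ ≤ C := by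
    filter_upwards [hg.lim] with z hz
    exact le_of_tendsto hz.norm (Eventually.of_forall fun n => hC n z)
  refine ⟨fun n => hw.mul_bdd (hg.meas n) (Eventually.of_forall (hC n)), hw.mul_bdd hm hC', ?_⟩
  refine tendsto_integral_of_dominated_convergence (fun z => ‖w z‖ * C)
    (fun n => hw.aestronglyMeasurable.mul (hg.meas n)) (hw.norm.mul_const C) (fun n => ?_) ?_
  · refine Eventually.of_forall fun z => ?_
    rw [norm_mul]
    exact mul_le_mul_of_nonneg_left (hC n z) (norm_nonneg _)
  · filter_upwards [hg.lim] with z hz using hz.const_mul _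

theorem IntTendsto.add {f g : ℕ → ℝ × E d → ℝ} {f' g' : ℝ × E d → ℝ} (hf : IntTendsto T f f')
    (hg : IntTendsto T g g') : IntTendsto T (fun n z => f n z + g n z) (fun z => f' z + g' z) := by
  refine ⟨fun n => (hf.int n).add (hg.int n), hf.int'.add hg.int', ?_⟩
  rw [integral_add hf.int' hg.int']
  exact (hf.lim.add hg.lim).congr fun n => (integral_add (hf.int n) (hg.int n)).symm

theorem IntTendsto.sub {f g : ℕ → ℝ × E d → ℝ} {f' g' : ℝ × E d → ℝ} (hf : IntTendsto T f f')
    (hg : IntTendsto T g g') : IntTendsto T (fun n z => f n z - g n z) (fun z => f' z - g' z) := by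
  refine ⟨fun n => (hf.int n).sub (hg.int n), hf.int'.sub hg.int', ?_⟩
  rw [integral_sub hf.int' hg.int']
  exact (hf.lim.sub hg.lim).congr fun n => (integral_sub (hf.int n) (hg.int n)).symm

theorem IntTendsto.sum {ι : Type*} (s : Finset ι) {f : ι → ℕ → ℝ × E d → ℝ}
    {f' : ι → ℝ × E d → ℝ} (hf : ∀ i, IntTendsto T (f i) (f' i)) :
    IntTendsto T (fun n z => ∑ i ∈ s, f i n z) (fun z => ∑ i ∈ s, f' i z) := by
  refine ⟨fun n => integrable_finsetSum _ fun i _ => (hf i).int n,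
    integrable_finsetSum _ fun i _ => (hf i).int', ?_⟩
  rw [integral_finsetSum _ fun i _ => (hf i).int']
  exact (tendsto_finsetSum _ fun i _ => (hf i).lim).congr fun n =>
    (integral_finsetSum _ fun i _ => (hf i).int n).symm

/-- Integrable functions on `(0,T) × 𝕋^d` with zero integral. -/
def NullInt (T : ℝ) (h : ℝ × E d → ℝ) : Prop :=
  IntegrableOn h (Q d T) ∧ ∫ z in Q d T, h z = 0

theorem IntTendsto.null {h : ℕ → ℝ × E d → ℝ} {h' : ℝ × E d → ℝ} (H : IntTendsto T h h')
    (h0 : ∀ᶠ n in atTop, ∫ z in Q d T, h n z = 0) : NullInt T h' :=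
  ⟨H.int', tendsto_nhds_unique H.lim (tendsto_const_nhds.congr' (h0.mono fun n hn => hn.symm))⟩

theorem NullInt.add {f g : ℝ × E d → ℝ} (hf : NullInt T f) (hg : NullInt T g) :
    NullInt T fun z => f z + g z :=
  ⟨hf.1.add hg.1, by rw [integral_add hf.1 hg.1, hf.2, hg.2, add_zero]⟩

theorem NullInt.sub {f g : ℝ × E d → ℝ} (hf : NullInt T f) (hg : NullInt T g) :
    NullInt T fun z => f z - g z :=
  ⟨hf.1.sub hg.1, by rw [integral_sub hf.1 hg.1, hf.2, hg.2, sub_zero]⟩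

theorem NullInt.sum {ι : Type*} (s : Finset ι) {f : ι → ℝ × E d → ℝ}
    (hf : ∀ i, NullInt T (f i)) : NullInt T fun z => ∑ i ∈ s, f i z :=
  ⟨integrable_finsetSum _ fun i _ => (hf i).1, by
    rw [integral_finsetSum _ fun i _ => (hf i).1]
    exact Finset.sum_eq_zero fun i _ => (hf i).2⟩

theorem NullInt.congr {f g : ℝ × E d → ℝ} (hf : NullInt T f)
    (h : f =ᵐ[volume.restrict (Q d T)] g) : NullInt T g :=
  ⟨hf.1.congr h, by rw [← integral_congr_ae h]; exact hf.2⟩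

/-! ### Test functions -/

/-- Smooth cutoffs in time with compact support in `(0,T)`. -/
structure TimeCutoff (T : ℝ) (θ : ℝ → ℝ) : Prop where
  smooth : ContDiff ℝ ∞ θ
  compact : HasCompactSupport θ
  sub : tsupport θ ⊆ Ioo 0 T

theorem TimeCutoff.eq_zero {θ : ℝ → ℝ} {t : ℝ} (ht : t ∉ tsupport θ) :
    θ t = 0 := image_eq_zero_of_notMem_tsupport ht

theorem TimeCutoff.deriv_eq_zero {θ : ℝ → ℝ} {t : ℝ} (ht : t ∉ tsupport θ) :
    deriv θ t = 0 :=
  image_eq_zero_of_notMem_tsupport fun h => ht (tsupport_deriv_subset h)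

theorem TimeCutoff.differentiable {θ : ℝ → ℝ} (h : TimeCutoff T θ) : Differentiable ℝ θ :=
  h.smooth.differentiable (by simp)

theorem TimeCutoff.bddMeas {θ : ℝ → ℝ} (h : TimeCutoff T θ) :
    BddMeas fun z : ℝ × E d => θ z.1 := by
  obtain ⟨C, hC⟩ := h.compact.exists_bound_of_continuous h.smooth.continuous
  exact ⟨(h.smooth.continuous.comp continuous_fst).stronglyMeasurable, C, fun z => hC z.1⟩

theorem TimeCutoff.continuous_deriv {θ : ℝ → ℝ} (h : TimeCutoff T θ) : Continuous (deriv θ) :=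
  h.smooth.continuous_deriv (by simp)

theorem TimeCutoff.bddMeas_deriv {θ : ℝ → ℝ} (h : TimeCutoff T θ) :
    BddMeas fun z : ℝ × E d => deriv θ z.1 := by
  obtain ⟨C, hC⟩ := h.compact.deriv.exists_bound_of_continuous h.continuous_deriv
  exact ⟨(h.continuous_deriv.comp continuous_fst).stronglyMeasurable, C, fun z => hC z.1⟩

theorem TimeCutoff.margin {θ : ℝ → ℝ} (h : TimeCutoff T θ) :
    ∀ᶠ n : ℕ in atTop, ∀ z : ℝ × E d, z.1 ∈ tsupport θ →
      Metric.closedBall z (1 / (n + 1 : ℝ)) ⊆ Ioo 0 T ×ˢ univ := by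
  filter_upwards [exists_margin h.compact.isCompact isOpen_Ioo h.sub] with n hn z hz y hy
  refine ⟨hn z.1 hz ?_, trivial⟩
  rw [Metric.mem_closedBall] at hy ⊢
  exact (le_max_left _ _).trans hy

theorem moll_periodic {f : ℝ × E d → ℝ} (h : SpacePeriodic f) (n : ℕ) :
    SpacePeriodic (moll n f) := by
  intro z i
  have h1 := moll_add_period n (f := f) (a := ((0 : ℝ), (e i : E d)))
    (fun x => by simpa [Prod.add_def] using h x i) z
  simpa [Prod.add_def] using h1

theorem TimeCutoff.isTest {θ : ℝ → ℝ} (h : TimeCutoff T θ) {f : ℝ × E d → ℝ}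
    (hf : ContDiff ℝ 1 f) (hp : SpacePeriodic f) {I : Set ℝ} (hI : Ioo 0 T ⊆ I) :
    IsTest I fun t x => θ t * f (t, x) := by
  refine ⟨((h.smooth.of_le (by simp)).comp contDiff_fst).mul hf, fun t x i => ?_, tsupport θ,
    h.compact, h.sub.trans hI, fun t _ ht x => ?_⟩
  · exact congrArg (θ t * ·) (hp (t, x) i)
  · simp only [TimeCutoff.eq_zero ht, zero_mul]

theorem hasFDerivAt_slice {f : ℝ × E d → ℝ} {t : ℝ} {x : E d} (hf : DifferentiableAt ℝ f (t, x)) :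
    HasFDerivAt (fun x => f (t, x))
      ((fderiv ℝ f (t, x)).comp (ContinuousLinearMap.inr ℝ ℝ (E d))) x :=
  hf.hasFDerivAt.comp x (hasFDerivAt_prodMk_right t x)

theorem dx_eq {f : ℝ × E d → ℝ} {t : ℝ} {x : E d} (hf : DifferentiableAt ℝ f (t, x)) (i : Fin d) :
    dx i (fun t x => f (t, x)) t x = fderiv ℝ f (t, x) (0, e i) := by
  rw [dx, (hasFDerivAt_slice hf).fderiv]; rfl

theorem dt_eq {f : ℝ × E d → ℝ} {t : ℝ} {x : E d} (hf : DifferentiableAt ℝ f (t, x)) :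
    dt (fun t x => f (t, x)) t x = fderiv ℝ f (t, x) (1, 0) := by
  have h : HasFDerivAt (fun τ => f (τ, x))
      ((fderiv ℝ f (t, x)).comp (ContinuousLinearMap.inl ℝ ℝ (E d))) t :=
    hf.hasFDerivAt.comp t (hasFDerivAt_prodMk_left t x)
  rw [dt, h.hasDerivAt.deriv]; rfl

theorem TimeCutoff.dt_mul {θ : ℝ → ℝ} (h : TimeCutoff T θ) {f : ℝ × E d → ℝ}
    (hf : Differentiable ℝ f) (t : ℝ) (x : E d) :
    dt (fun t x => θ t * f (t, x)) t x
      = deriv θ t * f (t, x) + θ t * fderiv ℝ f (t, x) (1, 0) := by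
  have h1 : HasFDerivAt (fun τ => f (τ, x))
      ((fderiv ℝ f (t, x)).comp (ContinuousLinearMap.inl ℝ ℝ (E d))) t :=
    (hf _).hasFDerivAt.comp t (hasFDerivAt_prodMk_left t x)
  rw [dt, ((h.differentiable t).hasDerivAt.fun_mul h1.hasDerivAt).deriv]
  rfl

theorem TimeCutoff.dx_mul {θ : ℝ → ℝ} {f : ℝ × E d → ℝ}
    (hf : Differentiable ℝ f) (t : ℝ) (x : E d) (i : Fin d) :
    dx i (fun t x => θ t * f (t, x)) t x = θ t * fderiv ℝ f (t, x) (0, e i) := by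
  rw [dx, ((hasFDerivAt_slice (hf (t, x))).const_mul (θ t)).fderiv]
  rfl

/-- The weak partial derivatives of a bounded function with respect to time and space. -/
structure TimeSpaceWD (T : ℝ) (f ft : ℝ × E d → ℝ) (fx : Fin d → ℝ × E d → ℝ) : Prop where
  b : BddMeas f
  bt : BddMeas ft
  bx : ∀ i, BddMeas (fx i)
  per : SpacePeriodic f
  t : WD (Ioo 0 T ×ˢ univ) f ft (1, 0)
  x : ∀ i, WD (Ioo 0 T ×ˢ univ) f (fx i) (0, e i)

/-- The factor `θ` removes the times near `0` and `T`, where the mollification ball leaves the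
domain. Since space has no boundary, one threshold in `n` is valid for all points. -/
theorem TimeCutoff.moll_deriv {θ : ℝ → ℝ} (h : TimeCutoff T θ) {f g : ℝ × E d → ℝ}
    {v : ℝ × E d} (hf : BddMeas f) (H : WD (Ioo 0 T ×ˢ univ) f g v) :
    ∀ᶠ n in atTop, ∀ z : ℝ × E d, θ z.1 * fderiv ℝ (moll n f) z v = θ z.1 * moll n g z := by
  filter_upwards [h.margin (d := d)] with n hn z
  by_cases hz : z.1 ∈ tsupport θ
  · rw [H.fderiv_moll hf n (hn z hz)]
  · rw [TimeCutoff.eq_zero hz, zero_mul, zero_mul]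

theorem integrableOn_mul_continuous {w g : ℝ × E d → ℝ} (hw : IntegrableOn w (Q d T))
    (hg : Continuous g) : IntegrableOn (fun z => w z * g z) (Q d T) := by
  have hc : IsCompact (Icc 0 T ×ˢ Metric.closedBall (0 : E d) (d + 1)) :=
    isCompact_Icc.prod (isCompact_closedBall _ _)
  obtain ⟨C, hC⟩ := hc.exists_bound_of_continuousOn hg.continuousOn
  refine hw.mul_bdd hg.aestronglyMeasurable (c := C) ?_
  filter_upwards [ae_restrict_mem (measurableSet_Q T)] with z hz
  exact hC z ⟨Ioo_subset_Icc_self hz.1,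
    mem_closedBall_zero_iff.2 (norm_lt_of_mem_cell hz.2).le⟩

theorem volume_restrict_Q : (volume : Measure (ℝ × E d)).restrict (Q d T)
    = ((volume : Measure ℝ).restrict (Ioo 0 T)).prod ((volume : Measure (E d)).restrict (cell d)) := by
  rw [Measure.prod_restrict]; rfl

theorem ContL1.continuousOn_norm {V : Type*} [NormedAddCommGroup V] {I : Set ℝ}
    {f : ℝ → E d → V} (h : ContL1 I f) :
    ContinuousOn (fun t => ∫ x in cell d, ‖f t x‖) I := by
  intro t₀ ht₀
  refine tendsto_iff_norm_sub_tendsto_zero.2 ?_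
  refine squeeze_zero' (Eventually.of_forall fun t => norm_nonneg _) ?_ (h.2 t₀ ht₀)
  filter_upwards [self_mem_nhdsWithin] with t ht
  rw [← integral_sub (h.1 t ht).norm (h.1 t₀ ht₀).norm]
  refine norm_integral_le_of_norm_le ((h.1 t ht).sub (h.1 t₀ ht₀)).norm
    (Eventually.of_forall fun x => ?_)
  exact abs_norm_sub_norm_le _ _

/-- The spatial norm is continuous in time, hence integrable over a bounded interval; Tonelli then
applies. -/
theorem ContL1.integrableOn_Q {V : Type*} [NormedAddCommGroup V] {f : ℝ → E d → V}
    (h : ContL1 (Icc 0 T) f)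
    (hm : AEStronglyMeasurable (fun z : ℝ × E d => f z.1 z.2) (volume.restrict (Q d T))) :
    IntegrableOn (fun z : ℝ × E d => f z.1 z.2) (Q d T) := by
  rw [volume_restrict_Q] at hm
  rw [IntegrableOn, volume_restrict_Q, integrable_prod_iff hm]
  refine ⟨?_, ?_⟩
  · filter_upwards [ae_restrict_mem measurableSet_Ioo] with t ht
    exact h.1 t (Ioo_subset_Icc_self ht)
  · exact (h.continuousOn_norm.integrableOn_compact isCompact_Icc).mono_set Ioo_subset_Icc_self

theorem ContL1.mono {V : Type*} [NormedAddCommGroup V] {I J : Set ℝ}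
    {f : ℝ → E d → V} (h : ContL1 J f) (hIJ : I ⊆ J) : ContL1 I f :=
  ⟨fun t ht => h.1 t (hIJ ht), fun t ht => (h.2 t (hIJ ht)).mono_left (nhdsWithin_mono _ hIJ)⟩

theorem integral_Ioi_eq_Q {h : ℝ × E d → ℝ} (h0 : ∀ z : ℝ × E d, z.1 ∉ Ioo 0 T → h z = 0) :
    ∫ z in Ioi 0 ×ˢ cell d, h z = ∫ z in Q d T, h z := by
  refine (setIntegral_eq_of_subset_of_forall_sdiff_eq_zero (measurableSet_Ioi.prod measurableSet_cell)
    (prod_mono Ioo_subset_Ioi_self subset_rfl) fun z hz => h0 z fun h => hz.2 ⟨h, hz.1.2⟩)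

/-- The weak gradient is given at each fixed time; Fubini makes it a statement on space-time. -/
theorem integral_mul_fderiv_of_weakGrad {ρ : ℝ → E d → ℝ} {q : ℝ → E d → E d}
    (hg : ∀ t, 0 ≤ t → IsWeakGrad (ρ t) (q t))
    (hρ : IntegrableOn (fun z : ℝ × E d => ρ z.1 z.2) (Q d T))
    (hq : ∀ i, IntegrableOn (fun z : ℝ × E d => q z.1 z.2 i) (Q d T))
    {h : ℝ × E d → ℝ} (hc : ContDiff ℝ 1 h) (hp : SpacePeriodic h) (i : Fin d) :
    ∫ z in Q d T, ρ z.1 z.2 * fderiv ℝ h z (0, e i) = - ∫ z in Q d T, q z.1 z.2 i * h z := by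
  have i1 : IntegrableOn (fun z : ℝ × E d => ρ z.1 z.2 * fderiv ℝ h z (0, e i)) (Q d T) :=
    integrableOn_mul_continuous hρ ((hc.continuous_fderiv (by simp)).clm_apply continuous_const)
  have i2 : IntegrableOn (fun z : ℝ × E d => q z.1 z.2 i * h z) (Q d T) :=
    integrableOn_mul_continuous (hq i) hc.continuous
  rw [Measure.volume_eq_prod] at i1 i2 ⊢
  rw [setIntegral_prod _ i1, setIntegral_prod _ i2, ← integral_neg]
  refine setIntegral_congr_fun measurableSet_Ioo fun t ht => ?_
  have hd : Differentiable ℝ h := hc.differentiable (by simp)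
  have h1 := (hg t ht.1.le).2.2 (fun x => h (t, x)) (hc.comp (contDiff_const.prodMk contDiff_id))
    (fun x i => hp (t, x) i) i
  simp only [(hasFDerivAt_slice (hd (t, _))).fderiv] at h1
  exact h1

end Limits

/-! ### The weak formulations tested with coefficients that have only weak derivatives. -/

section Identities

variable {d : ℕ} {T : ℝ} {θ : ℝ → ℝ}

/-- For second derivatives of a mollification the first-order identity must hold near the point, not
only at it. -/
theorem TimeCutoff.margin_nhds (h : TimeCutoff T θ) :
    ∀ᶠ n : ℕ in atTop, ∀ z : ℝ × E d, z.1 ∈ tsupport θ → ∀ᶠ y in 𝓝 z,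
      Metric.closedBall y (1 / (n + 1 : ℝ)) ⊆ Ioo 0 T ×ˢ univ := by
  obtain ⟨δ, hδ, hd⟩ := h.compact.isCompact.exists_cthickening_subset_open isOpen_Ioo h.sub
  filter_upwards [exists_margin h.compact.isCompact.cthickening isOpen_Ioo hd] with n hn z hz
  filter_upwards [Metric.ball_mem_nhds z hδ] with y hy w hw
  refine ⟨hn y.1 ?_ ?_, trivial⟩
  · refine Metric.closedBall_subset_cthickening hz δ (Metric.mem_closedBall.2 ?_)
    exact (le_max_left _ _).trans (le_of_lt hy)
  · rw [Metric.mem_closedBall] at hw ⊢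
    exact (le_max_left _ _).trans hw

/-- Both sides are the mixed second derivative of the smooth function `moll n f`. No second weak
derivative of `f` has to exist as a function, so this handles terms that disappear only after a
further integration by parts. -/
theorem moll_swap {f g h : ℝ × E d → ℝ} {O : Set (ℝ × E d)} {v w : ℝ × E d} (hf : BddMeas f)
    (hg : WD O f g v) (hh : WD O f h w) {n : ℕ} {z : ℝ × E d}
    (hz : ∀ᶠ y in 𝓝 z, Metric.closedBall y (1 / (n + 1 : ℝ)) ⊆ O) :
    fderiv ℝ (moll n g) z w = fderiv ℝ (moll n h) z v := by
  have hs := moll_contDiff n hf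
  have e1 : moll n g =ᶠ[𝓝 z] fun y => fderiv ℝ (moll n f) y v :=
    hz.mono fun y hy => (hg.fderiv_moll hf n hy).symm
  have e2 : moll n h =ᶠ[𝓝 z] fun y => fderiv ℝ (moll n f) y w :=
    hz.mono fun y hy => (hh.fderiv_moll hf n hy).symm
  have hd : DifferentiableAt ℝ (fderiv ℝ (moll n f)) z :=
    ((hs.fderiv_right (m := ∞) (by simp)).differentiable (by simp)) z
  have hsym : IsSymmSndFDerivAt ℝ (moll n f) z :=
    hs.contDiffAt.isSymmSndFDerivAt (by
      rw [minSmoothness_of_isRCLikeNormedField]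
      exact WithTop.coe_le_coe.2 (le_top : (2 : ℕ∞) ≤ ⊤))
  rw [e1.fderiv_eq, e2.fderiv_eq, fderiv_clm_apply hd (differentiableAt_const v),
    fderiv_clm_apply hd (differentiableAt_const w)]
  simpa using hsym w v

theorem TimeCutoff.moll_swap (h : TimeCutoff T θ) {f g k : ℝ × E d → ℝ} {v w : ℝ × E d}
    (hf : BddMeas f) (hg : WD (Ioo 0 T ×ˢ univ) f g v) (hh : WD (Ioo 0 T ×ˢ univ) f k w) :
    ∀ᶠ n in atTop, ∀ z : ℝ × E d,
      θ z.1 * fderiv ℝ (moll n g) z w = θ z.1 * fderiv ℝ (moll n k) z v := by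
  filter_upwards [h.margin_nhds (d := d)] with n hn z
  by_cases hz : z.1 ∈ tsupport θ
  · rw [EulerKorteweg.moll_swap hf hg hh (hn z hz)]
  · rw [TimeCutoff.eq_zero hz, zero_mul, zero_mul]

theorem TimeCutoff.fderiv_mul_space (h : TimeCutoff T θ) {f : ℝ × E d → ℝ}
    {z : ℝ × E d} (hf : DifferentiableAt ℝ f z) (v : E d) :
    fderiv ℝ (fun z : ℝ × E d => θ z.1 * f z) z (0, v) = θ z.1 * fderiv ℝ f z (0, v) := by
  have h1 : HasFDerivAt (fun z : ℝ × E d => θ z.1) _ z :=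
    (h.differentiable z.1).hasFDerivAt.comp z hasFDerivAt_fst
  rw [(h1.fun_mul hf.hasFDerivAt).fderiv]
  simp

/-- Integrability on `(0,T) × 𝕋^d` of the quantities in the weak formulation. -/
structure WeakIntegrable (T : ℝ) (F : ℝ × E d → ℝ) (ρ : ℝ → E d → ℝ) (q m : ℝ → E d → E d)
    (S : ℝ → E d → Matrix (Fin d) (Fin d) ℝ) : Prop where
  iρ : IntegrableOn (fun z : ℝ × E d => ρ z.1 z.2) (Q d T)
  iq : ∀ i, IntegrableOn (fun z : ℝ × E d => q z.1 z.2 i) (Q d T)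
  im : ∀ i, IntegrableOn (fun z : ℝ × E d => m z.1 z.2 i) (Q d T)
  ic : ∀ i j, IntegrableOn (fun z : ℝ × E d => m z.1 z.2 i * m z.1 z.2 j / ρ z.1 z.2) (Q d T)
  iS : ∀ i j, IntegrableOn (fun z : ℝ × E d => S z.1 z.2 i j) (Q d T)
  is : IntegrableOn (fun z : ℝ × E d => s F (ρ z.1 z.2, q z.1 z.2)) (Q d T)
  ir : ∀ k, IntegrableOn (fun z : ℝ × E d => r F k (ρ z.1 z.2, q z.1 z.2)) (Q d T)
  iH : ∀ i j, IntegrableOn (fun z : ℝ × E d => H F i j (ρ z.1 z.2, q z.1 z.2)) (Q d T)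

variable {F : ℝ × E d → ℝ} {ρ : ℝ → E d → ℝ} {q m : ℝ → E d → E d}
  {S : ℝ → E d → Matrix (Fin d) (Fin d) ℝ}

theorem IsWeakSolution.weakIntegrable (hw : IsWeakSolution F ρ q m S)
    (hρ : ContL1 (Icc 0 T) ρ) (hq : ContL1 (Icc 0 T) q) : WeakIntegrable T F ρ q m S := by
  have hsub : Q d T ⊆ Ioi 0 ×ˢ cell d := prod_mono Ioo_subset_Ioi_self subset_rfl
  have coord : ∀ {f : ℝ → E d → E d}, IntegrableOn (fun z : ℝ × E d => f z.1 z.2) (Q d T) →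
      ∀ i, IntegrableOn (fun z : ℝ × E d => f z.1 z.2 i) (Q d T) := fun hf i =>
    (EuclideanSpace.proj i : E d →L[ℝ] ℝ).integrable_comp hf
  exact
    { iρ := hρ.integrableOn_Q (hw.meas_ρ.mono_set hsub)
      iq := coord (hq.integrableOn_Q (hw.meas_q.mono_set hsub))
      im := coord ((hw.cont_m.mono Icc_subset_Ici_self).integrableOn_Q (hw.meas_m.mono_set hsub))
      ic := fun i j => hw.conv_loc i j T
      iS := fun i j => hw.S_loc i j T
      is := hw.stress.s_loc T
      ir := fun k => hw.stress.r_loc k T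
      iH := fun i j => hw.stress.H_loc i j T }

theorem TimeCutoff.smooth_deriv (h : TimeCutoff T θ) : ContDiff ℝ ∞ (deriv θ) :=
  (contDiff_infty_iff_deriv.1 h.smooth).2

theorem TimeCutoff.zero_at_zero (h : TimeCutoff T θ) : θ 0 = 0 :=
  TimeCutoff.eq_zero fun h0 => lt_irrefl _ (h.sub h0).1

theorem TimeCutoff.eq_zero' (h : TimeCutoff T θ) {t : ℝ} (ht : t ∉ Ioo 0 T) : θ t = 0 :=
  TimeCutoff.eq_zero fun h0 => ht (h.sub h0)

theorem TimeCutoff.deriv_eq_zero' (h : TimeCutoff T θ) {t : ℝ} (ht : t ∉ Ioo 0 T) :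
    deriv θ t = 0 :=
  TimeCutoff.deriv_eq_zero fun h0 => ht (h.sub h0)

/-- Mass balance tested with `θ f`, `f` smooth. -/
theorem IsWeakSolution.mass_smooth (hw : IsWeakSolution F ρ q m S) (hθ : TimeCutoff T θ)
    {f : ℝ × E d → ℝ} (hf : ContDiff ℝ 1 f) (hp : SpacePeriodic f) :
    ∫ z in Q d T, (ρ z.1 z.2 * (deriv θ z.1 * f z + θ z.1 * fderiv ℝ f z (1, 0))
      + ∑ i, m z.1 z.2 i * (θ z.1 * fderiv ℝ f z (0, e i))) = 0 := by
  have h1 := hw.mass _ (hθ.isTest hf hp (fun t ht => ht.1.le))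
  have hd : Differentiable ℝ f := hf.differentiable (by simp)
  simp only [hθ.dt_mul hd, TimeCutoff.dx_mul hd, hθ.zero_at_zero, zero_mul, mul_zero,
    integral_zero, neg_eq_zero] at h1
  refine Eq.trans (integral_Ioi_eq_Q (T := T) fun z hz => ?_).symm h1
  simp [hθ.eq_zero' hz, hθ.deriv_eq_zero' hz]

/-- The limit of the mass balance tested with mollifications of `f`. -/
theorem mass_identity (hw : IsWeakSolution F ρ q m S) (hi : WeakIntegrable T F ρ q m S)
    (hθ : TimeCutoff T θ) {f ft : ℝ × E d → ℝ} {fx : Fin d → ℝ × E d → ℝ}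
    (hf : TimeSpaceWD T f ft fx) :
    NullInt T fun z => ρ z.1 z.2 * (deriv θ z.1 * f z + θ z.1 * ft z)
      + ∑ i, m z.1 z.2 i * (θ z.1 * fx i z) := by
  have hB := BddTendsto.const (T := T) (hθ.bddMeas (d := d))
  have hB' := BddTendsto.const (T := T) (hθ.bddMeas_deriv (d := d))
  refine IntTendsto.null (h := fun n z => ρ z.1 z.2 * (deriv θ z.1 * moll n f z
    + θ z.1 * moll n ft z) + ∑ i, m z.1 z.2 i * (θ z.1 * moll n (fx i) z)) ?_ ?_
  · exact (((hB'.mul (.moll hf.b)).add (hB.mul (.moll hf.bt))).int hi.iρ).add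
      (.sum _ fun i => (hB.mul (.moll (hf.bx i))).int (hi.im i))
  · filter_upwards [hθ.moll_deriv hf.b hf.t,
      eventually_all.2 fun i => hθ.moll_deriv hf.b (hf.x i)] with n h1 h2
    rw [← hw.mass_smooth hθ ((moll_contDiff n hf.b).of_le (by simp)) (moll_periodic hf.per n)]
    simp only [h1, h2]

/-- This is the mass equation tested with $\theta\operatorname{div}V$, although
$\partial_t\operatorname{div}V$ need not be a function. After mollification it equals
$\operatorname{div}\partial_tV$, and the divergence is moved onto $\rho$, where it becomes
$q=\nabla\rho$. In the limit only $V$, $\partial_tV$ and $\nabla\operatorname{div}V$ remain. -/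
theorem mass_identity_div (hw : IsWeakSolution F ρ q m S) (hi : WeakIntegrable T F ρ q m S)
    (hθ : TimeCutoff T θ) {V Vt D δx : Fin d → ℝ × E d → ℝ}
    (hV : ∀ k, BddMeas (V k)) (hVt : ∀ k, BddMeas (Vt k)) (hD : ∀ k, BddMeas (D k))
    (hδ : ∀ k, BddMeas (δx k))
    (pV : ∀ k, SpacePeriodic (V k)) (pVt : ∀ k, SpacePeriodic (Vt k))
    (pD : ∀ k, SpacePeriodic (D k))
    (wt : ∀ k, WD (Ioo 0 T ×ˢ univ) (V k) (Vt k) (1, 0))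
    (wx : ∀ k, WD (Ioo 0 T ×ˢ univ) (V k) (D k) (0, e k))
    (wδ : ∀ i, WD (Ioo 0 T ×ˢ univ) (fun z => ∑ k, D k z) (δx i) (0, e i)) :
    NullInt T fun z => (∑ i, m z.1 z.2 i * (θ z.1 * δx i z))
      - ∑ k, q z.1 z.2 k * (deriv θ z.1 * V k z + θ z.1 * Vt k z) := by
  have hB := BddTendsto.const (T := T) (hθ.bddMeas (d := d))
  have hB' := BddTendsto.const (T := T) (hθ.bddMeas_deriv (d := d))
  have hδb : BddMeas fun z => ∑ k, D k z := by
    choose C hC using fun k => (hD k).bdd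
    refine ⟨Finset.stronglyMeasurable_fun_sum _ fun k _ => (hD k).meas, ∑ k, C k, fun z => ?_⟩
    exact norm_sum_le_of_le _ fun k _ => hC k z
  have hδp : SpacePeriodic fun z => ∑ k, D k z := fun z i =>
    Finset.sum_congr rfl fun k _ => pD k z i
  refine IntTendsto.null (h := fun n z => (∑ i, m z.1 z.2 i * (θ z.1 * moll n (δx i) z))
      - ∑ k, q z.1 z.2 k * (deriv θ z.1 * moll n (V k) z + θ z.1 * moll n (Vt k) z)) ?_ ?_
  · exact (IntTendsto.sum _ fun i => (hB.mul (.moll (hδ i))).int (hi.im i)).sub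
      (.sum _ fun k => ((hB'.mul (.moll (hV k))).add (hB.mul (.moll (hVt k)))).int (hi.iq k))
  · filter_upwards [eventually_all.2 fun k => hθ.moll_swap (hV k) (wt k) (wx k),
      eventually_all.2 fun i => hθ.moll_deriv hδb (wδ i), hθ.margin (d := d)] with n h1 h2 h3
    have hsm : ContDiff ℝ 1 (moll n fun z => ∑ k, D k z) := (moll_contDiff n hδb).of_le (by simp)
    have hθ1 : ContDiff ℝ 1 fun z : ℝ × E d => θ z.1 :=
      (hθ.smooth.of_le (by simp)).comp contDiff_fst
    have hθ2 : ContDiff ℝ 1 fun z : ℝ × E d => deriv θ z.1 :=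
      (hθ.smooth_deriv.of_le (by simp) : ContDiff ℝ 1 (deriv θ)).comp contDiff_fst
    have hk : ∀ k, ContDiff ℝ 1 fun z : ℝ × E d =>
        deriv θ z.1 * moll n (V k) z + θ z.1 * moll n (Vt k) z := fun k =>
      (hθ2.mul ((moll_contDiff n (hV k)).of_le (by simp))).add
        (hθ1.mul ((moll_contDiff n (hVt k)).of_le (by simp)))
    have hkp : ∀ k, SpacePeriodic fun z : ℝ × E d =>
        deriv θ z.1 * moll n (V k) z + θ z.1 * moll n (Vt k) z := fun k z i => by
      simp only [moll_periodic (pV k) n z i, moll_periodic (pVt k) n z i]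
    have hkd : ∀ k z, fderiv ℝ (fun z : ℝ × E d =>
        deriv θ z.1 * moll n (V k) z + θ z.1 * moll n (Vt k) z) z (0, e k)
        = deriv θ z.1 * moll n (D k) z + θ z.1 * fderiv ℝ (moll n (D k)) z (1, 0) := by
      intro k z
      have a1 : HasFDerivAt (fun z : ℝ × E d => deriv θ z.1) _ z :=
        ((hθ.smooth_deriv.of_le (by simp) : ContDiff ℝ 1 (deriv θ)).differentiable
          (by simp) z.1).hasFDerivAt.comp z hasFDerivAt_fst
      have a2 := a1.fun_mul (moll_differentiable n (hV k) z).hasFDerivAt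
      have a3 := ((hθ1.differentiable (by simp)).fun_mul (moll_differentiable n (hVt k)) z)
      have a4 := hθ.fderiv_mul_space (moll_differentiable n (hVt k) z) (e k)
      rw [fderiv_fun_add a2.differentiableAt a3, a2.fderiv, add_apply, a4, h1 k z]
      congr 1
      have : deriv θ z.1 * fderiv ℝ (moll n (V k)) z (0, e k) = deriv θ z.1 * moll n (D k) z := by
        by_cases hz : z.1 ∈ tsupport θ
        · rw [(wx k).fderiv_moll (hV k) n (h3 z hz)]
        · rw [TimeCutoff.deriv_eq_zero hz, zero_mul, zero_mul]
      simpa using this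
    have e1 := hw.mass_smooth hθ hsm (moll_periodic hδp n)
    have e2 : ∀ z, fderiv ℝ (moll n fun z => ∑ k, D k z) z (1, 0)
        = ∑ k, fderiv ℝ (moll n (D k)) z (1, 0) := by
      intro z
      have : (moll n fun z => ∑ k, D k z) = fun z => ∑ k, moll n (D k) z :=
        funext fun z => moll_sum _ n hD z
      rw [this, fderiv_fun_sum fun k _ => moll_differentiable n (hD k) z]
      simp
    -- The bad term: on the left is the derivative in direction `e k` of the factor on the right,
    -- because time and space derivatives of the mollification of `V k` commute.
    have e3 : ∀ k, ∫ z in Q d T, ρ z.1 z.2 * (deriv θ z.1 * moll n (D k) z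
        + θ z.1 * fderiv ℝ (moll n (D k)) z (1, 0))
        = - ∫ z in Q d T, q z.1 z.2 k *
          (deriv θ z.1 * moll n (V k) z + θ z.1 * moll n (Vt k) z) := by
      intro k
      rw [← integral_mul_fderiv_of_weakGrad hw.grad hi.iρ hi.iq (hk k) (hkp k) k]
      simp only [hkd]
    have c1 : ∀ k, IntegrableOn (fun z : ℝ × E d => ρ z.1 z.2 * (deriv θ z.1 * moll n (D k) z
        + θ z.1 * fderiv ℝ (moll n (D k)) z (1, 0))) (Q d T) := fun k => by
      refine integrableOn_mul_continuous hi.iρ ?_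
      exact (hθ2.continuous.mul (moll_continuous n (hD k))).add
        (hθ1.continuous.mul (((moll_contDiff n (hD k)).continuous_fderiv (by simp)).clm_apply
          continuous_const))
    have c2 : ∀ k, IntegrableOn (fun z : ℝ × E d => q z.1 z.2 k *
          (deriv θ z.1 * moll n (V k) z + θ z.1 * moll n (Vt k) z)) (Q d T) := fun k =>
      integrableOn_mul_continuous (hi.iq k) (hk k).continuous
    have c3 : ∀ i, IntegrableOn (fun z : ℝ × E d => m z.1 z.2 i * (θ z.1 * moll n (δx i) z))
        (Q d T) := fun i =>
      integrableOn_mul_continuous (hi.im i) (hθ1.continuous.mul (moll_continuous n (hδ i)))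
    simp only [h2, e2, moll_sum _ n hD] at e1
    rw [integral_sub (integrable_finsetSum _ fun i _ => c3 i)
      (integrable_finsetSum _ fun i _ => c2 i), integral_finsetSum _ fun k _ => c2 k,
      sub_eq_add_neg, ← Finset.sum_neg_distrib]
    simp only [← e3]
    rw [← integral_finsetSum _ fun k _ => c1 k, add_comm,
      ← integral_add (integrable_finsetSum _ fun k _ => c1 k)
        (integrable_finsetSum _ fun i _ => c3 i)]
    refine Eq.trans (integral_congr_ae (Eventually.of_forall fun z => ?_)) e1
    simp only [Finset.mul_sum, ← Finset.sum_add_distrib, mul_add]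

theorem fderiv_euclidean_apply {X : Type*} [NormedAddCommGroup X] [NormedSpace ℝ X]
    {f : X → E d} {x : X} (hf : DifferentiableAt ℝ f x) (v : X) (i : Fin d) :
    fderiv ℝ f x v i = fderiv ℝ (fun y => f y i) x v := by
  have h : HasFDerivAt (fun y => f y i) _ x :=
    (EuclideanSpace.proj i : E d →L[ℝ] ℝ).hasFDerivAt.comp x hf.hasFDerivAt
  rw [h.fderiv]; rfl

/-- Momentum balance tested with `θ u`, `u` smooth. -/
theorem IsWeakSolution.momentum_smooth (hw : IsWeakSolution F ρ q m S) (hθ : TimeCutoff T θ)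
    {u : Fin d → ℝ × E d → ℝ} (hu : ∀ i, ContDiff ℝ 1 (u i)) (hp : ∀ i, SpacePeriodic (u i)) :
    ∫ z in Q d T, ((∑ i, m z.1 z.2 i * (deriv θ z.1 * u i z + θ z.1 * fderiv ℝ (u i) z (1, 0)))
      + (∑ i, ∑ j, m z.1 z.2 i * m z.1 z.2 j / ρ z.1 z.2 * (θ z.1 * fderiv ℝ (u i) z (0, e j)))
      - ∑ i, ∑ j, S z.1 z.2 i j * (θ z.1 * fderiv ℝ (u i) z (0, e j))) = 0 := by
  have hd : ∀ i, Differentiable ℝ (u i) := fun i => (hu i).differentiable (by simp)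
  have hθ1 : ContDiff ℝ 1 fun z : ℝ × E d => θ z.1 :=
    (hθ.smooth.of_le (by simp)).comp contDiff_fst
  set φ : ℝ → E d → E d := fun t x => WithLp.toLp 2 fun i => θ t * u i (t, x) with hφ
  have hc : ContDiff ℝ 1 fun z : ℝ × E d => φ z.1 z.2 :=
    contDiff_euclidean.2 fun i => hθ1.mul (hu i)
  have hT : IsTest (Ici 0) φ := by
    refine ⟨hc, fun t x i => ?_, tsupport θ, hθ.compact, fun t ht => (hθ.sub ht).1.le,
      fun t _ ht x => ?_⟩
    · ext j
      exact congrArg (θ t * ·) (hp j (t, x) i)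
    · ext j
      simp [hφ, TimeCutoff.eq_zero ht]
  have hdt : ∀ t x i, dt φ t x i
      = deriv θ t * u i (t, x) + θ t * fderiv ℝ (u i) (t, x) (1, 0) := by
    intro t x i
    rw [← hθ.dt_mul (hd i), dt, dt]
    have h1 : DifferentiableAt ℝ (fun τ => φ τ x) t :=
      DifferentiableAt.comp (g := fun z : ℝ × E d => φ z.1 z.2) (f := fun τ : ℝ => (τ, x)) t
        (hc.differentiable (by simp) (t, x)) (differentiableAt_id.prodMk (differentiableAt_const x))
    rw [← fderiv_apply_one_eq_deriv, fderiv_euclidean_apply h1, fderiv_apply_one_eq_deriv]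
  have hdx : ∀ t x i j, dx j φ t x i = θ t * fderiv ℝ (u i) (t, x) (0, e j) := by
    intro t x i j
    rw [← TimeCutoff.dx_mul (hd i), dx, dx]
    have h1 : DifferentiableAt ℝ (φ t) x :=
      (hc.differentiable (by simp) (t, x)).comp x
        ((differentiableAt_const t).prodMk differentiableAt_id)
    exact fderiv_euclidean_apply h1 _ i
  have h1 := hw.momentum φ hT
  have h0 : ∀ x i, φ 0 x i = 0 := fun x i => by simp [hφ, hθ.zero_at_zero]
  simp only [hdt, hdx, h0, mul_zero, Finset.sum_const_zero, integral_zero, neg_eq_zero] at h1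
  refine Eq.trans (integral_Ioi_eq_Q (T := T) fun z hz => ?_).symm h1
  simp [hθ.eq_zero' hz, hθ.deriv_eq_zero' hz]

/-- The stress tensor tested with `θ f`, `f` smooth. -/
theorem IsStress.smooth (hS : IsStress F ρ q S) (hθ : TimeCutoff T θ)
    {f : ℝ × E d → ℝ} (hf : ContDiff ℝ 1 f) (hp : SpacePeriodic f) (i j : Fin d) :
    ∫ z in Q d T, S z.1 z.2 i j * (θ z.1 * f z)
      = ∫ z in Q d T, ((if i = j then - s F (ρ z.1 z.2, q z.1 z.2) * (θ z.1 * f z)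
          - ∑ k, r F k (ρ z.1 z.2, q z.1 z.2) * (θ z.1 * fderiv ℝ f z (0, e k)) else 0)
          - H F i j (ρ z.1 z.2, q z.1 z.2) * (θ z.1 * f z)) := by
  have hd : Differentiable ℝ f := hf.differentiable (by simp)
  have h1 := hS.eq _ (hθ.isTest hf hp (fun t ht => ht.1)) i j
  simp only [TimeCutoff.dx_mul hd] at h1
  refine Eq.trans (integral_Ioi_eq_Q (T := T) fun z hz => ?_).symm
    (h1.trans (integral_Ioi_eq_Q (T := T) fun z hz => ?_))
  · simp [hθ.eq_zero' hz]
  · simp [hθ.eq_zero' hz]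

theorem BddMeas.sum {f : Fin d → ℝ × E d → ℝ} (hf : ∀ k, BddMeas (f k)) :
    BddMeas fun z => ∑ k, f k z := by
  choose C hC using fun k => (hf k).bdd
  exact ⟨Finset.stronglyMeasurable_fun_sum _ fun k _ => (hf k).meas, ∑ k, C k, fun z =>
    norm_sum_le_of_le _ fun k _ => hC k z⟩

/-- Inserting the distributional definition of the stress puts one more derivative on $\nabla u$
only in the $\operatorname{div}r$ term. That term is a multiple of the identity, so it sees only the
trace, and a bounded $\nabla\operatorname{div}u$ is enough. -/
theorem momentum_identity (hw : IsWeakSolution F ρ q m S) (hi : WeakIntegrable T F ρ q m S)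
    (hθ : TimeCutoff T θ) {u ut : Fin d → ℝ × E d → ℝ} {Du : Fin d → Fin d → ℝ × E d → ℝ}
    {G : Fin d → ℝ × E d → ℝ} (hu : ∀ i, TimeSpaceWD T (u i) (ut i) (Du i))
    (pDu : ∀ i j, SpacePeriodic (Du i j)) (hG : ∀ k, BddMeas (G k))
    (wG : ∀ k, WD (Ioo 0 T ×ˢ univ) (fun z => ∑ i, Du i i z) (G k) (0, e k)) :
    NullInt T fun z => ((∑ i, m z.1 z.2 i * (deriv θ z.1 * u i z + θ z.1 * ut i z))
      + ∑ i, ∑ j, m z.1 z.2 i * m z.1 z.2 j / ρ z.1 z.2 * (θ z.1 * Du i j z))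
      + (s F (ρ z.1 z.2, q z.1 z.2) * (θ z.1 * ∑ i, Du i i z)
      + ((∑ k, r F k (ρ z.1 z.2, q z.1 z.2) * (θ z.1 * G k z))
      + ∑ i, ∑ j, H F i j (ρ z.1 z.2, q z.1 z.2) * (θ z.1 * Du i j z))) := by
  have hB := BddTendsto.const (T := T) (hθ.bddMeas (d := d))
  have hB' := BddTendsto.const (T := T) (hθ.bddMeas_deriv (d := d))
  have hDu : ∀ i j, BddMeas (Du i j) := fun i j => (hu i).bx j
  have hdiv : BddMeas fun z => ∑ i, Du i i z := BddMeas.sum fun i => hDu i i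
  have hθ1 : Continuous fun z : ℝ × E d => θ z.1 := hθ.smooth.continuous.comp continuous_fst
  refine IntTendsto.null (h := fun n z =>
      ((∑ i, m z.1 z.2 i * (deriv θ z.1 * moll n (u i) z + θ z.1 * moll n (ut i) z))
      + ∑ i, ∑ j, m z.1 z.2 i * m z.1 z.2 j / ρ z.1 z.2 * (θ z.1 * moll n (Du i j) z))
      + (s F (ρ z.1 z.2, q z.1 z.2) * (θ z.1 * ∑ i, moll n (Du i i) z)
      + ((∑ k, r F k (ρ z.1 z.2, q z.1 z.2) * (θ z.1 * moll n (G k) z))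
      + ∑ i, ∑ j, H F i j (ρ z.1 z.2, q z.1 z.2) * (θ z.1 * moll n (Du i j) z)))) ?_ ?_
  · refine IntTendsto.add (IntTendsto.add
      (.sum _ fun i => ((hB'.mul (.moll (hu i).b)).add (hB.mul (.moll (hu i).bt))).int (hi.im i))
      (.sum _ fun i => .sum _ fun j => (hB.mul (.moll (hDu i j))).int (hi.ic i j))) ?_
    refine IntTendsto.add ((hB.mul (.sum _ fun i => .moll (hDu i i))).int hi.is) ?_
    exact IntTendsto.add (.sum _ fun k => (hB.mul (.moll (hG k))).int (hi.ir k))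
      (.sum _ fun i => .sum _ fun j => (hB.mul (.moll (hDu i j))).int (hi.iH i j))
  · filter_upwards [eventually_all.2 fun i => hθ.moll_deriv (hu i).b (hu i).t,
      eventually_all.2 fun i => eventually_all.2 fun j => hθ.moll_deriv (hu i).b ((hu i).x j),
      eventually_all.2 fun k => hθ.moll_deriv hdiv (wG k)] with n h1 h2 h3
    have e1 := hw.momentum_smooth hθ (u := fun i => moll n (u i))
      (fun i => (moll_contDiff n (hu i).b).of_le (by simp)) fun i => moll_periodic (hu i).per n
    simp only [h1, h2] at e1
    have cD : ∀ i j, Continuous fun z : ℝ × E d => θ z.1 * moll n (Du i j) z := fun i j =>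
      hθ1.mul (moll_continuous n (hDu i j))
    have cd : ∀ i k, Continuous fun z : ℝ × E d =>
        θ z.1 * fderiv ℝ (moll n (Du i i)) z (0, e k) := fun i k =>
      hθ1.mul (((moll_contDiff n (hDu i i)).continuous_fderiv (by simp)).clm_apply continuous_const)
    have iS : ∀ i j, IntegrableOn (fun z : ℝ × E d => S z.1 z.2 i j * (θ z.1 * moll n (Du i j) z))
        (Q d T) := fun i j => integrableOn_mul_continuous (hi.iS i j) (cD i j)
    have is' : ∀ i, IntegrableOn (fun z : ℝ × E d =>
        s F (ρ z.1 z.2, q z.1 z.2) * (θ z.1 * moll n (Du i i) z)) (Q d T) := fun i =>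
      integrableOn_mul_continuous hi.is (cD i i)
    have ir' : ∀ i k, IntegrableOn (fun z : ℝ × E d =>
        r F k (ρ z.1 z.2, q z.1 z.2) * (θ z.1 * fderiv ℝ (moll n (Du i i)) z (0, e k))) (Q d T) :=
      fun i k => integrableOn_mul_continuous (hi.ir k) (cd i k)
    have iH' : ∀ i j, IntegrableOn (fun z : ℝ × E d =>
        H F i j (ρ z.1 z.2, q z.1 z.2) * (θ z.1 * moll n (Du i j) z)) (Q d T) := fun i j =>
      integrableOn_mul_continuous (hi.iH i j) (cD i j)
    have iR : ∀ i j, IntegrableOn (fun z : ℝ × E d =>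
        ((if i = j then - s F (ρ z.1 z.2, q z.1 z.2) * (θ z.1 * moll n (Du i j) z)
          - ∑ k, r F k (ρ z.1 z.2, q z.1 z.2) * (θ z.1 * fderiv ℝ (moll n (Du i j)) z (0, e k))
          else 0)
          - H F i j (ρ z.1 z.2, q z.1 z.2) * (θ z.1 * moll n (Du i j) z))) (Q d T) := by
      intro i j
      refine Integrable.sub ?_ (iH' i j)
      by_cases hij : i = j
      · subst hij
        simp only [if_true]
        refine Integrable.sub ?_ (integrable_finsetSum _ fun k _ => ir' i k)
        exact (is' i).neg.congr (Eventually.of_forall fun z => by simp)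
      · simp only [hij, if_false]
        exact integrable_zero _ _ _
    have e2 : ∀ i j, _ := fun i j => hw.stress.smooth hθ (f := moll n (Du i j))
      ((moll_contDiff n (hDu i j)).of_le (by simp)) (moll_periodic (pDu i j) n) i j
    have iA : IntegrableOn (fun z : ℝ × E d =>
        (∑ i, m z.1 z.2 i * (deriv θ z.1 * moll n (u i) z + θ z.1 * moll n (ut i) z))
        + ∑ i, ∑ j, m z.1 z.2 i * m z.1 z.2 j / ρ z.1 z.2 * (θ z.1 * moll n (Du i j) z))
        (Q d T) := by
      refine Integrable.add (integrable_finsetSum _ fun i _ => ?_)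
        (integrable_finsetSum _ fun i _ => integrable_finsetSum _ fun j _ =>
          integrableOn_mul_continuous (hi.ic i j) (cD i j))
      exact integrableOn_mul_continuous (hi.im i) (((hθ.continuous_deriv.comp continuous_fst).mul
        (moll_continuous n (hu i).b)).add (hθ1.mul (moll_continuous n (hu i).bt)))
    rw [integral_sub iA (integrable_finsetSum _ fun i _ => integrable_finsetSum _ fun j _ => iS i j),
      integral_finsetSum _ fun i _ => integrable_finsetSum _ fun j _ => iS i j] at e1
    have e3 : ∀ i, ∫ z in Q d T, ∑ j, S z.1 z.2 i j * (θ z.1 * moll n (Du i j) z)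
        = ∫ z in Q d T, ∑ j,
        ((if i = j then - s F (ρ z.1 z.2, q z.1 z.2) * (θ z.1 * moll n (Du i j) z)
          - ∑ k, r F k (ρ z.1 z.2, q z.1 z.2) * (θ z.1 * fderiv ℝ (moll n (Du i j)) z (0, e k))
          else 0)
          - H F i j (ρ z.1 z.2, q z.1 z.2) * (θ z.1 * moll n (Du i j) z)) := by
      intro i
      rw [integral_finsetSum _ fun j _ => iS i j, integral_finsetSum _ fun j _ => iR i j]
      exact Finset.sum_congr rfl fun j _ => e2 i j
    simp only [e3] at e1
    have iR2 : ∀ i, IntegrableOn (fun z : ℝ × E d => ∑ j,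
        ((if i = j then - s F (ρ z.1 z.2, q z.1 z.2) * (θ z.1 * moll n (Du i j) z)
          - ∑ k, r F k (ρ z.1 z.2, q z.1 z.2) * (θ z.1 * fderiv ℝ (moll n (Du i j)) z (0, e k))
          else 0)
          - H F i j (ρ z.1 z.2, q z.1 z.2) * (θ z.1 * moll n (Du i j) z))) (Q d T) := fun i =>
      integrable_finsetSum _ fun j _ => iR i j
    rw [← integral_finsetSum _ fun i _ => iR2 i, ← integral_sub iA
      (integrable_finsetSum _ fun i _ => iR2 i)] at e1
    refine Eq.trans (integral_congr_ae (Eventually.of_forall fun z => ?_)) e1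
    -- The individual derivatives of `Du i i` need not converge; only their sum over the diagonal
    -- has a limit.
    have e4 : ∀ k, θ z.1 * moll n (G k) z = ∑ i, θ z.1 * fderiv ℝ (moll n (Du i i)) z (0, e k) := by
      intro k
      rw [← h3 k z, ← Finset.mul_sum]
      have : (moll n fun z => ∑ i, Du i i z) = fun z => ∑ i, moll n (Du i i) z :=
        funext fun z => moll_sum _ n (fun i => hDu i i) z
      rw [this, fderiv_fun_sum fun i _ => moll_differentiable n (hDu i i) z]
      simp
    simp only [e4, Finset.sum_sub_distrib, Finset.sum_ite_eq, Finset.mem_univ, if_true, neg_mul,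
      Finset.sum_neg_distrib, Finset.mul_sum]
    rw [Finset.sum_comm (γ := Fin d) (f := fun k i => r F k (ρ z.1 z.2, q z.1 z.2)
      * (θ z.1 * fderiv ℝ (moll n (Du i i)) z (0, e k)))]
    ring

/-- On each line in time the mollified integrand is the derivative of a compactly supported
function. The factor `1` is the integrable weight to which `BddTendsto.int` is applied. -/
theorem time_identity (hθ : TimeCutoff T θ) {f ft : ℝ × E d → ℝ}
    (hf : BddMeas f) (hft : BddMeas ft) (h : WD (Ioo 0 T ×ˢ univ) f ft (1, 0)) :
    NullInt T fun z => (1 : ℝ) * (deriv θ z.1 * f z + θ z.1 * ft z) := by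
  have hB := BddTendsto.const (T := T) (hθ.bddMeas (d := d))
  have hB' := BddTendsto.const (T := T) (hθ.bddMeas_deriv (d := d))
  have h1 : IntegrableOn (fun _ : ℝ × E d => (1 : ℝ)) (Q d T) := integrable_const _
  refine IntTendsto.null (h := fun n z => (1 : ℝ) * (deriv θ z.1 * moll n f z
    + θ z.1 * moll n ft z)) ?_ ?_
  · exact ((hB'.mul (.moll hf)).add (hB.mul (.moll hft))).int h1
  · filter_upwards [hθ.moll_deriv hf h] with n hn
    have hi : IntegrableOn (fun z : ℝ × E d => (1 : ℝ) * (deriv θ z.1 * moll n f z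
        + θ z.1 * moll n ft z)) (Q d T) :=
      integrableOn_mul_continuous h1
        (((hθ.continuous_deriv.comp continuous_fst).mul (moll_continuous n hf)).add
          ((hθ.smooth.continuous.comp continuous_fst).mul (moll_continuous n hft)))
    simp only [← hn, one_mul] at hi ⊢
    rw [IntegrableOn, volume_restrict_Q] at hi
    rw [volume_restrict_Q, integral_prod_symm _ hi]
    refine Eq.trans (integral_congr_ae (Eventually.of_forall fun x => ?_)) (integral_zero' _ _)
    set g : ℝ → ℝ := fun t => θ t * moll n f (t, x) with hg
    have hgd : ∀ t, HasDerivAt g (deriv θ t * moll n f (t, x)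
        + θ t * fderiv ℝ (moll n f) (t, x) (1, 0)) t := by
      intro t
      have h2 : HasFDerivAt (fun τ => moll n f (τ, x))
          ((fderiv ℝ (moll n f) (t, x)).comp (ContinuousLinearMap.inl ℝ ℝ (E d))) t :=
        (moll_differentiable n hf _).hasFDerivAt.comp t (hasFDerivAt_prodMk_left t x)
      exact (hθ.differentiable t).hasDerivAt.fun_mul h2.hasDerivAt
    have hc : HasCompactSupport g := hθ.compact.mul_right
    have hgc : ContDiff ℝ 1 g := (hθ.smooth.of_le (by simp)).mul
      (((moll_contDiff n hf).of_le (by simp)).comp (contDiff_id.prodMk contDiff_const))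
    have hgd' : ∀ t, deriv θ t * moll n f (t, x) + θ t * fderiv ℝ (moll n f) (t, x) (1, 0)
        = deriv g t := fun t => (hgd t).deriv.symm
    simp only [hgd', Pi.zero_apply]
    rw [setIntegral_eq_integral_of_forall_compl_eq_zero]
    · exact integral_eq_zero_of_hasDerivAt_of_integrable (fun t => by rw [← hgd' t]; exact hgd t)
        ((hgc.continuous_deriv (by simp)).integrable_of_hasCompactSupport hc.deriv)
        (hgc.continuous.integrable_of_hasCompactSupport hc)
    · intro t ht
      rw [← hgd', hθ.eq_zero' ht, hθ.deriv_eq_zero' ht]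
      ring

/-- The integral of $\partial_j(uf)$ over the torus vanishes. The hypothesis `H` is phrased with
periodic tests because the test function, `θ` times a mollification of `f`, is periodic and not
compactly supported in space. -/
theorem divergence_identity (hθ : TimeCutoff T θ) {u u' f fx : ℝ × E d → ℝ} {j : Fin d}
    (hu : BddMeas u) (hu' : BddMeas u') (hf : BddMeas f) (hfx : BddMeas fx)
    (hp : SpacePeriodic f)
    (H : ∀ φ : ℝ → E d → ℝ, IsTest (Ioo 0 T) φ →
      ∫ z in Q d T, u z * dx j φ z.1 z.2 = - ∫ z in Q d T, u' z * φ z.1 z.2)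
    (h : WD (Ioo 0 T ×ˢ univ) f fx (0, e j)) :
    NullInt T fun z => u z * (θ z.1 * fx z) + u' z * (θ z.1 * f z) := by
  have hB := BddTendsto.const (T := T) (hθ.bddMeas (d := d))
  have int : ∀ {w : ℝ × E d → ℝ}, BddMeas w → IntegrableOn w (Q d T) := fun {w} hw => by
    obtain ⟨C, hC⟩ := hw.bdd
    exact Integrable.of_bound hw.meas.aestronglyMeasurable C (Eventually.of_forall hC)
  have I := ((hB.mul (.moll hfx)).int (int hu)).add ((hB.mul (.moll hf)).int (int hu'))
  refine I.null ?_
  filter_upwards [hθ.moll_deriv hf h] with n hn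
  have e1 := H _ (hθ.isTest ((moll_contDiff n hf).of_le (by simp)) (moll_periodic hp n) subset_rfl)
  simp only [TimeCutoff.dx_mul (moll_differentiable n hf), hn] at e1
  rw [integral_add (((hB.mul (.moll hfx)).int (int hu)).int n)
    (((hB.mul (.moll hf)).int (int hu')).int n), e1]
  simp

/-- This is $\int\theta\operatorname{div}(\rho\,[u,V])=0$ for the Lie bracket
$[u,V]=(u\cdot\nabla)V-(V\cdot\nabla)u$. In $\operatorname{div}[u,V]$ the products of first
derivatives cancel, leaving $u\cdot\nabla\operatorname{div}V-V\cdot\nabla\operatorname{div}u$; full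
second derivatives of `u` and `V` do not survive the limit. -/
theorem commutator_identity (hw : IsWeakSolution F ρ q m S) (hi : WeakIntegrable T F ρ q m S)
    (hθ : TimeCutoff T θ) {u G V δx : Fin d → ℝ × E d → ℝ} {Du Vx : Fin d → Fin d → ℝ × E d → ℝ}
    (hu : ∀ i, BddMeas (u i)) (hDu : ∀ i j, BddMeas (Du i j)) (hG : ∀ k, BddMeas (G k))
    (hV : ∀ i, BddMeas (V i)) (hVx : ∀ i j, BddMeas (Vx i j)) (hδ : ∀ k, BddMeas (δx k))
    (pu : ∀ i, SpacePeriodic (u i)) (pDu : ∀ i j, SpacePeriodic (Du i j))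
    (pV : ∀ i, SpacePeriodic (V i)) (pVx : ∀ i j, SpacePeriodic (Vx i j))
    (wu : ∀ i j, WD (Ioo 0 T ×ˢ univ) (u i) (Du i j) (0, e j))
    (wV : ∀ i j, WD (Ioo 0 T ×ˢ univ) (V i) (Vx i j) (0, e j))
    (wG : ∀ k, WD (Ioo 0 T ×ˢ univ) (fun z => ∑ i, Du i i z) (G k) (0, e k))
    (wδ : ∀ k, WD (Ioo 0 T ×ˢ univ) (fun z => ∑ i, Vx i i z) (δx k) (0, e k)) :
    NullInt T fun z => ρ z.1 z.2 * (θ z.1 * ∑ j, (u j z * δx j z - V j z * G j z))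
      + ∑ i, q z.1 z.2 i * (θ z.1 * ∑ j, (u j z * Vx i j z - V j z * Du i j z)) := by
  have hB := BddTendsto.const (T := T) (hθ.bddMeas (d := d))
  have hθ1 : ContDiff ℝ 1 fun z : ℝ × E d => θ z.1 :=
    (hθ.smooth.of_le (by simp)).comp contDiff_fst
  have hdiv : BddMeas fun z => ∑ i, Du i i z := BddMeas.sum fun i => hDu i i
  have hVdiv : BddMeas fun z => ∑ i, Vx i i z := BddMeas.sum fun i => hVx i i
  refine IntTendsto.null (h := fun n z => ρ z.1 z.2 * (θ z.1 * ∑ j,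
      (moll n (u j) z * moll n (δx j) z - moll n (V j) z * moll n (G j) z))
      + ∑ i, q z.1 z.2 i * (θ z.1 * ∑ j,
      (moll n (u j) z * moll n (Vx i j) z - moll n (V j) z * moll n (Du i j) z))) ?_ ?_
  · refine IntTendsto.add (BddTendsto.int (hB.mul (.sum _ fun j => ?_)) hi.iρ)
      (.sum _ fun i => BddTendsto.int (hB.mul (.sum _ fun j => ?_)) (hi.iq i))
    · exact (BddTendsto.mul (.moll (hu j)) (.moll (hδ j))).sub (.mul (.moll (hV j)) (.moll (hG j)))
    · exact (BddTendsto.mul (.moll (hu j)) (.moll (hVx i j))).sub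
        (.mul (.moll (hV j)) (.moll (hDu i j)))
  · filter_upwards [eventually_all.2 fun i => eventually_all.2 fun j => hθ.moll_deriv (hu i) (wu i j),
      eventually_all.2 fun i => eventually_all.2 fun j => hθ.moll_deriv (hV i) (wV i j),
      eventually_all.2 fun k => hθ.moll_deriv hdiv (wG k),
      eventually_all.2 fun k => hθ.moll_deriv hVdiv (wδ k),
      eventually_all.2 fun i => eventually_all.2 fun j => hθ.moll_swap (hu i) (wu i j) (wu i i),
      eventually_all.2 fun i => eventually_all.2 fun j => hθ.moll_swap (hV i) (wV i j) (wV i i)]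
      with n h1 h2 h3 h4 h5 h6
    have dsum : ∀ {f : Fin d → Fin d → ℝ × E d → ℝ}, (∀ i j, BddMeas (f i j)) → ∀ z v,
        fderiv ℝ (moll n fun z => ∑ i, f i i z) z v = ∑ i, fderiv ℝ (moll n (f i i)) z v := by
      intro f hf z v
      have : (moll n fun z => ∑ i, f i i z) = fun z => ∑ i, moll n (f i i) z :=
        funext fun z => moll_sum _ n (fun i => hf i i) z
      rw [this, fderiv_fun_sum fun i _ => moll_differentiable n (hf i i) z]
      simp
    simp only [dsum hDu] at h3
    simp only [dsum hVx] at h4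
    set g : Fin d → ℝ × E d → ℝ := fun i z => ∑ j,
      (moll n (u j) z * moll n (Vx i j) z - moll n (V j) z * moll n (Du i j) z) with hg
    have sm : ∀ {f : ℝ × E d → ℝ}, BddMeas f → ContDiff ℝ 1 (moll n f) := fun hf =>
      (moll_contDiff n hf).of_le (by simp)
    have gc : ∀ i, ContDiff ℝ 1 (g i) := fun i => ContDiff.sum fun j _ =>
      ((sm (hu j)).mul (sm (hVx i j))).sub ((sm (hV j)).mul (sm (hDu i j)))
    have gp : ∀ i, SpacePeriodic fun z => θ z.1 * g i z := fun i z k => by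
      simp only [hg, moll_periodic (pu _) n z k, moll_periodic (pVx _ _) n z k,
        moll_periodic (pV _) n z k, moll_periodic (pDu _ _) n z k]
    have gd : ∀ i z, fderiv ℝ (fun z : ℝ × E d => θ z.1 * g i z) z (0, e i)
        = ∑ j, θ z.1 * ((fderiv ℝ (moll n (u j)) z (0, e i) * moll n (Vx i j) z
            + moll n (u j) z * fderiv ℝ (moll n (Vx i j)) z (0, e i))
          - (fderiv ℝ (moll n (V j)) z (0, e i) * moll n (Du i j) z
            + moll n (V j) z * fderiv ℝ (moll n (Du i j)) z (0, e i))) := by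
      intro i z
      rw [hθ.fderiv_mul_space ((gc i).differentiable (by simp) z), ← Finset.mul_sum]
      congr 1
      have hD : ∀ {f : ℝ × E d → ℝ}, BddMeas f → HasFDerivAt (moll n f) (fderiv ℝ (moll n f) z) z :=
        fun hf => (moll_differentiable n hf z).hasFDerivAt
      have : HasFDerivAt (g i) _ z := HasFDerivAt.fun_sum fun j _ =>
        ((hD (hu j)).fun_mul (hD (hVx i j))).fun_sub ((hD (hV j)).fun_mul (hD (hDu i j)))
      rw [this.fderiv]
      simp only [sum_apply, sub_apply, add_apply, smul_apply, smul_eq_mul]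
      refine Finset.sum_congr rfl fun j _ => ?_
      ring
    have e1 : ∀ i, ∫ z in Q d T, ρ z.1 z.2 * fderiv ℝ (fun z : ℝ × E d => θ z.1 * g i z) z (0, e i)
        = - ∫ z in Q d T, q z.1 z.2 i * (θ z.1 * g i z) := fun i =>
      integral_mul_fderiv_of_weakGrad hw.grad hi.iρ hi.iq (hθ1.mul (gc i)) (gp i) i
    have i1 : ∀ i, IntegrableOn (fun z : ℝ × E d => ρ z.1 z.2 *
        fderiv ℝ (fun z : ℝ × E d => θ z.1 * g i z) z (0, e i)) (Q d T) := fun i =>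
      integrableOn_mul_continuous hi.iρ
        (((hθ1.mul (gc i)).continuous_fderiv (by simp)).clm_apply continuous_const)
    have i2 : ∀ i, IntegrableOn (fun z : ℝ × E d => q z.1 z.2 i * (θ z.1 * g i z)) (Q d T) :=
      fun i => integrableOn_mul_continuous (hi.iq i) (hθ1.mul (gc i)).continuous
    have e2 : ∫ z in Q d T, ((∑ i, ρ z.1 z.2 *
        fderiv ℝ (fun z : ℝ × E d => θ z.1 * g i z) z (0, e i))
        + ∑ i, q z.1 z.2 i * (θ z.1 * g i z)) = 0 := by
      rw [integral_add (integrable_finsetSum _ fun i _ => i1 i)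
        (integrable_finsetSum _ fun i _ => i2 i), integral_finsetSum _ fun i _ => i1 i,
        integral_finsetSum _ fun i _ => i2 i, ← Finset.sum_add_distrib]
      exact Finset.sum_eq_zero fun i _ => by rw [e1 i]; ring
    refine Eq.trans (integral_congr_ae (Eventually.of_forall fun z => ?_)) e2
    simp only
    congr 1
    rw [← Finset.mul_sum]
    congr 1
    simp only [gd]
    -- The first two terms on the right are exchanged by interchanging `i` and `j`, so they cancel
    -- in the double sum. In the others `h5` and `h6` have turned $\partial_i\partial_j$ of the
    -- `i`-th component into $\partial_j$ of the diagonal entry, which sums to a divergence.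
    have key : ∀ i j, θ z.1 * ((fderiv ℝ (moll n (u j)) z (0, e i) * moll n (Vx i j) z
            + moll n (u j) z * fderiv ℝ (moll n (Vx i j)) z (0, e i))
          - (fderiv ℝ (moll n (V j)) z (0, e i) * moll n (Du i j) z
            + moll n (V j) z * fderiv ℝ (moll n (Du i j)) z (0, e i)))
        = θ z.1 * (moll n (Du j i) z * moll n (Vx i j) z)
          - θ z.1 * (moll n (Vx j i) z * moll n (Du i j) z)
          + (moll n (u j) z * (θ z.1 * fderiv ℝ (moll n (Vx i i)) z (0, e j))
          - moll n (V j) z * (θ z.1 * fderiv ℝ (moll n (Du i i)) z (0, e j))) := by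
      intro i j
      linear_combination moll n (Vx i j) z * h1 j i z - moll n (Du i j) z * h2 j i z
        + moll n (u j) z * h6 i j z - moll n (V j) z * h5 i j z
    simp only [key, Finset.sum_add_distrib, Finset.sum_sub_distrib]
    rw [Finset.sum_comm (f := fun i j => θ z.1 * (moll n (Vx j i) z * moll n (Du i j) z)),
      Finset.sum_comm (f := fun i j => moll n (u j) z * (θ z.1 * fderiv ℝ (moll n (Vx i i)) z (0, e j))),
      Finset.sum_comm (f := fun i j => moll n (V j) z * (θ z.1 * fderiv ℝ (moll n (Du i i)) z (0, e j)))]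
    simp only [← Finset.mul_sum, h3, h4]
    simp only [mul_sub, Finset.mul_sum, mul_comm (moll n (Du _ _) z), mul_left_comm (θ z.1)]
    ring

end Identities

/-! ### The constitutive functions and their first derivatives on the phase space. -/

section Phase

variable {d : ℕ}

/-- A part `Ω` of the phase space on which `F` is smooth, with a compact convex subset `K`. -/
structure PhaseDomain (F : ℝ × E d → ℝ) (Ω K : Set (ℝ × E d)) : Prop where
  unique : UniqueDiffOn ℝ Ω
  smooth : ContDiffOn ℝ ∞ F Ω
  interior : Ω ⊆ closure (interior Ω)
  fderiv_eq : ∀ (G : ℝ × E d → ℝ), ∀ z ∈ Ω, fderivWithin ℝ G (phase d) z = fderivWithin ℝ G Ω z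
  convex : Convex ℝ K
  compact : IsCompact K
  sub : K ⊆ Ω

/-- Without vacuum, compactness bounds the density below by some `a > 0` and the open half-space
serves as `Ω`. Otherwise `Ω` is the closed phase space and smoothness of `F` up to the boundary is
used. In both cases `K` is an interval times a ball, hence convex. -/
theorem exists_phaseDomain {T : ℝ} (hT : 0 ≤ T) {F : ℝ × E d → ℝ}
    (hF : ContDiffOn ℝ ∞ F (Ioi 0 ×ˢ univ)) {ρb : ℝ → E d → ℝ} {qb : ℝ → E d → E d}
    (pρ : Periodic ρb) (pq : Periodic qb)
    (cρ : ContinuousOn (fun z : ℝ × E d => ρb z.1 z.2) (Icc 0 T ×ˢ univ))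
    (cq : ContinuousOn (fun z : ℝ × E d => qb z.1 z.2) (Icc 0 T ×ˢ univ))
    (hn : ∀ t ∈ Icc 0 T, ∀ x, 0 ≤ ρb t x)
    (hvac : (∀ t ∈ Icc 0 T, ∀ x, 0 < ρb t x) ∨ ContDiffOn ℝ ∞ F (Ici 0 ×ˢ univ)) :
    ∃ Ω K, PhaseDomain F Ω K ∧ ∀ t ∈ Icc 0 T, ∀ x, (ρb t x, qb t x) ∈ K := by
  obtain ⟨S, hS, hSI, hS', hSm⟩ := pρ.exists_compact cρ
  obtain ⟨R, -, -, hR', hRm⟩ := pq.exists_compact cq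
  obtain ⟨C, hC⟩ := hS'.isBounded.exists_norm_le
  obtain ⟨B, hB⟩ := hR'.isBounded.exists_norm_le
  have box : ∀ a : ℝ, Convex ℝ (Icc a C ×ˢ Metric.closedBall (0 : E d) B) ∧
      IsCompact (Icc a C ×ˢ Metric.closedBall (0 : E d) B) := fun a =>
    ⟨(convex_Icc a C).prod (convex_closedBall _ _), isCompact_Icc.prod (isCompact_closedBall _ _)⟩
  have mem : ∀ a : ℝ, (∀ t ∈ Icc 0 T, ∀ x, a ≤ ρb t x) → ∀ t ∈ Icc 0 T, ∀ x,
      (ρb t x, qb t x) ∈ Icc a C ×ˢ Metric.closedBall (0 : E d) B := fun a ha t ht x =>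
    ⟨⟨ha t ht x, (le_abs_self _).trans (hC _ (hSm t ht x))⟩,
      mem_closedBall_zero_iff.2 (hB _ (hRm t ht x))⟩
  rcases hvac with h | h
  · have hne : ((fun z : ℝ × E d => ρb z.1 z.2) '' S).Nonempty :=
      ⟨_, hSm 0 ⟨le_rfl, hT⟩ 0⟩
    obtain ⟨a, ⟨⟨z, hz, hza⟩, hal⟩⟩ := hS'.exists_isLeast hne
    have ha : 0 < a := by rw [← hza]; exact h _ (hSI hz).1 _
    have ho : IsOpen ((Ioi (0 : ℝ)) ×ˢ (univ : Set (E d))) := isOpen_Ioi.prod isOpen_univ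
    refine ⟨Ioi 0 ×ˢ univ, Icc a C ×ˢ Metric.closedBall 0 B, ⟨ho.uniqueDiffOn, hF, ?_, ?_,
      (box a).1, (box a).2, ?_⟩, mem a fun t ht x => hal (hSm t ht x)⟩
    · rw [ho.interior_eq]; exact subset_closure
    · intro G z hz
      have : phase d ∈ 𝓝 z :=
        mem_of_superset (ho.mem_nhds hz) (prod_mono Ioi_subset_Ici_self subset_rfl)
      rw [fderivWithin_of_mem_nhds this, fderivWithin_of_isOpen ho hz]
    · exact prod_mono (fun x hx => ha.trans_le hx.1) (subset_univ _)
  · refine ⟨phase d, Icc 0 C ×ˢ Metric.closedBall 0 B, ⟨?_, h, ?_, fun _ _ _ => rfl,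
      (box 0).1, (box 0).2, ?_⟩, mem 0 hn⟩
    · exact (uniqueDiffOn_Ici 0).prod uniqueDiffOn_univ
    · rw [phase, interior_prod_eq, closure_prod_eq]
      simp
    · exact prod_mono (fun x hx => hx.1) (subset_univ _)

variable {F : ℝ × E d → ℝ} {Ω K : Set (ℝ × E d)}

/-- The Hessian of `F`. -/
noncomputable def hess (F : ℝ × E d → ℝ) (Ω : Set (ℝ × E d)) (z : ℝ × E d) :
    (ℝ × E d) →L[ℝ] (ℝ × E d) →L[ℝ] ℝ := fderivWithin ℝ (fderivWithin ℝ F Ω) Ω z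

/-- The coordinate vector `(0, e_k)`. -/
noncomputable abbrev ev (k : Fin d) : ℝ × E d := (0, e k)

theorem phase_vector_eq (z : ℝ × E d) : z = z.1 • ((1 : ℝ), (0 : E d)) + ∑ k, z.2 k • ev k := by
  refine Prod.ext ?_ ?_
  · simp [Prod.fst_sum]
  · ext j
    simp [Prod.snd_sum, Finset.sum_apply, Pi.single_apply]

namespace PhaseDomain

theorem smooth_grad (h : PhaseDomain F Ω K) : ContDiffOn ℝ ∞ (fderivWithin ℝ F Ω) Ω :=
  h.smooth.fderivWithin h.unique (by simp)

theorem hasFDerivWithinAt_grad (h : PhaseDomain F Ω K) {z : ℝ × E d} (hz : z ∈ Ω) :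
    HasFDerivWithinAt (fderivWithin ℝ F Ω) (hess F Ω z) Ω z :=
  (h.smooth_grad.differentiableOn (by simp) z hz).hasFDerivWithinAt

theorem hasFDerivWithinAt (h : PhaseDomain F Ω K) {z : ℝ × E d} (hz : z ∈ Ω) :
    HasFDerivWithinAt F (fderivWithin ℝ F Ω z) Ω z :=
  (h.smooth.differentiableOn (by simp) z hz).hasFDerivWithinAt

/-- At vacuum states the symmetry is inherited from the interior, which is why `PhaseDomain`
requires `Ω` to lie in the closure of its interior. -/
theorem hess_symm (h : PhaseDomain F Ω K) {z : ℝ × E d} (hz : z ∈ Ω) (v w : ℝ × E d) :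
    hess F Ω z v w = hess F Ω z w v :=
  (h.smooth z hz).isSymmSndFDerivWithinAt (by
    rw [minSmoothness_of_isRCLikeNormedField]
    exact WithTop.coe_le_coe.2 (le_top : (2 : ℕ∞) ≤ ⊤)) h.unique (h.interior hz) hz v w

theorem Fρ_eq (h : PhaseDomain F Ω K) {z : ℝ × E d} (hz : z ∈ Ω) :
    Fρ F z = fderivWithin ℝ F Ω z (1, 0) := by rw [Fρ, h.fderiv_eq F z hz]

theorem Fq_eq (h : PhaseDomain F Ω K) (k : Fin d) {z : ℝ × E d} (hz : z ∈ Ω) :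
    Fq F k z = fderivWithin ℝ F Ω z (ev k) := by rw [Fq, h.fderiv_eq F z hz]

theorem fderivWithin_apply_eq (h : PhaseDomain F Ω K) {z : ℝ × E d} (hz : z ∈ Ω) (w : ℝ × E d) :
    fderivWithin ℝ F Ω z w = w.1 * Fρ F z + ∑ k, w.2 k * Fq F k z := by
  conv_lhs => rw [phase_vector_eq w]
  rw [map_add, map_sum, map_smul, h.Fρ_eq hz]
  simp only [map_smul, smul_eq_mul, h.Fq_eq _ hz]

theorem s_eq (h : PhaseDomain F Ω K) {z : ℝ × E d} (hz : z ∈ Ω) :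
    s F z = fderivWithin ℝ F Ω z z - F z := by
  rw [h.fderivWithin_apply_eq hz, s]

theorem hasFDerivWithinAt_Fρ (h : PhaseDomain F Ω K) {z : ℝ × E d} (hz : z ∈ Ω) :
    HasFDerivWithinAt (Fρ F) ((hess F Ω z).flip (1, 0)) Ω z := by
  have h1 := (h.hasFDerivWithinAt_grad hz).clm_apply (hasFDerivWithinAt_const ((1 : ℝ), (0 : E d)) z Ω)
  refine (h1.congr (fun y hy => h.Fρ_eq hy) (h.Fρ_eq hz)).congr_fderiv ?_
  ext <;> simp

theorem hasFDerivWithinAt_Fq (h : PhaseDomain F Ω K) (k : Fin d) {z : ℝ × E d} (hz : z ∈ Ω) :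
    HasFDerivWithinAt (Fq F k) ((hess F Ω z).flip (ev k)) Ω z := by
  have h1 := (h.hasFDerivWithinAt_grad hz).clm_apply (hasFDerivWithinAt_const (ev k) z Ω)
  refine (h1.congr (fun y hy => h.Fq_eq k hy) (h.Fq_eq k hz)).congr_fderiv ?_
  ext <;> simp

/-- As $s(z)=DF(z)z-F(z)$ is a Legendre-type transform, the first-order terms cancel and only the
Hessian paired with `z` remains. -/
theorem hasFDerivWithinAt_s (h : PhaseDomain F Ω K) {z : ℝ × E d} (hz : z ∈ Ω) :
    HasFDerivWithinAt (s F) ((hess F Ω z).flip z) Ω z := by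
  have h1 := ((h.hasFDerivWithinAt_grad hz).clm_apply (hasFDerivWithinAt_id z Ω)).fun_sub
    (h.hasFDerivWithinAt hz)
  refine (h1.congr (fun y hy => h.s_eq hy) (h.s_eq hz)).congr_fderiv ?_
  ext <;> simp

theorem fderivWithin_Fρ (h : PhaseDomain F Ω K) {z : ℝ × E d} (hz : z ∈ Ω) (w : ℝ × E d) :
    fderivWithin ℝ (Fρ F) Ω z w = hess F Ω z w (1, 0) := by
  rw [(h.hasFDerivWithinAt_Fρ hz).fderivWithin (h.unique z hz)]; rfl

theorem fderivWithin_Fq (h : PhaseDomain F Ω K) (k : Fin d) {z : ℝ × E d} (hz : z ∈ Ω)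
    (w : ℝ × E d) : fderivWithin ℝ (Fq F k) Ω z w = hess F Ω z w (ev k) := by
  rw [(h.hasFDerivWithinAt_Fq k hz).fderivWithin (h.unique z hz)]; rfl

theorem fderivWithin_s (h : PhaseDomain F Ω K) {z : ℝ × E d} (hz : z ∈ Ω) (w : ℝ × E d) :
    fderivWithin ℝ (s F) Ω z w = hess F Ω z w z := by
  rw [(h.hasFDerivWithinAt_s hz).fderivWithin (h.unique z hz)]; rfl

theorem fderivWithin_r (h : PhaseDomain F Ω K) (k : Fin d) {z : ℝ × E d} (hz : z ∈ Ω)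
    (w : ℝ × E d) :
    fderivWithin ℝ (r F k) Ω z w = w.1 * Fq F k z + z.1 * hess F Ω z w (ev k) := by
  have h1 : HasFDerivWithinAt (r F k) _ Ω z :=
    (hasFDerivAt_fst.hasFDerivWithinAt).fun_mul (h.hasFDerivWithinAt_Fq k hz)
  rw [h1.fderivWithin (h.unique z hz)]
  simp
  ring

theorem fderivWithin_H (h : PhaseDomain F Ω K) (i j : Fin d) {z : ℝ × E d} (hz : z ∈ Ω)
    (w : ℝ × E d) :
    fderivWithin ℝ (H F i j) Ω z w = w.2 i * Fq F j z + z.2 i * hess F Ω z w (ev j) := by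
  have h0 : HasFDerivWithinAt (fun z : ℝ × E d => z.2 i)
      ((EuclideanSpace.proj i : E d →L[ℝ] ℝ).comp (ContinuousLinearMap.snd ℝ ℝ (E d))) Ω z :=
    ((EuclideanSpace.proj i : E d →L[ℝ] ℝ).comp
      (ContinuousLinearMap.snd ℝ ℝ (E d))).hasFDerivWithinAt
  have h1 : HasFDerivWithinAt (H F i j) _ Ω z := h0.fun_mul (h.hasFDerivWithinAt_Fq j hz)
  rw [h1.fderivWithin (h.unique z hz)]
  simp
  ring

theorem contDiffOn_Fρ (h : PhaseDomain F Ω K) : ContDiffOn ℝ ∞ (Fρ F) Ω :=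
  (h.smooth_grad.clm_apply contDiffOn_const).congr fun z hz => h.Fρ_eq hz

theorem contDiffOn_Fq (h : PhaseDomain F Ω K) (k : Fin d) : ContDiffOn ℝ ∞ (Fq F k) Ω :=
  (h.smooth_grad.clm_apply contDiffOn_const).congr fun z hz => h.Fq_eq k hz

theorem contDiffOn_s (h : PhaseDomain F Ω K) : ContDiffOn ℝ ∞ (s F) Ω :=
  ((h.smooth_grad.clm_apply contDiffOn_id).sub h.smooth).congr fun z hz => h.s_eq hz

end PhaseDomain

end Phase

/-! ### Vector-valued fields, and passage from the torus definitions to `WD`. -/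

section Vector

variable {d : ℕ}

theorem WD.prodMk {O : Set (ℝ × E d)} {f f' : ℝ × E d → ℝ} {g g' : ℝ × E d → E d} {v : ℝ × E d}
    (hf : BddMeas f) (hf' : BddMeas f') (hg : BddMeas g) (hg' : BddMeas g')
    (h1 : WD O f f' v) (h2 : WD O g g' v) :
    WD O (fun z => (f z, g z)) (fun z => (f' z, g' z)) v := by
  intro φ hφ hφc hφO
  have hφ' : Continuous fun x => fderiv ℝ φ x v :=
    (hφ.continuous_fderiv (by simp)).clm_apply continuous_const
  have hc := hasCompactSupport_fderiv_apply hφc v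
  simp only [Prod.smul_mk]
  rw [integral_pair (WD.integrable_test hf hφ' hc) (WD.integrable_test hg hφ' hc),
    integral_pair (WD.integrable_test hf' hφ.continuous hφc)
      (WD.integrable_test hg' hφ.continuous hφc), h1 φ hφ hφc hφO, h2 φ hφ hφc hφO]
  rfl

theorem BddMeas.euclidean {f : Fin d → ℝ × E d → ℝ} (hf : ∀ i, BddMeas (f i)) :
    BddMeas fun z => (WithLp.toLp 2 fun i => f i z : E d) := by
  choose C hC using fun i => (hf i).bdd
  refine ⟨?_, Real.sqrt (∑ i, C i ^ 2), fun z => ?_⟩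
  · exact ((MeasurableEquiv.toLp 2 (Fin d → ℝ)).measurable.comp
      (measurable_pi_lambda _ fun i => (hf i).meas.measurable)).stronglyMeasurable
  · rw [EuclideanSpace.norm_eq]
    refine Real.sqrt_le_sqrt (Finset.sum_le_sum fun i _ => ?_)
    exact pow_le_pow_left₀ (norm_nonneg _) (hC i z) 2

theorem WD.euclidean {O : Set (ℝ × E d)} {f f' : Fin d → ℝ × E d → ℝ} {v : ℝ × E d}
    (hf : ∀ i, BddMeas (f i)) (hf' : ∀ i, BddMeas (f' i)) (h : ∀ i, WD O (f i) (f' i) v) :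
    WD O (fun z => (WithLp.toLp 2 fun i => f i z : E d)) (fun z => WithLp.toLp 2 fun i => f' i z)
      v := by
  intro φ hφ hφc hφO
  have hφ' : Continuous fun x => fderiv ℝ φ x v :=
    (hφ.continuous_fderiv (by simp)).clm_apply continuous_const
  have hc := hasCompactSupport_fderiv_apply hφc v
  have key : ∀ {w : ℝ × E d → E d}, Integrable w → ∀ i, (∫ z, w z) i = ∫ z, w z i := fun hw i =>
    ((EuclideanSpace.proj i : E d →L[ℝ] ℝ).integral_comp_comm hw).symm
  ext i
  rw [PiLp.neg_apply, key (WD.integrable_test (BddMeas.euclidean hf) hφ' hc),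
    key (WD.integrable_test (BddMeas.euclidean hf') hφ.continuous hφc)]
  exact h i φ hφ hφc hφO

theorem BddMeas.prodMk {f : ℝ × E d → ℝ} {g : ℝ × E d → E d} (hf : BddMeas f) (hg : BddMeas g) :
    BddMeas fun z => (f z, g z) := by
  obtain ⟨A, hA⟩ := hf.bdd
  obtain ⟨B, hB⟩ := hg.bdd
  exact ⟨hf.meas.prodMk hg.meas, max A B, fun z => max_le_max (hA z) (hB z)⟩

theorem BddMeas.mul {f g : ℝ × E d → ℝ} (hf : BddMeas f) (hg : BddMeas g) :
    BddMeas fun z => f z * g z := by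
  obtain ⟨A, hA⟩ := hf.bdd
  obtain ⟨B, hB⟩ := hg.bdd
  refine ⟨hf.meas.mul hg.meas, A * B, fun z => ?_⟩
  rw [norm_mul]
  exact mul_le_mul (hA z) (hB z) (norm_nonneg _) ((norm_nonneg _).trans (hA z))

theorem BddMeas.add {f g : ℝ × E d → ℝ} (hf : BddMeas f) (hg : BddMeas g) :
    BddMeas fun z => f z + g z := by
  obtain ⟨A, hA⟩ := hf.bdd
  obtain ⟨B, hB⟩ := hg.bdd
  exact ⟨hf.meas.add hg.meas, A + B, fun z => (norm_add_le _ _).trans (add_le_add (hA z) (hB z))⟩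

theorem BddMeas.sub {f g : ℝ × E d → ℝ} (hf : BddMeas f) (hg : BddMeas g) :
    BddMeas fun z => f z - g z := by
  obtain ⟨A, hA⟩ := hf.bdd
  obtain ⟨B, hB⟩ := hg.bdd
  exact ⟨hf.meas.sub hg.meas, A + B, fun z => (norm_sub_le _ _).trans (add_le_add (hA z) (hB z))⟩

theorem BddMeas.const (c : ℝ) : BddMeas fun _ : ℝ × E d => c :=
  ⟨stronglyMeasurable_const, ‖c‖, fun _ => le_rfl⟩

variable {T : ℝ} {F : ℝ × E d → ℝ} {Ω K : Set (ℝ × E d)}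

theorem fderiv_uncurry_eq_dx {I : Set ℝ} {ψ : ℝ → E d → ℝ} (h : IsTest I ψ) (i : Fin d)
    (z : ℝ × E d) : dx i ψ z.1 z.2 = fderiv ℝ (fun z : ℝ × E d => ψ z.1 z.2) z (0, e i) :=
  dx_eq (f := fun z : ℝ × E d => ψ z.1 z.2) (h.1.differentiable (by simp) _) i

theorem fderiv_uncurry_eq_dt {I : Set ℝ} {ψ : ℝ → E d → ℝ} (h : IsTest I ψ)
    (z : ℝ × E d) : dt ψ z.1 z.2 = fderiv ℝ (fun z : ℝ × E d => ψ z.1 z.2) z (1, 0) :=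
  dt_eq (f := fun z : ℝ × E d => ψ z.1 z.2) (h.1.differentiable (by simp) _)

/-- Transfers a hypothesis on the given fields, known almost everywhere on the cell, to the globally
defined periodic representatives on which mollification acts. -/
theorem IsWeakDx.wd {i : Fin d} {f g : ℝ → E d → ℝ} (h : IsWeakDx T i f g)
    {f' g' : ℝ × E d → ℝ} (hf : BddMeas f') (hg : BddMeas g') (pf : SpacePeriodic f')
    (pg : SpacePeriodic g') (ef : ∀ᵐ z ∂(volume.restrict (Q d T)), f z.1 z.2 = f' z)
    (eg : ∀ᵐ z ∂(volume.restrict (Q d T)), g z.1 z.2 = g' z) :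
    WD (Ioo 0 T ×ˢ univ) f' g' (0, e i) := by
  refine WD.of_torus hf hg pf pg fun ψ hψ => ?_
  refine (integral_congr_ae (ef.mono fun z hz => ?_)).trans
    ((h.2 ψ hψ).trans (congrArg Neg.neg (integral_congr_ae (eg.mono fun z hz => ?_))))
  · simp only [hz, fderiv_uncurry_eq_dx hψ i z]
  · simp only [hz]

theorem IsWeakDt.wd {f g : ℝ → E d → ℝ} (h : IsWeakDt T f g)
    {f' g' : ℝ × E d → ℝ} (hf : BddMeas f') (hg : BddMeas g') (pf : SpacePeriodic f')
    (pg : SpacePeriodic g') (ef : ∀ᵐ z ∂(volume.restrict (Q d T)), f z.1 z.2 = f' z)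
    (eg : ∀ᵐ z ∂(volume.restrict (Q d T)), g z.1 z.2 = g' z) :
    WD (Ioo 0 T ×ˢ univ) f' g' (1, 0) := by
  refine WD.of_torus hf hg pf pg fun ψ hψ => ?_
  refine (integral_congr_ae (ef.mono fun z hz => ?_)).trans
    ((h.2 ψ hψ).trans (congrArg Neg.neg (integral_congr_ae (eg.mono fun z hz => ?_))))
  · simp only [hz, fderiv_uncurry_eq_dt hψ z]
  · simp only [hz]

theorem clampTime_ae_eq {V : Type*} (f : ℝ → E d → V) :
    ∀ᵐ z ∂(volume.restrict (Q d T)), f z.1 z.2 = clampTime T f z := by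
  filter_upwards [ae_restrict_mem (measurableSet_Q T)] with z hz
  exact (clampTime_eq f (Ioo_subset_Icc_self hz.1)).symm

/-- Composition of a smooth constitutive function with a field valued in `K`. -/
theorem PhaseDomain.bddMeas_comp (h : PhaseDomain F Ω K) {L : ℝ × E d → ℝ}
    (hL : ContDiffOn ℝ ∞ L Ω) {Z : ℝ × E d → ℝ × E d} (hZ : Continuous Z) (hZK : ∀ z, Z z ∈ K) :
    BddMeas fun z => L (Z z) := by
  obtain ⟨C, hC⟩ := h.compact.exists_bound_of_continuousOn (hL.continuousOn.mono h.sub)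
  exact ⟨(hL.continuousOn.comp_continuous hZ fun z => h.sub (hZK z)).stronglyMeasurable, C,
    fun z => hC _ (hZK z)⟩

theorem PhaseDomain.bddMeas_comp_deriv (h : PhaseDomain F Ω K) {L : ℝ × E d → ℝ}
    (hL : ContDiffOn ℝ ∞ L Ω) {Z Z' : ℝ × E d → ℝ × E d} (hZ : Continuous Z) (hZK : ∀ z, Z z ∈ K)
    (hZ' : BddMeas Z') : BddMeas fun z => fderivWithin ℝ L Ω (Z z) (Z' z) := by
  have hc : ContinuousOn (fderivWithin ℝ L Ω) Ω := hL.continuousOn_fderivWithin h.unique (by simp)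
  obtain ⟨C, hC⟩ := h.compact.exists_bound_of_continuousOn (hc.mono h.sub)
  obtain ⟨B, hB⟩ := hZ'.bdd
  refine ⟨?_, C * B, fun z => ?_⟩
  · exact (isBoundedBilinearMap_apply (𝕜 := ℝ) (E := ℝ × E d) (F := ℝ)).continuous.comp_stronglyMeasurable
      (((hc.comp_continuous hZ fun z => h.sub (hZK z)).stronglyMeasurable).prodMk hZ'.meas)
  · refine (ContinuousLinearMap.le_opNorm _ _).trans ?_
    exact mul_le_mul (hC _ (hZK z)) (hB z) (norm_nonneg _) ((norm_nonneg _).trans (hC _ (hZK z)))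

theorem PhaseDomain.wd_comp (h : PhaseDomain F Ω K) {L : ℝ × E d → ℝ}
    (hL : ContDiffOn ℝ ∞ L Ω) {Z Z' : ℝ × E d → ℝ × E d} (hZ : BddMeas Z)
    (hZK : ∀ z, Z z ∈ K) (hZ' : BddMeas Z') {v : ℝ × E d} (hw : WD (Ioo 0 T ×ˢ univ) Z Z' v) :
    WD (Ioo 0 T ×ˢ univ) (fun z => L (Z z)) (fun z => fderivWithin ℝ L Ω (Z z) (Z' z)) v :=
  WD.comp (isOpen_Ioo.prod isOpen_univ) h.unique (hL.of_le (by simp)) h.convex h.compact h.sub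
    (fun z _ => hZK z) hZ hZ' hw

end Vector

/-! ### Representatives of the strong solution and the transport law for the density and its
gradient. -/

section Strong

variable {d : ℕ}

/-- Bounded, everywhere defined, periodic representatives of a density, a velocity and their weak
derivatives, subject to the continuity equation. -/
structure StrongRep (d : ℕ) (T : ℝ) (K : Set (ℝ × E d)) where
  ρ : ℝ × E d → ℝ
  q : Fin d → ℝ × E d → ℝ
  u : Fin d → ℝ × E d → ℝ
  ut : Fin d → ℝ × E d → ℝ
  G : Fin d → ℝ × E d → ℝ
  Du : Fin d → Fin d → ℝ × E d → ℝ
  A : Fin d → Fin d → ℝ × E d → ℝ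
  bρ : BddMeas ρ
  bq : ∀ i, BddMeas (q i)
  bu : ∀ i, BddMeas (u i)
  but : ∀ i, BddMeas (ut i)
  bG : ∀ i, BddMeas (G i)
  bDu : ∀ i j, BddMeas (Du i j)
  bA : ∀ i j, BddMeas (A i j)
  pρ : SpacePeriodic ρ
  pq : ∀ i, SpacePeriodic (q i)
  pu : ∀ i, SpacePeriodic (u i)
  pDu : ∀ i j, SpacePeriodic (Du i j)
  pA : ∀ i j, SpacePeriodic (A i j)
  pG : ∀ i, SpacePeriodic (G i)
  cρ : Continuous ρ
  cq : ∀ i, Continuous (q i)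
  cu : ∀ i, Continuous (u i)
  mem : ∀ z, (ρ z, (WithLp.toLp 2 fun i => q i z : E d)) ∈ K
  wρ : ∀ i, WD (Ioo 0 T ×ˢ univ) ρ (q i) (0, e i)
  wq : ∀ i j, WD (Ioo 0 T ×ˢ univ) (q i) (A i j) (0, e j)
  wu : ∀ i j, WD (Ioo 0 T ×ˢ univ) (u i) (Du i j) (0, e j)
  wut : ∀ i, WD (Ioo 0 T ×ˢ univ) (u i) (ut i) (1, 0)
  wdiv : ∀ k, WD (Ioo 0 T ×ˢ univ) (fun z => ∑ i, Du i i z) (G k) (0, e k)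
  wρt : WD (Ioo 0 T ×ˢ univ) ρ (fun z => 0 - ((∑ j, q j z * u j z) + ρ z * ∑ i, Du i i z)) (1, 0)
  torus : ∀ j, ∀ φ : ℝ → E d → ℝ, IsTest (Ioo 0 T) φ →
      ∫ z in Q d T, u j z * dx j φ z.1 z.2 = - ∫ z in Q d T, Du j j z * φ z.1 z.2

namespace StrongRep

variable {T : ℝ} {F : ℝ × E d → ℝ} {Ω K : Set (ℝ × E d)} (R : StrongRep d T K)

/-- The field `(ρ, ∇ρ)`. -/
noncomputable def Z (z : ℝ × E d) : ℝ × E d := (R.ρ z, WithLp.toLp 2 fun i => R.q i z)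

/-- `div (ρ u)`. -/
noncomputable def flux (z : ℝ × E d) : ℝ := (∑ j, R.q j z * R.u j z) + R.ρ z * ∑ i, R.Du i i z

/-- `∂_i div (ρ u)`. -/
noncomputable def fluxx (i : Fin d) (z : ℝ × E d) : ℝ :=
  (∑ j, (R.A j i z * R.u j z + R.q j z * R.Du j i z))
    + (R.q i z * (∑ k, R.Du k k z) + R.ρ z * R.G i z)

/-- `∂_t (ρ, ∇ρ)`. -/
noncomputable def Zt (z : ℝ × E d) : ℝ × E d :=
  (0 - R.flux z, WithLp.toLp 2 fun i => 0 - R.fluxx i z)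

/-- `∂_j (ρ, ∇ρ)`. -/
noncomputable def Zx (j : Fin d) (z : ℝ × E d) : ℝ × E d :=
  (R.q j z, WithLp.toLp 2 fun i => R.A i j z)

theorem Z_mem (z : ℝ × E d) : R.Z z ∈ K := R.mem z

theorem Z_bdd : BddMeas R.Z := R.bρ.prodMk (BddMeas.euclidean R.bq)

theorem Z_cont : Continuous R.Z :=
  R.cρ.prodMk ((PiLp.continuous_toLp 2 _).comp (continuous_pi R.cq))

theorem div_bdd : BddMeas fun z => ∑ i, R.Du i i z := BddMeas.sum fun i => R.bDu i i

theorem flux_bdd : BddMeas R.flux :=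
  (BddMeas.sum fun j => (R.bq j).mul (R.bu j)).add (R.bρ.mul R.div_bdd)

theorem fluxx_bdd (i : Fin d) : BddMeas (R.fluxx i) :=
  (BddMeas.sum fun j => ((R.bA j i).mul (R.bu j)).add ((R.bq j).mul (R.bDu j i))).add
    (((R.bq i).mul R.div_bdd).add (R.bρ.mul (R.bG i)))

theorem Zt_bdd : BddMeas R.Zt :=
  ((BddMeas.const 0).sub R.flux_bdd).prodMk
    (BddMeas.euclidean fun i => (BddMeas.const 0).sub (R.fluxx_bdd i))

theorem Zx_bdd (j : Fin d) : BddMeas (R.Zx j) :=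
  (R.bq j).prodMk (BddMeas.euclidean fun i => R.bA i j)

theorem Z_per : SpacePeriodic R.Z := fun z i => by
  simp only [Z, R.pρ z i, R.pq _ z i]

theorem Zx_per (j : Fin d) : SpacePeriodic (R.Zx j) := fun z i => by
  simp only [Zx, R.pq _ z i, R.pA _ _ z i]

theorem Zt_per : SpacePeriodic R.Zt := fun z i => by
  simp only [Zt, flux, fluxx, R.pρ z i, R.pq _ z i, R.pA _ _ z i, R.pu _ z i, R.pDu _ _ z i,
    R.pG _ z i]

/-- The product rule, with `G` supplying the gradient of the divergence of the velocity. The form `0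
- …` keeps the sign of $\rho_t$ and lets `WD.sub` do all the work. -/
theorem flux_wd (i : Fin d) :
    WD (Ioo 0 T ×ˢ univ) (fun z => 0 - R.flux z) (fun z => 0 - R.fluxx i z) (0, e i) := by
  have ho : IsOpen ((Ioo 0 T) ×ˢ (univ : Set (E d))) := isOpen_Ioo.prod isOpen_univ
  have w0 : WD (Ioo 0 T ×ˢ univ) (fun _ : ℝ × E d => (0 : ℝ)) (fun _ => 0) (0, e i) :=
    fun φ _ _ _ => by simp
  have h1 := WD.sum Finset.univ (fun j => (R.bq j).mul (R.bu j))
    (fun j => ((R.bA j i).mul (R.bu j)).add ((R.bq j).mul (R.bDu j i)))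
    fun j => WD.mul ho (R.bq j) (R.bu j) (R.bA j i) (R.bDu j i) (R.wq j i) (R.wu j i)
  have h2 := WD.mul ho R.bρ R.div_bdd (R.bq i) (R.bG i) (R.wρ i) (R.wdiv i)
  have b1 := BddMeas.sum fun j => (R.bq j).mul (R.bu j)
  have b2 := R.bρ.mul R.div_bdd
  have c1 := BddMeas.sum fun j => ((R.bA j i).mul (R.bu j)).add ((R.bq j).mul (R.bDu j i))
  have c2 := ((R.bq i).mul R.div_bdd).add (R.bρ.mul (R.bG i))
  have z0 := BddMeas.const (d := d) 0
  have h3 := WD.sub (z0.sub b1) b2 (z0.sub c1) c2 (WD.sub z0 b1 z0 c1 w0 h1) h2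
  refine h3.congr (Eventually.of_forall fun z _ => ?_) (Eventually.of_forall fun z _ => ?_)
  · simp only [flux]; ring
  · simp only [fluxx]; ring

/-- The time derivative of $\nabla\rho$ is found by exchanging derivatives: it is the gradient of
$\rho_t=-\operatorname{div}(\rho u)$. -/
theorem Z_wd_t : WD (Ioo 0 T ×ˢ univ) R.Z R.Zt (1, 0) := by
  refine WD.prodMk R.bρ ((BddMeas.const 0).sub R.flux_bdd) (BddMeas.euclidean R.bq)
    (BddMeas.euclidean fun i => (BddMeas.const 0).sub (R.fluxx_bdd i)) R.wρt ?_
  exact WD.euclidean R.bq (fun i => (BddMeas.const 0).sub (R.fluxx_bdd i)) fun i =>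
    WD.swap R.wρt (R.wρ i) (R.flux_wd i)

theorem Z_wd_x (j : Fin d) : WD (Ioo 0 T ×ˢ univ) R.Z (R.Zx j) (0, e j) :=
  WD.prodMk R.bρ (R.bq j) (BddMeas.euclidean R.bq) (BddMeas.euclidean fun i => R.bA i j) (R.wρ j)
    (WD.euclidean R.bq (fun i => R.bA i j) fun i => R.wq i j)

/-- Exchanging derivatives of $\rho$ makes both entries weak derivatives of the same function, and
these are unique. -/
theorem A_symm (i j : Fin d) : ∀ᵐ z, z ∈ Ioo 0 T ×ˢ (univ : Set (E d)) → R.A i j z = R.A j i z :=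
  WD.unique (isOpen_Ioo.prod isOpen_univ) (R.bq j) (R.bA i j) (R.bA j i)
    (WD.swap (R.wρ i) (R.wρ j) (R.wq i j)) (R.wq j i)

theorem comp_timeSpaceWD (h : PhaseDomain F Ω K) {L : ℝ × E d → ℝ} (hL : ContDiffOn ℝ ∞ L Ω) :
    TimeSpaceWD T (fun z => L (R.Z z)) (fun z => fderivWithin ℝ L Ω (R.Z z) (R.Zt z))
      (fun j z => fderivWithin ℝ L Ω (R.Z z) (R.Zx j z)) where
  b := h.bddMeas_comp hL R.Z_cont R.Z_mem
  bt := h.bddMeas_comp_deriv hL R.Z_cont R.Z_mem R.Zt_bdd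
  bx j := h.bddMeas_comp_deriv hL R.Z_cont R.Z_mem (R.Zx_bdd j)
  per := fun z i => by simp only [R.Z_per z i]
  t := h.wd_comp hL R.Z_bdd R.Z_mem R.Zt_bdd R.Z_wd_t
  x j := h.wd_comp hL R.Z_bdd R.Z_mem (R.Zx_bdd j) (R.Z_wd_x j)

theorem u_timeSpaceWD (i : Fin d) : TimeSpaceWD T (R.u i) (R.ut i) (R.Du i) :=
  ⟨R.bu i, R.but i, R.bDu i, R.pu i, R.wut i, R.wu i⟩

/-- The chain rule identity expressing transport of `(ρ, ∇ρ)`. -/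
theorem transport : ∀ᵐ z, z ∈ Ioo 0 T ×ˢ (univ : Set (E d)) →
    R.Zt z + (∑ i, R.Du i i z) • R.Z z + (∑ i, ∑ j, (R.Du i j z * R.q i z) • ev j)
      + (∑ k, (R.ρ z * R.G k z) • ev k) + ∑ j, R.u j z • R.Zx j z = 0 := by
  filter_upwards [eventually_all.2 fun i => eventually_all.2 fun j => R.A_symm i j] with z hz hzO
  refine Prod.ext ?_ ?_
  · simp only [Zt, Z, Zx, flux, Prod.fst_add, Prod.fst_sum, Prod.smul_fst, smul_eq_mul, mul_zero,
      Finset.sum_const_zero, Prod.fst_zero, mul_comm (R.u _ z)]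
    ring
  · ext l
    simp only [Zt, Z, Zx, fluxx, Prod.snd_add, Prod.snd_sum, Prod.smul_snd, PiLp.add_apply,
      WithLp.ofLp_sum, Finset.sum_apply, PiLp.smul_apply, smul_eq_mul, Prod.snd_zero,
      PiLp.zero_apply, PiLp.single_apply, mul_ite, mul_one, mul_zero,
      Finset.sum_ite_eq, Finset.mem_univ, if_true]
    simp only [Finset.sum_add_distrib]
    -- Symmetry of the Hessian of the density: transport gives $\partial_jq_l$, the differentiated
    -- flux gives $\partial_lq_j$.
    have e2 : ∑ j, R.u j z * R.A l j z = ∑ j, R.A j l z * R.u j z :=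
      Finset.sum_congr rfl fun j _ => by rw [hz l j hzO]; ring
    have e3 : ∑ j, R.Du j l z * R.q j z = ∑ j, R.q j z * R.Du j l z :=
      Finset.sum_congr rfl fun j _ => by ring
    rw [e2, e3]
    ring

end StrongRep

/-- The continuous fields are extended by freezing time outside `[0,T]`, the weak derivatives by
`exists_bddMeas_periodic`. The pressure gradient `P` is kept as a single field, since only
$F_\rho-\operatorname{div}F_q$ as a whole is assumed to have a gradient. -/
theorem exists_strongRep {T : ℝ} (hT : 0 < T) {F : ℝ × E d → ℝ} {Ω K : Set (ℝ × E d)}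
    (h : PhaseDomain F Ω K)
    {ρb : ℝ → E d → ℝ} {qb ub : ℝ → E d → E d}
    {Dub : ℝ → E d → Matrix (Fin d) (Fin d) ℝ} {Gb : ℝ → E d → E d}
    (hs : IsStrongSolution F T ρb qb ub Dub Gb)
    (hK : ∀ t ∈ Icc 0 T, ∀ x, (ρb t x, qb t x) ∈ K) :
    ∃ R : StrongRep d T K, R.ρ = clampTime T ρb ∧ (∀ i, R.q i = fun z => clampTime T qb z i) ∧
      (∀ i, R.u i = fun z => clampTime T ub z i) ∧
      (∀ i j, ∀ᵐ z ∂(volume.restrict (Q d T)), Dub z.1 z.2 i j = R.Du i j z) ∧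
      (∀ k, ∀ᵐ z ∂(volume.restrict (Q d T)), Gb z.1 z.2 k = R.G k z) ∧
      ∃ P : Fin d → ℝ × E d → ℝ, (∀ i, BddMeas (P i)) ∧
        (∀ i, WD (Ioo 0 T ×ˢ univ) (fun z => Fρ F (R.Z z)
          - ∑ k, fderivWithin ℝ (Fq F k) Ω (R.Z z) (R.Zx k z)) (P i) (0, e i)) ∧
        ∀ᵐ z ∂(volume.restrict (Q d T)), ∀ i,
          R.ut i z + (∑ j, R.u j z * R.Du i j z) = - P i z := by
  obtain ⟨A₀, -, hA₀, -⟩ := hs.third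
  obtain ⟨ρt, hρt, hcont⟩ := hs.continuity
  obtain ⟨ut₀, D₀, P₀, hut₀, hD₀, hP₀, hmom⟩ := hs.momentum
  choose A bA pA eA using fun i j => exists_bddMeas_periodic (hA₀ i j).1
  choose Du bDu pDu eDu using fun i j => exists_bddMeas_periodic (hs.grad_u i j).1
  choose G bG pG eG using fun k => exists_bddMeas_periodic (hs.grad_div_u k).1
  choose ut but put eut using fun i => exists_bddMeas_periodic (hut₀ i).1
  choose D bD pD eD using fun k => exists_bddMeas_periodic (hD₀ k).1
  choose P bP pP eP using fun i => exists_bddMeas_periodic (hP₀ i).1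
  have co : ∀ {f : ℝ → E d → E d},
      ContinuousOn (fun z : ℝ × E d => f z.1 z.2) (Icc 0 T ×ˢ univ) → ∀ i : Fin d,
      ContinuousOn (fun z : ℝ × E d => f z.1 z.2 i) (Icc 0 T ×ˢ univ) := fun hf i =>
    (EuclideanSpace.proj i : E d →L[ℝ] ℝ).continuous.comp_continuousOn hf
  have pco : ∀ {f : ℝ → E d → E d}, Periodic f → ∀ i : Fin d, Periodic fun t x => f t x i :=
    fun hf i t x k => by simp only [hf t x k]
  have bρ := clampTime_bddMeas hT.le hs.periodic_ρ hs.cont_ρ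
  have bq : ∀ i, BddMeas (clampTime T fun t x => qb t x i) := fun i =>
    clampTime_bddMeas hT.le (pco hs.periodic_q i) (co hs.cont_q i)
  have bu : ∀ i, BddMeas (clampTime T fun t x => ub t x i) := fun i =>
    clampTime_bddMeas hT.le (pco hs.periodic_u i) (co hs.cont_u i)
  have pρ : SpacePeriodic (clampTime T ρb) := clampTime_periodic hs.periodic_ρ
  have pq : ∀ i, SpacePeriodic (clampTime T fun t x => qb t x i) := fun i =>
    clampTime_periodic (pco hs.periodic_q i)
  have pu : ∀ i, SpacePeriodic (clampTime T fun t x => ub t x i) := fun i =>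
    clampTime_periodic (pco hs.periodic_u i)
  have bdiv : BddMeas fun z => ∑ i, Du i i z := BddMeas.sum fun i => bDu i i
  have pdiv : SpacePeriodic fun z => ∑ i, Du i i z := fun z k => by simp only [pDu _ _ z k]
  have bflux := (BddMeas.const (d := d) 0).sub ((BddMeas.sum fun j => (bq j).mul (bu j)).add
    (bρ.mul bdiv))
  let R : StrongRep d T K :=
    { ρ := clampTime T ρb
      q := fun i => clampTime T fun t x => qb t x i
      u := fun i => clampTime T fun t x => ub t x i
      ut := ut
      G := G
      Du := Du
      A := A
      bρ := bρ
      bq := bq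
      bu := bu
      but := but
      bG := bG
      bDu := bDu
      bA := bA
      pρ := pρ
      pq := pq
      pu := pu
      pDu := pDu
      pA := pA
      pG := pG
      cρ := clampTime_continuous hT.le hs.cont_ρ
      cq := fun i => clampTime_continuous hT.le (co hs.cont_q i)
      cu := fun i => clampTime_continuous hT.le (co hs.cont_u i)
      mem := fun z => hK _ (clamp_mem hT.le z.1) z.2
      wρ := fun i => (hs.grad_ρ i).wd bρ (bq i) pρ (pq i) (clampTime_ae_eq _)
        (clampTime_ae_eq fun t x => qb t x i)
      wq := fun i j => (hA₀ i j).wd (bq i) (bA i j) (pq i) (pA i j)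
        (clampTime_ae_eq fun t x => qb t x i) (eA i j)
      wu := fun i j => (hs.grad_u i j).wd (bu i) (bDu i j) (pu i) (pDu i j)
        (clampTime_ae_eq fun t x => ub t x i) (eDu i j)
      wut := fun i => (hut₀ i).wd (bu i) (but i) (pu i) (put i)
        (clampTime_ae_eq fun t x => ub t x i) (eut i)
      wdiv := fun k => (hs.grad_div_u k).wd bdiv (bG k) pdiv (pG k)
        (by
          filter_upwards [eventually_all.2 fun i => eDu i i] with z hz
          exact Finset.sum_congr rfl fun i _ => hz i) (eG k)
      wρt := by
        refine hρt.wd bρ bflux pρ (fun z k => ?_) (clampTime_ae_eq _) ?_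
        · simp only [pDu _ _ z k, pu _ z k, pq _ z k, pρ z k]
        · filter_upwards [hcont, eventually_all.2 fun i => eDu i i,
            ae_restrict_mem (measurableSet_Q T)] with z hz h1 h2
          have h3 := Ioo_subset_Icc_self h2.1
          simp only [clampTime_eq _ h3, ← h1, Finset.mul_sum, ← Finset.sum_add_distrib]
          linarith
      torus := fun j φ hφ => by
        refine (integral_congr_ae ?_).trans
          (((hs.grad_u j j).2 φ hφ).trans (congrArg Neg.neg (integral_congr_ae ?_)))
        · filter_upwards [clampTime_ae_eq (T := T) fun t x => ub t x j] with z hz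
          rw [← hz]
        · filter_upwards [eDu j j] with z hz
          rw [hz] }
  refine ⟨R, rfl, fun i => rfl, fun i => rfl, eDu, eG, P, bP, ?_, ?_⟩
  · have hVk : ∀ k, TimeSpaceWD T (fun z => Fq F k (R.Z z)) _ _ := fun k =>
      R.comp_timeSpaceWD h (h.contDiffOn_Fq k)
    have hZ : ∀ z ∈ Q d T, R.Z z = (ρb z.1 z.2, qb z.1 z.2) := fun z hz => by
      have h3 := Ioo_subset_Icc_self hz.1
      refine Prod.ext (clampTime_eq _ h3) ?_
      ext i
      exact clampTime_eq (fun t x => qb t x i) h3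
    have wD : ∀ k, WD (Ioo 0 T ×ˢ univ) (fun z => Fq F k (R.Z z)) (D k) (0, e k) := fun k => by
      refine (hD₀ k).wd (hVk k).b (bD k) (hVk k).per (pD k) ?_ (eD k)
      filter_upwards [ae_restrict_mem (measurableSet_Q T)] with z hz
      rw [hZ z hz]
    -- The derivatives of $F_{q_k}$ given in the momentum equation agree with those from the chain
    -- rule, by uniqueness of weak derivatives.
    have huniq : ∀ k, ∀ᵐ z, z ∈ Ioo 0 T ×ˢ (univ : Set (E d)) →
        D k z = fderivWithin ℝ (Fq F k) Ω (R.Z z) (R.Zx k z) := fun k =>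
      WD.unique (isOpen_Ioo.prod isOpen_univ) (hVk k).b (bD k) ((hVk k).bx k) (wD k) ((hVk k).x k)
    have ha := R.comp_timeSpaceWD h h.contDiffOn_Fρ
    intro i
    refine (hP₀ i).wd (ha.b.sub (BddMeas.sum fun k => (hVk k).bx k)) (bP i) ?_ (pP i) ?_ (eP i)
    · intro z l
      simp only [R.Z_per z l, R.Zx_per _ z l]
    · filter_upwards [eventually_all.2 eD, ae_restrict_of_ae (eventually_all.2 huniq),
        ae_restrict_mem (measurableSet_Q T)] with z h1 h2 h3
      rw [hZ z h3]
      congr 1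
      refine Finset.sum_congr rfl fun k _ => ?_
      rw [h1 k, h2 k ⟨h3.1, trivial⟩, hZ z h3]
  · filter_upwards [hmom, eventually_all.2 eut, eventually_all.2 eP,
      eventually_all.2 fun i => eventually_all.2 (eDu i), ae_restrict_mem (measurableSet_Q T)]
      with z hz h1 h2 h3 h4 i
    have h5 := hz i
    rw [h1, h2] at h5
    simp only [h3] at h5
    rw [← h5]
    congr 1
    refine Finset.sum_congr rfl fun j _ => ?_
    show clampTime T (fun t x => ub t x j) z * Du i j z = _
    rw [clampTime_eq _ (Ioo_subset_Icc_self h4.1)]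

end Strong

/-! ### Pointwise algebra of the relative quantities. -/

section Algebra

variable {d : ℕ} {F : ℝ × E d → ℝ} {Ω K : Set (ℝ × E d)}

theorem PhaseDomain.rel_s (h : PhaseDomain F Ω K) {zb : ℝ × E d} (hz : zb ∈ Ω) (z : ℝ × E d) :
    rel (s F) z zb = s F z - s F zb - hess F Ω zb (z - zb) zb := by
  rw [rel, h.fderiv_eq _ _ hz, h.fderivWithin_s hz]

/-- The first-order part of the derivative of `r` combines with the base value, leaving a term
linear in the density `z.1` and a pure Hessian term, which is what the transport law can match. The
same happens for `H`. -/
theorem PhaseDomain.rel_r (h : PhaseDomain F Ω K) (k : Fin d) {zb : ℝ × E d} (hz : zb ∈ Ω)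
    (z : ℝ × E d) :
    rel (r F k) z zb = r F k z - z.1 * Fq F k zb - zb.1 * hess F Ω zb (z - zb) (ev k) := by
  rw [rel, h.fderiv_eq _ _ hz, h.fderivWithin_r k hz, r, r]
  simp only [Prod.fst_sub]
  ring

theorem PhaseDomain.rel_H (h : PhaseDomain F Ω K) (i j : Fin d) {zb : ℝ × E d} (hz : zb ∈ Ω)
    (z : ℝ × E d) :
    rel (H F i j) z zb
      = H F i j z - z.2 i * Fq F j zb - zb.2 i * hess F Ω zb (z - zb) (ev j) := by
  rw [rel, h.fderiv_eq _ _ hz, h.fderivWithin_H i j hz, H, H]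
  simp only [Prod.snd_sub, PiLp.sub_apply]
  ring

theorem PhaseDomain.rel_self (h : PhaseDomain F Ω K) {zb : ℝ × E d} (hz : zb ∈ Ω) (z : ℝ × E d) :
    rel F z zb = F z + s F zb - (z.1 * Fρ F zb + ∑ k, z.2 k * Fq F k zb) := by
  rw [rel, h.fderiv_eq _ _ hz, map_sub, h.s_eq hz, h.fderivWithin_apply_eq hz z]
  ring

theorem clm_apply_eq (L : ℝ × E d →L[ℝ] ℝ) (z : ℝ × E d) :
    L z = z.1 * L (1, 0) + ∑ k, z.2 k * L (ev k) := by
  conv_lhs => rw [phase_vector_eq z]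
  rw [map_add, map_sum, map_smul]
  simp only [map_smul, smul_eq_mul]

/-- In the vacuum both sides are zero under the convention `x / 0 = 0`. -/
theorem mul_div_sub_mul_div_sub {ρ a b u v : ℝ} (ha : ρ = 0 → a = 0) (hb : ρ = 0 → b = 0) :
    ρ * (a / ρ - u) * (b / ρ - v) = a * b / ρ - (a * v + u * b) + ρ * u * v := by
  by_cases h : ρ = 0
  · simp [h, ha h, hb h]
  · field_simp
    ring

/-- The pointwise identity behind the relative energy identity. -/
theorem PhaseDomain.relative_flux (h : PhaseDomain F Ω K) {zb : ℝ × E d} (hz : zb ∈ Ω)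
    (z : ℝ × E d) {m u ut G P : Fin d → ℝ} {Du : Fin d → Fin d → ℝ} {Zt : ℝ × E d}
    {Zx : Fin d → ℝ × E d} (hm : z.1 = 0 → ∀ i, m i = 0)
    (hP : ∀ i, ut i + ∑ j, u j * Du i j = - P i)
    (hT : Zt + (∑ i, Du i i) • zb + (∑ i, ∑ j, (Du i j * zb.2 i) • ev j)
      + (∑ k, (zb.1 * G k) • ev k) + ∑ j, u j • Zx j = 0) :
    (((∑ i, m i * ut i) + ∑ i, ∑ j, m i * m j / z.1 * Du i j)
      + (s F z * (∑ i, Du i i) + ((∑ k, r F k z * G k) + ∑ i, ∑ j, H F i j z * Du i j)))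
      - (z.1 * (∑ i, u i * ut i) + ∑ j, m j * ∑ i, u i * Du i j)
      - hess F Ω zb Zt zb
      + (z.1 * hess F Ω zb Zt (1, 0) + (∑ k, z.2 k * hess F Ω zb Zt (ev k)) + ∑ i, m i * P i)
      = (((∑ i, ∑ j, z.1 * (m i / z.1 - u i) * (m j / z.1 - u j) * Du i j)
          + (∑ i, Du i i) * rel (s F) z zb)
        + ((∑ i, ∑ j, Du i j * rel (H F i j) z zb) + ∑ k, G k * rel (r F k) z zb))
        + ((∑ j, u j * hess F Ω zb (Zx j) zb) + (∑ i, Du i i) * s F zb)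
        - (z.1 * (∑ j, (u j * (hess F Ω zb (Zx j) (1, 0) - P j) - Fq F j zb * G j))
          + ∑ i, z.2 i * ∑ j, (u j * hess F Ω zb (Zx j) (ev i) - Fq F j zb * Du i j)) := by
  set B := hess F Ω zb with hB
  set w := z - zb with hw
  have sym := h.hess_symm hz
  -- transport, tested with `B w`
  have hT' := congrArg (B w) hT
  simp only [map_add, map_sum, map_smul, smul_eq_mul, map_zero] at hT'
  have e1 : B Zt z = z.1 * B Zt (1, 0) + ∑ k, z.2 k * B Zt (ev k) := clm_apply_eq (B Zt) z
  have e2 : B w Zt = B Zt z - B Zt zb := by rw [sym, hw, map_sub]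
  have e3 : ∀ j, B (Zx j) z = z.1 * B (Zx j) (1, 0) + ∑ k, z.2 k * B (Zx j) (ev k) :=
    fun j => clm_apply_eq (B (Zx j)) z
  have e4 : ∀ j, B w (Zx j) = B (Zx j) z - B (Zx j) zb := fun j => by rw [sym, hw, map_sub]
  have e5 : ∑ j, u j * B w (Zx j) = z.1 * (∑ j, u j * B (Zx j) (1, 0))
      + (∑ i, ∑ j, z.2 i * (u j * B (Zx j) (ev i))) - ∑ j, u j * B (Zx j) zb := by
    rw [Finset.sum_comm, Finset.mul_sum, ← Finset.sum_add_distrib, ← Finset.sum_sub_distrib]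
    refine Finset.sum_congr rfl fun j _ => ?_
    rw [e4, e3, mul_sub, mul_add, Finset.mul_sum]
    congr 2
    · ring
    · exact Finset.sum_congr rfl fun i _ => by ring
  have eq1 : (∑ i, ∑ j, z.1 * (m i / z.1 - u i) * (m j / z.1 - u j) * Du i j)
      = (∑ i, ∑ j, m i * m j / z.1 * Du i j) - (∑ i, m i * ∑ j, u j * Du i j)
        - (∑ j, m j * ∑ i, u i * Du i j) + z.1 * ∑ i, u i * ∑ j, u j * Du i j := by
    simp only [Finset.mul_sum]
    rw [Finset.sum_comm (f := fun j i => m j * (u i * Du i j))]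
    simp only [← Finset.sum_sub_distrib, ← Finset.sum_add_distrib]
    refine Finset.sum_congr rfl fun i _ => Finset.sum_congr rfl fun j _ => ?_
    rw [mul_div_sub_mul_div_sub (fun h0 => hm h0 i) (fun h0 => hm h0 j)]
    ring
  have eq2 : (∑ i, ∑ j, Du i j * rel (H F i j) z zb) = (∑ i, ∑ j, H F i j z * Du i j)
      - (∑ i, ∑ j, z.2 i * (Fq F j zb * Du i j)) - ∑ i, ∑ j, Du i j * zb.2 i * B w (ev j) := by
    simp only [← Finset.sum_sub_distrib]
    refine Finset.sum_congr rfl fun i _ => Finset.sum_congr rfl fun j _ => ?_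
    rw [h.rel_H i j hz]
    ring
  have eq3 : (∑ k, G k * rel (r F k) z zb) = (∑ k, r F k z * G k)
      - z.1 * (∑ k, Fq F k zb * G k) - ∑ k, zb.1 * G k * B w (ev k) := by
    rw [Finset.mul_sum]
    simp only [← Finset.sum_sub_distrib]
    refine Finset.sum_congr rfl fun k _ => ?_
    rw [h.rel_r k hz]
    ring
  have eq4 : ∀ v : Fin d → ℝ, (∑ i, v i * ut i) + (∑ i, v i * ∑ j, u j * Du i j)
      + ∑ i, v i * P i = 0 := fun v => by
    simp only [← Finset.sum_add_distrib]
    refine Finset.sum_eq_zero fun i _ => ?_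
    linear_combination v i * hP i
  have eq5 : (∑ j, (u j * (B (Zx j) (1, 0) - P j) - Fq F j zb * G j))
      = (∑ j, u j * B (Zx j) (1, 0)) - (∑ j, u j * P j) - ∑ j, Fq F j zb * G j := by
    simp only [← Finset.sum_sub_distrib]
    exact Finset.sum_congr rfl fun j _ => by ring
  have eq6 : (∑ i, z.2 i * ∑ j, (u j * B (Zx j) (ev i) - Fq F j zb * Du i j))
      = (∑ i, ∑ j, z.2 i * (u j * B (Zx j) (ev i)))
        - ∑ i, ∑ j, z.2 i * (Fq F j zb * Du i j) := by
    simp only [← Finset.sum_sub_distrib, Finset.mul_sum, mul_sub]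
  rw [eq1, eq2, eq3, eq5, eq6, h.rel_s hz]
  -- The strong momentum equation enters dotted with $m-\rho u$, and the transport law paired with
  -- the Hessian applied to `w`; the remaining equations only expand these pairings in coordinates.
  linear_combination eq4 m - z.1 * eq4 u + hT' - e1 - e2 - e5

end Algebra

/-! ### The exact identity for the linear part of the relative energy. -/

section Identity

variable {d : ℕ} {T : ℝ} {F : ℝ × E d → ℝ} {Ω K : Set (ℝ × E d)}
  {ρ : ℝ → E d → ℝ} {q m : ℝ → E d → E d} {S : ℝ → E d → Matrix (Fin d) (Fin d) ℝ} {θ : ℝ → ℝ}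

theorem NullInt.const_mul {f : ℝ × E d → ℝ} (c : ℝ) (hf : NullInt T f) :
    NullInt T fun z => c * f z :=
  ⟨hf.1.const_mul c, by rw [integral_const_mul, hf.2, mul_zero]⟩

/-- The relative energy density minus the energy density, in terms of the representatives of the
strong solution. -/
noncomputable def StrongRep.linear (R : StrongRep d T K) (F : ℝ × E d → ℝ) (ρ : ℝ → E d → ℝ)
    (q m : ℝ → E d → E d) (z : ℝ × E d) : ℝ :=
  1 / 2 * (ρ z.1 z.2 * ∑ i, R.u i z * R.u i z) - (∑ i, m z.1 z.2 i * R.u i z) + s F (R.Z z)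
    - (ρ z.1 z.2 * Fρ F (R.Z z) + ∑ k, q z.1 z.2 k * Fq F k (R.Z z))

/-- The convective part of the relative flux, in terms of the representatives of the strong
solution. -/
noncomputable def StrongRep.relConv (R : StrongRep d T K) (F : ℝ × E d → ℝ) (ρ : ℝ → E d → ℝ)
    (q m : ℝ → E d → E d) (z : ℝ × E d) : ℝ :=
  (∑ i, ∑ j, ρ z.1 z.2 * (m z.1 z.2 i / ρ z.1 z.2 - R.u i z)
      * (m z.1 z.2 j / ρ z.1 z.2 - R.u j z) * R.Du i j z)
    + (∑ i, R.Du i i z) * rel (s F) (ρ z.1 z.2, q z.1 z.2) (R.Z z)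

/-- The capillary part of the relative flux, in terms of the representatives of the strong
solution. -/
noncomputable def StrongRep.relStress (R : StrongRep d T K) (F : ℝ × E d → ℝ) (ρ : ℝ → E d → ℝ)
    (q : ℝ → E d → E d) (z : ℝ × E d) : ℝ :=
  (∑ i, ∑ j, R.Du i j z * rel (H F i j) (ρ z.1 z.2, q z.1 z.2) (R.Z z))
    + ∑ k, R.G k z * rel (r F k) (ρ z.1 z.2, q z.1 z.2) (R.Z z)

/-- Distributionally in time, the integral of `linear` has derivative minus the integral of the
relative flux. This is an equality, obtained from the weak equations without the energy inequality.
-/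
theorem StrongRep.relative_identity (R : StrongRep d T K) (h : PhaseDomain F Ω K)
    (hw : IsWeakSolution F ρ q m S) (hi : WeakIntegrable T F ρ q m S) (hθ : TimeCutoff T θ)
    {P : Fin d → ℝ × E d → ℝ} (bP : ∀ i, BddMeas (P i))
    (wP : ∀ i, WD (Ioo 0 T ×ˢ univ) (fun z => Fρ F (R.Z z)
          - ∑ k, fderivWithin ℝ (Fq F k) Ω (R.Z z) (R.Zx k z)) (P i) (0, e i))
    (hP : ∀ᵐ z ∂(volume.restrict (Q d T)), ∀ i,
          R.ut i z + (∑ j, R.u j z * R.Du i j z) = - P i z) :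
    NullInt T fun z => θ z.1 * (R.relConv F ρ q m z + R.relStress F ρ q z)
      - deriv θ z.1 * R.linear F ρ q m z := by
  have ho : IsOpen ((Ioo 0 T) ×ˢ (univ : Set (E d))) := isOpen_Ioo.prod isOpen_univ
  have ha := R.comp_timeSpaceWD h h.contDiffOn_Fρ
  have hs := R.comp_timeSpaceWD h h.contDiffOn_s
  have hV := fun k => R.comp_timeSpaceWD h (h.contDiffOn_Fq k)
  have hVx : ∀ i j, BddMeas fun z => fderivWithin ℝ (Fq F i) Ω (R.Z z) (R.Zx j z) :=
    fun i j => (hV i).bx j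
  have pVx : ∀ i j, SpacePeriodic fun z => fderivWithin ℝ (Fq F i) Ω (R.Z z) (R.Zx j z) :=
    fun i j z l => by simp only [R.Z_per z l, R.Zx_per _ z l]
  have pVt : ∀ i, SpacePeriodic fun z => fderivWithin ℝ (Fq F i) Ω (R.Z z) (R.Zt z) :=
    fun i z l => by simp only [R.Z_per z l, R.Zt_per z l]
  have hdiv := BddMeas.sum fun k => hVx k k
  have bδ : ∀ i, BddMeas fun z => fderivWithin ℝ (Fρ F) Ω (R.Z z) (R.Zx i z) - P i z :=
    fun i => (ha.bx i).sub (bP i)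
  -- The gradient of $\operatorname{div}F_q$ is not given separately; it is that of $F_\rho$, known
  -- from the chain rule, minus `P`.
  have wδ : ∀ i, WD (Ioo 0 T ×ˢ univ)
      (fun z => ∑ k, fderivWithin ℝ (Fq F k) Ω (R.Z z) (R.Zx k z))
      (fun z => fderivWithin ℝ (Fρ F) Ω (R.Z z) (R.Zx i z) - P i z) (0, e i) := fun i =>
    (WD.sub ha.b (ha.b.sub hdiv) (ha.bx i) (bP i) (ha.x i) (wP i)).congr
      (Eventually.of_forall fun z _ => sub_sub_cancel _ _) (Eventually.of_forall fun z _ => rfl)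
  have hu2 : TimeSpaceWD T (fun z => ∑ i, R.u i z * R.u i z)
      (fun z => ∑ i, (R.ut i z * R.u i z + R.u i z * R.ut i z))
      (fun j z => ∑ i, (R.Du i j z * R.u i z + R.u i z * R.Du i j z)) :=
    { b := BddMeas.sum fun i => (R.bu i).mul (R.bu i)
      bt := BddMeas.sum fun i => ((R.but i).mul (R.bu i)).add ((R.bu i).mul (R.but i))
      bx := fun j => BddMeas.sum fun i =>
        ((R.bDu i j).mul (R.bu i)).add ((R.bu i).mul (R.bDu i j))
      per := fun z l => by simp only [R.pu _ z l]
      t := WD.sum _ (fun i => (R.bu i).mul (R.bu i))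
        (fun i => ((R.but i).mul (R.bu i)).add ((R.bu i).mul (R.but i)))
        fun i => WD.mul ho (R.bu i) (R.bu i) (R.but i) (R.but i) (R.wut i) (R.wut i)
      x := fun j => WD.sum _ (fun i => (R.bu i).mul (R.bu i))
        (fun i => ((R.bDu i j).mul (R.bu i)).add ((R.bu i).mul (R.bDu i j)))
        fun i => WD.mul ho (R.bu i) (R.bu i) (R.bDu i j) (R.bDu i j) (R.wu i j) (R.wu i j) }
  have L1 := (mass_identity hw hi hθ hu2).const_mul (1 / 2)
  have L2 := momentum_identity hw hi hθ R.u_timeSpaceWD R.pDu R.bG R.wdiv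
  have L3 := (mass_identity hw hi hθ ha).sub (mass_identity_div hw hi hθ (fun k => (hV k).b)
    (fun k => (hV k).bt) (fun k => hVx k k) bδ (fun k => (hV k).per) pVt (fun k => pVx k k)
    (fun k => (hV k).t) (fun k => (hV k).x k) wδ)
  have L4 := time_identity hθ hs.b hs.bt hs.t
  have L5 := NullInt.sum Finset.univ fun j => divergence_identity hθ (R.bu j) (R.bDu j j) hs.b
    (hs.bx j) hs.per (R.torus j) (hs.x j)
  have L6 := commutator_identity hw hi hθ R.bu R.bDu R.bG (fun i => (hV i).b) hVx bδ R.pu R.pDu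
    (fun i => (hV i).per) pVx R.wu (fun i j => (hV i).x j) R.wdiv wδ
  -- The coefficient of $\theta'$ in `L2 - L1 - L4 + L3` is $m\cdot u-\frac12\rho|u|^2-s+\rho
  -- F_\rho+q\cdot F_q$, which is minus `linear`. The identities `L5` and `L6` carry no $\theta'$
  -- and remove the divergences left over in `relative_flux`.
  refine ((((L2.sub L1).sub L4).add L3).sub (L5.sub L6)).congr ?_
  have hvac : ∀ᵐ z ∂(volume.restrict (Q d T)), ρ z.1 z.2 = 0 → m z.1 z.2 = 0 :=
    ae_restrict_of_ae_restrict_of_subset (prod_mono Ioo_subset_Ioi_self subset_rfl) hw.vacuum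
  filter_upwards [hvac, hP, ae_restrict_of_ae R.transport, ae_restrict_mem (measurableSet_Q T)]
    with z hv hPz hT hz
  have hΩ := h.sub (R.Z_mem z)
  have key := h.relative_flux hΩ (ρ z.1 z.2, q z.1 z.2) (m := fun i => m z.1 z.2 i)
    (fun h0 i => by rw [hv h0]; rfl) hPz (G := fun k => R.G k z) (hT ⟨hz.1, trivial⟩)
  simp only [h.fderivWithin_Fρ hΩ, h.fderivWithin_Fq _ hΩ, h.fderivWithin_s hΩ] at key ⊢
  have c1 : ∀ (v f g : Fin d → ℝ), ∑ i, v i * (deriv θ z.1 * f i + θ z.1 * g i)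
      = deriv θ z.1 * (∑ i, v i * f i) + θ z.1 * ∑ i, v i * g i := fun v f g => by
    simp only [Finset.mul_sum, ← Finset.sum_add_distrib]
    exact Finset.sum_congr rfl fun i _ => by ring
  have c2 : ∀ (v f : Fin d → ℝ), ∑ i, v i * (θ z.1 * f i) = θ z.1 * ∑ i, v i * f i :=
    fun v f => by
    simp only [Finset.mul_sum]
    exact Finset.sum_congr rfl fun i _ => by ring
  have c3 : ∀ (f g : Fin d → ℝ), ∑ i, (f i * g i + g i * f i) = 2 * ∑ i, g i * f i :=
    fun f g => by
    simp only [Finset.mul_sum]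
    exact Finset.sum_congr rfl fun i _ => by ring
  have c4 : ∀ (v w : Fin d → ℝ) (a : ℝ), ∑ i, (v i * (θ z.1 * w i) + R.Du i i z * (θ z.1 * a))
      = θ z.1 * ((∑ i, v i * w i) + (∑ i, R.Du i i z) * a) := fun v w a => by
    simp only [Finset.mul_sum, Finset.sum_mul, mul_add, ← Finset.sum_add_distrib]
    exact Finset.sum_congr rfl fun i _ => by ring
  have c5 : ∀ (v w f : Fin d → ℝ), ∑ i, v i * (w i - f i)
      = (∑ i, v i * w i) - ∑ i, v i * f i := fun v w f => by
    simp only [mul_sub, Finset.sum_sub_distrib]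
  have c6 : ∀ v : Fin d → ℝ, ∑ i, v i * (2 * ∑ j, R.u j z * R.Du j i z)
      = 2 * ∑ i, v i * ∑ j, R.u j z * R.Du j i z := fun v => by
    simp only [Finset.mul_sum]
    exact Finset.sum_congr rfl fun i _ => Finset.sum_congr rfl fun j _ => by ring
  have c7 : ∀ f : Fin d → ℝ, ∑ i, θ z.1 * f i = θ z.1 * ∑ i, f i := fun f =>
    (Finset.mul_sum _ _ _).symm
  simp only [c4]
  simp only [c3]
  simp only [c1, c2, c7]
  simp only [c6]
  rw [StrongRep.relConv, StrongRep.relStress, StrongRep.linear]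
  have c8 := c5 (fun i => m z.1 z.2 i) (fun i => hess F Ω (R.Z z) (R.Zx i z) (1, 0))
    fun i => P i z
  simp only [c8]
  linear_combination θ z.1 * key

end Identity

/-! ### From distributional to pointwise inequalities in time. -/

section OneDim

variable {T : ℝ}

/-- A smooth approximation of the indicator function of `(a, ∞)`. -/
noncomputable def step (a δ τ : ℝ) : ℝ := Real.smoothTransition (δ⁻¹ * (τ - a))

variable {a b δ τ : ℝ}

theorem step_contDiff : ContDiff ℝ ∞ (step a δ) :=
  Real.smoothTransition.contDiff.comp (contDiff_const.mul (contDiff_id.sub contDiff_const))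

theorem step_monotone (hδ : 0 < δ) : Monotone (step a δ) := fun x y h =>
  Real.smoothTransition.monotone
    (mul_le_mul_of_nonneg_left (sub_le_sub_right h a) (inv_pos.2 hδ).le)

theorem step_eq_zero (hδ : 0 < δ) (h : τ ≤ a) : step a δ τ = 0 :=
  Real.smoothTransition.zero_of_nonpos
    (mul_nonpos_of_nonneg_of_nonpos (inv_pos.2 hδ).le (sub_nonpos.2 h))

theorem step_eq_one (hδ : 0 < δ) (h : a + δ ≤ τ) : step a δ τ = 1 := by
  refine Real.smoothTransition.one_of_one_le ?_
  rw [inv_mul_eq_div, one_le_div hδ]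
  linarith

theorem step_deriv_nonneg (hδ : 0 < δ) : 0 ≤ deriv (step a δ) τ :=
  (step_monotone hδ).deriv_nonneg

theorem step_deriv_continuous : Continuous (deriv (step a δ)) :=
  step_contDiff.continuous_deriv (by simp)

theorem step_deriv_eq_zero (hδ : 0 < δ) (h : τ ∉ Icc a (a + δ)) : deriv (step a δ) τ = 0 := by
  rw [mem_Icc, not_and_or, not_le, not_le] at h
  rcases h with h | h
  · have : step a δ =ᶠ[𝓝 τ] fun _ => 0 :=
      (eventually_lt_nhds h).mono fun x hx => step_eq_zero hδ hx.le
    rw [this.deriv_eq, deriv_const]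
  · have : step a δ =ᶠ[𝓝 τ] fun _ => 1 :=
      (eventually_gt_nhds h).mono fun x hx => step_eq_one hδ hx.le
    rw [this.deriv_eq, deriv_const]

theorem integral_step_deriv (hT : 0 ≤ T) (hδ : 0 < δ) (ha : 0 ≤ a) (haT : a + δ ≤ T) :
    ∫ τ in Ioo 0 T, deriv (step a δ) τ = 1 := by
  rw [← integral_Ioc_eq_integral_Ioo, ← intervalIntegral.integral_of_le hT,
    intervalIntegral.integral_deriv_eq_sub
      (fun x _ => (step_contDiff.differentiable (by simp)) x)
      (step_deriv_continuous.intervalIntegrable _ _),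
    step_eq_one hδ haT, step_eq_zero hδ ha, sub_zero]

theorem integrableOn_Ioo_mul {J g : ℝ → ℝ} (hJ : ContinuousOn J (Icc 0 T)) (hg : Continuous g) :
    IntegrableOn (fun τ => J τ * g τ) (Ioo 0 T) :=
  ((hJ.mul hg.continuousOn).integrableOn_compact isCompact_Icc).mono_set Ioo_subset_Icc_self

/-- The derivative of `step a δ` is a probability density carried by `[a, a + δ]`, so the integral
is an average of values of `J` there. -/
theorem abs_integral_step_le (hT : 0 ≤ T) (hδ : 0 < δ) (ha : 0 ≤ a) (haT : a + δ ≤ T)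
    {J : ℝ → ℝ} (hJ : ContinuousOn J (Icc 0 T)) {c ε : ℝ}
    (hε : ∀ τ ∈ Icc a (a + δ), |J τ - c| ≤ ε) :
    |(∫ τ in Ioo 0 T, J τ * deriv (step a δ) τ) - c| ≤ ε := by
  have e1 : (∫ τ in Ioo 0 T, J τ * deriv (step a δ) τ) - c
      = ∫ τ in Ioo 0 T, (J τ - c) * deriv (step a δ) τ := by
    simp only [sub_mul]
    rw [integral_sub (integrableOn_Ioo_mul hJ step_deriv_continuous)
      (integrableOn_Ioo_mul continuousOn_const step_deriv_continuous), integral_const_mul,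
      integral_step_deriv hT hδ ha haT, mul_one]
  have e2 : ε = ∫ τ in Ioo 0 T, ε * deriv (step a δ) τ := by
    rw [integral_const_mul, integral_step_deriv hT hδ ha haT, mul_one]
  rw [e1, e2, ← Real.norm_eq_abs]
  refine norm_integral_le_of_norm_le
    (integrableOn_Ioo_mul continuousOn_const step_deriv_continuous)
    (Eventually.of_forall fun τ => ?_)
  rw [norm_mul, Real.norm_eq_abs, Real.norm_eq_abs, abs_of_nonneg (step_deriv_nonneg hδ)]
  by_cases h : τ ∈ Icc a (a + δ)
  · exact mul_le_mul_of_nonneg_right (hε τ h) (step_deriv_nonneg hδ)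
  · rw [step_deriv_eq_zero hδ h, mul_zero, mul_zero]

theorem tendsto_integral_step (hT : 0 ≤ T) (ha : 0 < a) (haT : a < T) {J : ℝ → ℝ}
    (hJ : ContinuousOn J (Icc 0 T)) :
    Tendsto (fun δ => ∫ τ in Ioo 0 T, J τ * deriv (step a δ) τ) (𝓝[>] 0) (𝓝 (J a)) := by
  rw [Metric.tendsto_nhds]
  intro ε hε
  have hc : ContinuousAt J a := hJ.continuousAt (Icc_mem_nhds ha haT)
  obtain ⟨r, hr, hr'⟩ := Metric.continuousAt_iff.1 hc (ε / 2) (half_pos hε)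
  have h0 : (0 : ℝ) < min r (T - a) := lt_min hr (sub_pos.2 haT)
  filter_upwards [Ioo_mem_nhdsGT h0] with δ hδ
  rw [Real.dist_eq]
  refine (abs_integral_step_le hT hδ.1 ha.le ?_ hJ fun τ hτ => ?_).trans_lt (half_lt_self hε)
  · linarith [hδ.2.trans_le (min_le_right _ _)]
  · have : dist τ a < r := by
      rw [Real.dist_eq, abs_of_nonneg (sub_nonneg.2 hτ.1)]
      linarith [hδ.2.trans_le (min_le_left _ _), hτ.2]
    exact (hr' this).le

theorem tendsto_step (τ : ℝ) :
    Tendsto (fun δ => step a δ τ) (𝓝[>] 0) (𝓝 ((Ioi a).indicator 1 τ)) := by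
  by_cases h : τ ∈ Ioi a
  · rw [indicator_of_mem h, Pi.one_apply]
    refine tendsto_const_nhds.congr' ?_
    filter_upwards [Ioo_mem_nhdsGT (sub_pos.2 h)] with δ hδ
    exact (step_eq_one hδ.1 (by linarith [hδ.2])).symm
  · rw [indicator_of_notMem h]
    refine tendsto_const_nhds.congr' ?_
    filter_upwards [self_mem_nhdsWithin] with δ hδ
    exact (step_eq_zero hδ (not_lt.1 h)).symm

theorem step_norm_le : ‖step a δ τ‖ ≤ 1 := by
  rw [Real.norm_eq_abs, abs_le]
  exact ⟨(neg_nonpos.2 zero_le_one).trans (Real.smoothTransition.nonneg _),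
    Real.smoothTransition.le_one _⟩

theorem tendsto_integral_mul_step {g : ℝ → ℝ} (hg : IntegrableOn g (Ioo 0 T)) :
    Tendsto (fun δ => ∫ τ in Ioo 0 T, step a δ τ * g τ) (𝓝[>] 0)
      (𝓝 (∫ τ in Ioo 0 T, (Ioi a).indicator 1 τ * g τ)) := by
  refine tendsto_integral_filter_of_dominated_convergence (fun τ => ‖g τ‖)
    (Eventually.of_forall fun δ => step_contDiff.continuous.aestronglyMeasurable.mul hg.1)
    (Eventually.of_forall fun δ => Eventually.of_forall fun τ => ?_) hg.norm
    (Eventually.of_forall fun τ => (tendsto_step τ).mul_const _)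
  rw [norm_mul]
  exact mul_le_of_le_one_left (norm_nonneg _) step_norm_le

/-- A smooth replacement for the indicator of `(a, b]`: as `δ` tends to `0` its derivative tends to
a unit mass at `a` minus one at `b`. -/
theorem timeCutoff_step (hδ : 0 < δ) (ha : 0 < a) (hab : a < b) (hbT : b + δ < T) :
    TimeCutoff T fun τ => step a δ τ - step b δ τ := by
  have hs : Function.support (fun τ => step a δ τ - step b δ τ) ⊆ Icc a (b + δ) := by
    intro τ hτ
    by_contra h
    rw [mem_Icc, not_and_or, not_le, not_le] at h
    refine hτ ?_
    rcases h with h | h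
    · simp [step_eq_zero hδ h.le, step_eq_zero hδ (h.trans hab).le]
    · simp [step_eq_one hδ h.le, step_eq_one hδ (show a + δ ≤ τ by linarith)]
  exact ⟨step_contDiff.sub step_contDiff, .of_support_subset_isCompact isCompact_Icc hs,
    (closure_minimal hs isClosed_Icc).trans fun τ hτ => ⟨ha.trans_le hτ.1, hτ.2.trans_lt hbT⟩⟩

theorem step_antitone (hδ : 0 < δ) (hab : a ≤ b) : step b δ τ ≤ step a δ τ :=
  Real.smoothTransition.monotone
    (mul_le_mul_of_nonneg_left (sub_le_sub_left hab τ) (inv_pos.2 hδ).le)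

/-- The pointwise form of a distributional differential inequality, inside the interval. -/
theorem le_of_forall_timeCutoff_Ioo (hT : 0 ≤ T) {J g : ℝ → ℝ} (hJ : ContinuousOn J (Icc 0 T))
    (hg : IntegrableOn g (Ioo 0 T))
    (H : ∀ θ, TimeCutoff T θ → (∀ τ, 0 ≤ θ τ) →
      ∫ τ in Ioo 0 T, θ τ * g τ ≤ ∫ τ in Ioo 0 T, J τ * deriv θ τ)
    (ha : 0 < a) (hab : a < b) (hbT : b < T) : ∫ τ in Ioc a b, g τ ≤ J a - J b := by
  have l1 := (tendsto_integral_step hT ha (hab.trans hbT) hJ).sub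
    (tendsto_integral_step hT (ha.trans hab) hbT hJ)
  have l2 := (tendsto_integral_mul_step (a := a) hg).sub (tendsto_integral_mul_step (a := b) hg)
  have int : ∀ a δ, IntegrableOn (fun τ => step a δ τ * g τ) (Ioo 0 T) := fun a δ =>
    hg.bdd_mul step_contDiff.continuous.aestronglyMeasurable
      (Eventually.of_forall fun τ => step_norm_le)
  have int' : ∀ a, IntegrableOn (fun τ => (Ioi a).indicator 1 τ * g τ) (Ioo 0 T) := fun a => by
    refine (hg.indicator (measurableSet_Ioi (a := a))).congr (Eventually.of_forall fun τ => ?_)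
    by_cases h : τ ∈ Ioi a <;> simp [h]
  have e : ∫ τ in Ioc a b, g τ = (∫ τ in Ioo 0 T, (Ioi a).indicator 1 τ * g τ)
      - ∫ τ in Ioo 0 T, (Ioi b).indicator 1 τ * g τ := by
    rw [← integral_sub (int' a) (int' b)]
    have hsub : Ioc a b ⊆ Ioo 0 T := fun τ hτ => ⟨ha.trans hτ.1, hτ.2.trans_lt hbT⟩
    rw [← inter_eq_self_of_subset_right hsub, ← setIntegral_indicator measurableSet_Ioc]
    refine integral_congr_ae (Eventually.of_forall fun τ => ?_)
    by_cases h1 : a < τ <;> by_cases h2 : b < τ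
    · simp [h1, h2, indicator]
    · simp [h1, h2, indicator]
    · exact absurd (hab.trans h2) h1
    · simp [h1, h2, indicator]
  rw [e]
  refine le_of_tendsto_of_tendsto l2 l1 ?_
  filter_upwards [Ioo_mem_nhdsGT (sub_pos.2 hbT)] with δ hδ
  have hc := timeCutoff_step (T := T) hδ.1 ha hab (by linarith [hδ.2])
  have h1 := H _ hc fun τ => sub_nonneg.2 (step_antitone hδ.1 hab.le)
  have hd : ∀ a, Differentiable ℝ (step a δ) := fun a =>
    step_contDiff.differentiable (by simp)
  simp only [sub_mul, deriv_fun_sub (hd a _) (hd b _), mul_sub] at h1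
  rwa [integral_sub (int a δ) (int b δ), integral_sub
    (integrableOn_Ioo_mul hJ step_deriv_continuous)
    (integrableOn_Ioo_mul hJ step_deriv_continuous)] at h1

/-- The pointwise form of a distributional differential inequality. -/
theorem le_of_forall_timeCutoff (hT : 0 < T) {J g : ℝ → ℝ} (hJ : ContinuousOn J (Icc 0 T))
    (hg : IntegrableOn g (Ioo 0 T))
    (H : ∀ θ, TimeCutoff T θ → (∀ τ, 0 ≤ θ τ) →
      ∫ τ in Ioo 0 T, θ τ * g τ ≤ ∫ τ in Ioo 0 T, J τ * deriv θ τ)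
    {t : ℝ} (ht : t ∈ Icc 0 T) : J t ≤ J 0 - ∫ τ in Ioo 0 t, g τ := by
  have hgi : IntegrableOn g (Icc 0 T) := by
    rwa [integrableOn_Icc_iff_integrableOn_Ioo]
  -- This function is nonincreasing inside the interval and continuous on the closed one, so its
  -- monotonicity extends to the endpoints, first as `a` tends to `0` and then up to `T`.
  have hΦ : ContinuousOn (fun t => J t + ∫ τ in Ioc 0 t, g τ) (Icc 0 T) :=
    hJ.add (intervalIntegral.continuousOn_primitive hgi)
  have hmono : ∀ a b, 0 < a → a < b → b < T →
      (J b + ∫ τ in Ioc 0 b, g τ) ≤ J a + ∫ τ in Ioc 0 a, g τ := fun a b ha hab hbT => by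
    have h1 := le_of_forall_timeCutoff_Ioo hT.le hJ hg H ha hab hbT
    have h2 : ∫ τ in Ioc 0 b, g τ = (∫ τ in Ioc 0 a, g τ) + ∫ τ in Ioc a b, g τ := by
      rw [← Ioc_union_Ioc_eq_Ioc ha.le hab.le]
      exact setIntegral_union (Ioc_disjoint_Ioc_of_le le_rfl) measurableSet_Ioc
        (hgi.mono_set fun x hx => ⟨hx.1.le, by linarith [hx.2]⟩)
        (hgi.mono_set fun x hx => ⟨by linarith [hx.1], by linarith [hx.2]⟩)
    linarith
  have hz : ∀ b ∈ Ioo 0 T, (J b + ∫ τ in Ioc 0 b, g τ) ≤ J 0 + ∫ τ in Ioc 0 0, g τ := by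
    intro b hb
    refine ContinuousWithinAt.closure_le (s := Ioo 0 b)
      (f := fun _ => J b + ∫ τ in Ioc 0 b, g τ) (g := fun t => J t + ∫ τ in Ioc 0 t, g τ)
      ?_ continuousWithinAt_const ?_ fun a ha => hmono a b ha.1 ha.2 hb.2
    · rw [closure_Ioo hb.1.ne]; exact ⟨le_rfl, hb.1.le⟩
    · exact (hΦ 0 ⟨le_rfl, hT.le⟩).mono fun x hx => ⟨hx.1.le, (hx.2.trans hb.2).le⟩
  have hfin : (J t + ∫ τ in Ioc 0 t, g τ) ≤ J 0 + ∫ τ in Ioc 0 0, g τ := by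
    refine ContinuousWithinAt.closure_le (s := Ioo 0 T)
      (f := fun t => J t + ∫ τ in Ioc 0 t, g τ) (g := fun _ => J 0 + ∫ τ in Ioc 0 0, g τ)
      ?_ ((hΦ t ht).mono Ioo_subset_Icc_self) continuousWithinAt_const hz
    rwa [closure_Ioo hT.ne]
  rw [← integral_Ioc_eq_integral_Ioo]
  simp only [Ioc_self, Measure.restrict_empty, integral_zero_measure] at hfin
  linarith

end OneDim

/-! ### Time slices of fields that are continuous into $L^1$. -/

section Slices

variable {d : ℕ} {T : ℝ}

theorem ContL1.coord {I : Set ℝ} {f : ℝ → E d → E d} (h : ContL1 I f) (i : Fin d) :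
    ContL1 I fun t x => f t x i := by
  refine ⟨fun t ht => (EuclideanSpace.proj i : E d →L[ℝ] ℝ).integrable_comp (h.1 t ht),
    fun t₀ ht₀ => ?_⟩
  refine tendsto_of_tendsto_of_tendsto_of_le_of_le' tendsto_const_nhds (h.2 t₀ ht₀)
    (Eventually.of_forall fun t => integral_nonneg fun x => norm_nonneg _) ?_
  filter_upwards [self_mem_nhdsWithin] with t ht
  have hi := (h.1 t ht).sub (h.1 t₀ ht₀)
  refine integral_mono ((EuclideanSpace.proj i : E d →L[ℝ] ℝ).integrable_comp hi).norm hi.norm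
    fun x => ?_
  exact PiLp.norm_apply_le (f t x - f t₀ x) i

theorem ContL1.const (I : Set ℝ) (c : ℝ) : ContL1 I fun (_ : ℝ) (_ : E d) => c :=
  ⟨fun _ _ => integrable_const _, fun _ _ => by simpa using tendsto_const_nhds⟩

theorem ContL1.integrableOn_mul {I : Set ℝ} {f : ℝ → E d → ℝ} (h : ContL1 I f)
    {g : ℝ × E d → ℝ} (hg : BddMeas g) (hc : Continuous g) {t : ℝ} (ht : t ∈ I) :
    IntegrableOn (fun x => f t x * g (t, x)) (cell d) := by
  obtain ⟨C, hC⟩ := hg.bdd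
  exact (h.1 t ht).mul_bdd (hc.comp (by fun_prop : Continuous fun x : E d => (t, x))).aestronglyMeasurable
    (Eventually.of_forall fun x => hC (t, x))

/-- The difference splits into $(f(t)-f(t_0))g(t)$, small in $L^1$ since `g` is bounded, and
$f(t_0)(g(t)-g(t_0))$, where dominated convergence applies. -/
theorem ContL1.continuousOn_integral_mul {I : Set ℝ} {f : ℝ → E d → ℝ} (h : ContL1 I f)
    {g : ℝ × E d → ℝ} (hg : BddMeas g) (hc : Continuous g) :
    ContinuousOn (fun t => ∫ x in cell d, f t x * g (t, x)) I := by
  intro t₀ ht₀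
  obtain ⟨C, hC⟩ := hg.bdd
  have hgt : ∀ t, Continuous fun x : E d => g (t, x) := fun t =>
    hc.comp (by fun_prop : Continuous fun x : E d => (t, x))
  have h1 : Continuous fun t => ∫ x in cell d, f t₀ x * g (t, x) := by
    refine continuous_of_dominated (bound := fun x => ‖f t₀ x‖ * C)
      (fun t => (h.1 t₀ ht₀).1.mul (hgt t).aestronglyMeasurable)
      (fun t => Eventually.of_forall fun x => ?_) ((h.1 t₀ ht₀).norm.mul_const C)
      (Eventually.of_forall fun x => continuous_const.mul
        (hc.comp (by fun_prop : Continuous fun t : ℝ => (t, x))))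
    rw [norm_mul]
    exact mul_le_mul_of_nonneg_left (hC _) (norm_nonneg _)
  have h2 : Tendsto (fun t => ∫ x in cell d, (f t x - f t₀ x) * g (t, x)) (𝓝[I] t₀) (𝓝 0) := by
    have h3 := (h.2 t₀ ht₀).mul_const C
    rw [zero_mul] at h3
    refine squeeze_zero_norm' ?_ h3
    filter_upwards [self_mem_nhdsWithin] with t ht
    rw [← integral_mul_const]
    refine norm_integral_le_of_norm_le (((h.1 t ht).sub (h.1 t₀ ht₀)).norm.mul_const C)
      (Eventually.of_forall fun x => ?_)
    rw [norm_mul]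
    exact mul_le_mul_of_nonneg_left (hC _) (norm_nonneg _)
  have h4 := h2.add (h1.tendsto t₀ |>.mono_left nhdsWithin_le_nhds)
  rw [zero_add] at h4
  refine h4.congr' ?_
  filter_upwards [self_mem_nhdsWithin] with t ht
  have hi := h.integrableOn_mul hg hc ht
  have hi' : IntegrableOn (fun x => f t₀ x * g (t, x)) (cell d) :=
    (h.1 t₀ ht₀).mul_bdd (hgt t).aestronglyMeasurable (Eventually.of_forall fun x => hC (t, x))
  simp only [sub_mul]
  rw [integral_sub hi hi', sub_add_cancel]

end Slices

/-! ### Integrability of the relative terms and continuity of the linear part. -/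

section RelFlux

variable {d : ℕ} {T : ℝ} {F : ℝ × E d → ℝ} {Ω K : Set (ℝ × E d)}
  {ρ : ℝ → E d → ℝ} {q m : ℝ → E d → E d} {S : ℝ → E d → Matrix (Fin d) (Fin d) ℝ} {θ : ℝ → ℝ}

theorem PhaseDomain.contDiffOn_r (h : PhaseDomain F Ω K) (k : Fin d) :
    ContDiffOn ℝ ∞ (r F k) Ω := contDiffOn_fst.mul (h.contDiffOn_Fq k)

theorem PhaseDomain.contDiffOn_H (h : PhaseDomain F Ω K) (i j : Fin d) :
    ContDiffOn ℝ ∞ (H F i j) Ω :=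
  (((EuclideanSpace.proj i : E d →L[ℝ] ℝ).contDiff.comp contDiff_snd).contDiffOn).mul
    (h.contDiffOn_Fq j)

theorem integrableOn_mul_bddMeas {f g : ℝ × E d → ℝ} (hf : IntegrableOn f (Q d T))
    (hg : BddMeas g) : IntegrableOn (fun z => f z * g z) (Q d T) := by
  obtain ⟨C, hC⟩ := hg.bdd
  exact hf.mul_bdd hg.meas.aestronglyMeasurable (Eventually.of_forall hC)

theorem BddMeas.integrableOn {g : ℝ × E d → ℝ} (hg : BddMeas g) : IntegrableOn g (Q d T) := by
  obtain ⟨C, hC⟩ := hg.bdd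
  exact Integrable.of_bound hg.meas.aestronglyMeasurable C (Eventually.of_forall hC)

/-- Apart from the value of `L` at the weak state, a relative function is affine in $(\rho,q)$ with
bounded coefficients. -/
theorem StrongRep.integrableOn_rel (R : StrongRep d T K) (h : PhaseDomain F Ω K)
    (hi : WeakIntegrable T F ρ q m S) {L : ℝ × E d → ℝ} (hL : ContDiffOn ℝ ∞ L Ω)
    (hLi : IntegrableOn (fun z : ℝ × E d => L (ρ z.1 z.2, q z.1 z.2)) (Q d T)) :
    IntegrableOn (fun z : ℝ × E d => rel L (ρ z.1 z.2, q z.1 z.2) (R.Z z)) (Q d T) := by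
  have hD : ∀ w : ℝ × E d, BddMeas fun z => fderivWithin ℝ L Ω (R.Z z) w := fun w =>
    h.bddMeas_comp_deriv hL R.Z_cont R.Z_mem ⟨stronglyMeasurable_const, ‖w‖, fun _ => le_rfl⟩
  have h1 := (hLi.sub (h.bddMeas_comp hL R.Z_cont R.Z_mem).integrableOn).sub
    ((integrableOn_mul_bddMeas (hi.iρ.sub R.bρ.integrableOn) (hD (1, 0))).add
      (integrable_finsetSum Finset.univ fun k _ =>
        integrableOn_mul_bddMeas ((hi.iq k).sub (R.bq k).integrableOn) (hD (ev k))))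
  refine h1.congr (Eventually.of_forall fun z => ?_)
  simp only [Pi.sub_apply, Pi.add_apply]
  rw [rel, h.fderiv_eq _ _ (h.sub (R.Z_mem z)), clm_apply_eq _ (_ - R.Z z)]
  rfl

theorem StrongRep.integrableOn_conv (R : StrongRep d T K) (h : PhaseDomain F Ω K)
    (hw : IsWeakSolution F ρ q m S) (hi : WeakIntegrable T F ρ q m S) :
    IntegrableOn (R.relConv F ρ q m) (Q d T) := by
  have h1 : ∀ i j, IntegrableOn (fun z : ℝ × E d =>
      ρ z.1 z.2 * (m z.1 z.2 i / ρ z.1 z.2 - R.u i z)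
      * (m z.1 z.2 j / ρ z.1 z.2 - R.u j z) * R.Du i j z) (Q d T) := fun i j => by
    refine integrableOn_mul_bddMeas (Integrable.congr ((hi.ic i j).sub
      ((integrableOn_mul_bddMeas (hi.im i) (R.bu j)).add
        (integrableOn_mul_bddMeas (hi.im j) (R.bu i))) |>.add
      (integrableOn_mul_bddMeas hi.iρ ((R.bu i).mul (R.bu j)))) ?_) (R.bDu i j)
    have hvac : ∀ᵐ z ∂(volume.restrict (Q d T)), ρ z.1 z.2 = 0 → m z.1 z.2 = 0 :=
      ae_restrict_of_ae_restrict_of_subset (prod_mono Ioo_subset_Ioi_self subset_rfl) hw.vacuum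
    filter_upwards [hvac] with z hv
    rw [mul_div_sub_mul_div_sub (fun h0 => by rw [hv h0]; rfl) (fun h0 => by rw [hv h0]; rfl)]
    simp only [Pi.sub_apply, Pi.add_apply]
    ring
  refine (integrable_finsetSum _ fun i _ => integrable_finsetSum _ fun j _ => h1 i j).add ?_
  exact (integrableOn_mul_bddMeas (R.integrableOn_rel h hi h.contDiffOn_s hi.is) R.div_bdd).congr
    (Eventually.of_forall fun z => mul_comm _ _)

theorem StrongRep.integrableOn_stress (R : StrongRep d T K) (h : PhaseDomain F Ω K)
    (hi : WeakIntegrable T F ρ q m S) :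
    IntegrableOn (R.relStress F ρ q) (Q d T) := by
  refine (integrable_finsetSum _ fun i _ => integrable_finsetSum _ fun j _ => ?_).add
    (integrable_finsetSum _ fun k _ => ?_)
  · exact (integrableOn_mul_bddMeas (R.integrableOn_rel h hi (h.contDiffOn_H i j) (hi.iH i j))
      (R.bDu i j)).congr (Eventually.of_forall fun z => mul_comm _ _)
  · exact (integrableOn_mul_bddMeas (R.integrableOn_rel h hi (h.contDiffOn_r k) (hi.ir k))
      (R.bG k)).congr (Eventually.of_forall fun z => mul_comm _ _)

theorem StrongRep.integrableOn_linear (R : StrongRep d T K) (h : PhaseDomain F Ω K)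
    (hi : WeakIntegrable T F ρ q m S) : IntegrableOn (R.linear F ρ q m) (Q d T) := by
  have b1 := BddMeas.sum fun i => (R.bu i).mul (R.bu i)
  refine ((((integrableOn_mul_bddMeas hi.iρ b1).const_mul _).sub
    (integrable_finsetSum _ fun i _ => integrableOn_mul_bddMeas (hi.im i) (R.bu i))).add
    (h.bddMeas_comp h.contDiffOn_s R.Z_cont R.Z_mem).integrableOn).sub
    ((integrableOn_mul_bddMeas hi.iρ (h.bddMeas_comp h.contDiffOn_Fρ R.Z_cont R.Z_mem)).add
    (integrable_finsetSum _ fun k _ => integrableOn_mul_bddMeas (hi.iq k)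
      (h.bddMeas_comp (h.contDiffOn_Fq k) R.Z_cont R.Z_mem)))

theorem PhaseDomain.continuous_comp (h : PhaseDomain F Ω K) {L : ℝ × E d → ℝ}
    (hL : ContDiffOn ℝ ∞ L Ω) (R : StrongRep d T K) : Continuous fun z => L (R.Z z) :=
  hL.continuousOn.comp_continuous R.Z_cont fun z => h.sub (R.Z_mem z)

/-- Each summand is a field continuous into $L^1$ times a bounded continuous coefficient; for `s`
the field is the constant `1`. -/
theorem StrongRep.linear_slice (R : StrongRep d T K) (h : PhaseDomain F Ω K) {I : Set ℝ}
    (hρ : ContL1 I ρ) (hq : ContL1 I q) (hm : ContL1 I m) :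
    (∀ t ∈ I, IntegrableOn (fun x => R.linear F ρ q m (t, x)) (cell d)) ∧
      ContinuousOn (fun t => ∫ x in cell d, R.linear F ρ q m (t, x)) I := by
  have b1 := BddMeas.sum fun i => (R.bu i).mul (R.bu i)
  have c1 : Continuous fun z => ∑ i, R.u i z * R.u i z :=
    continuous_finsetSum _ fun i _ => (R.cu i).mul (R.cu i)
  have bs := h.bddMeas_comp h.contDiffOn_s R.Z_cont R.Z_mem
  have cs := h.continuous_comp h.contDiffOn_s R
  have bF := h.bddMeas_comp h.contDiffOn_Fρ R.Z_cont R.Z_mem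
  have cF := h.continuous_comp h.contDiffOn_Fρ R
  have bV := fun k => h.bddMeas_comp (h.contDiffOn_Fq k) R.Z_cont R.Z_mem
  have cV := fun k => h.continuous_comp (h.contDiffOn_Fq k) R
  have h1 := ContL1.const (d := d) I 1
  have i1 : ∀ t ∈ I, IntegrableOn (fun x => 1 / 2 * (ρ t x * ∑ i, R.u i (t, x) * R.u i (t, x)))
    (cell d) := fun t ht => (hρ.integrableOn_mul b1 c1 ht).const_mul _
  have i2 : ∀ t ∈ I, IntegrableOn (fun x => ∑ i, m t x i * R.u i (t, x)) (cell d) :=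
    fun t ht => integrable_finsetSum _ fun i _ =>
      (hm.coord i).integrableOn_mul (R.bu i) (R.cu i) ht
  have i3 : ∀ t ∈ I, IntegrableOn (fun x => s F (R.Z (t, x))) (cell d) := fun t ht => by
    simpa only [one_mul] using h1.integrableOn_mul bs cs ht
  have i4 : ∀ t ∈ I, IntegrableOn (fun x => ρ t x * Fρ F (R.Z (t, x))) (cell d) :=
    fun t ht => hρ.integrableOn_mul bF cF ht
  have i5 : ∀ t ∈ I, IntegrableOn (fun x => ∑ k, q t x k * Fq F k (R.Z (t, x))) (cell d) :=
    fun t ht => integrable_finsetSum _ fun k _ =>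
      (hq.coord k).integrableOn_mul (bV k) (cV k) ht
  refine ⟨fun t ht => (((i1 t ht).sub (i2 t ht)).add (i3 t ht)).sub ((i4 t ht).add (i5 t ht)), ?_⟩
  have k1 := (hρ.continuousOn_integral_mul b1 c1).const_mul (1 / 2)
  have k2 := continuousOn_finsetSum Finset.univ fun i _ =>
    (hm.coord i).continuousOn_integral_mul (R.bu i) (R.cu i)
  have k3 := h1.continuousOn_integral_mul bs cs
  have k4 := hρ.continuousOn_integral_mul bF cF
  have k5 := continuousOn_finsetSum Finset.univ fun k _ =>
    (hq.coord k).continuousOn_integral_mul (bV k) (cV k)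
  refine ((((k1.sub k2).add k3).sub (k4.add k5))).congr fun t ht => ?_
  have j12 := (integral_sub (i1 t ht) (i2 t ht)).trans (congrArg₂ (· - ·)
    (integral_const_mul _ _) (integral_finsetSum _ fun i _ =>
      (hm.coord i).integrableOn_mul (R.bu i) (R.cu i) ht))
  have j45 := (integral_add (i4 t ht) (i5 t ht)).trans (congrArg₂ (· + ·) rfl
    (integral_finsetSum _ fun k _ => (hq.coord k).integrableOn_mul (bV k) (cV k) ht))
  have j123 := (integral_add ((i1 t ht).sub (i2 t ht)) (i3 t ht)).trans
    (congrArg₂ (· + ·) j12 rfl)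
  simp only [one_mul]
  exact (integral_sub (((i1 t ht).sub (i2 t ht)).add (i3 t ht)) ((i4 t ht).add (i5 t ht))).trans
    (congrArg₂ (· - ·) j123 j45)

end RelFlux

/-! ### The relative energy inequality for the representatives. -/

section Final

variable {d : ℕ} {T : ℝ} {F : ℝ × E d → ℝ} {Ω K : Set (ℝ × E d)}
  {ρ : ℝ → E d → ℝ} {q m : ℝ → E d → E d} {S : ℝ → E d → Matrix (Fin d) (Fin d) ℝ} {θ : ℝ → ℝ}

/-- Expanding the square isolates the kinetic energy, the only part not linear in $(\rho,m)$. In the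
vacuum both sides vanish. -/
theorem kinetic_eq {ρ : ℝ} {m u : E d} (h : ρ = 0 → m = 0) :
    1 / 2 * ρ * ‖ρ⁻¹ • m - u‖ ^ 2
      = 1 / 2 * (‖m‖ ^ 2 / ρ) + (1 / 2 * (ρ * ∑ i, u i * u i) - ∑ i, m i * u i) := by
  by_cases h0 : ρ = 0
  · simp [h0, h h0]
  · simp only [EuclideanSpace.real_norm_sq_eq, PiLp.sub_apply, PiLp.smul_apply, smul_eq_mul,
      Finset.mul_sum, Finset.sum_div, ← Finset.sum_sub_distrib, ← Finset.sum_add_distrib]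
    refine Finset.sum_congr rfl fun i _ => ?_
    field_simp
    ring

theorem StrongRep.relEnergy_eq (R : StrongRep d T K) (h : PhaseDomain F Ω K)
    {ρb : ℝ → E d → ℝ} {qb ub : ℝ → E d → E d} {t : ℝ} {x : E d}
    (hZ : R.Z (t, x) = (ρb t x, qb t x)) (hu : ∀ i, R.u i (t, x) = ub t x i)
    (hv : ρ t x = 0 → m t x = 0) :
    energy F ρ q m t x + R.linear F ρ q m (t, x) = relEnergy F ρ q m ρb qb ub t x := by
  have hΩ := h.sub (R.Z_mem (t, x))
  rw [relEnergy, kinetic_eq hv, ← hZ, h.rel_self hΩ, energy, StrongRep.linear]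
  simp only [hu]
  ring

/-- Adds the energy inequality of the weak solution to the exact identity for the linear part, for
each nonnegative cutoff, and then localizes in time. -/
theorem StrongRep.relative_inequality (R : StrongRep d T K) (h : PhaseDomain F Ω K) (hT : 0 < T)
    (hw : IsWeakSolution F ρ q m S) (hi : WeakIntegrable T F ρ q m S)
    (hE : ContL1 (Ici 0) (energy F ρ q m)) (hbal : EnergyInequality (Ici 0) (energy F ρ q m))
    (hρ : ContL1 (Icc 0 T) ρ) (hq : ContL1 (Icc 0 T) q)
    {P : Fin d → ℝ × E d → ℝ} (bP : ∀ i, BddMeas (P i))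
    (wP : ∀ i, WD (Ioo 0 T ×ˢ univ) (fun z => Fρ F (R.Z z)
          - ∑ k, fderivWithin ℝ (Fq F k) Ω (R.Z z) (R.Zx k z)) (P i) (0, e i))
    (hP : ∀ᵐ z ∂(volume.restrict (Q d T)), ∀ i,
          R.ut i z + (∑ j, R.u j z * R.Du i j z) = - P i z)
    {t : ℝ} (ht : t ∈ Icc 0 T) :
    (∫ x in cell d, (energy F ρ q m t x + R.linear F ρ q m (t, x)))
      ≤ (∫ x in cell d, (energy F ρ q m 0 x + R.linear F ρ q m (0, x)))
        - ∫ z in Q d t, (R.relConv F ρ q m z + R.relStress F ρ q z) := by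
  have hm := hw.cont_m.mono (Icc_subset_Ici_self : Icc 0 T ⊆ Ici 0)
  have hE' := hE.mono (Icc_subset_Ici_self : Icc 0 T ⊆ Ici 0)
  obtain ⟨hl1, hl2⟩ := R.linear_slice h hρ hq hm
  have hQ : Integrable (fun z => R.relConv F ρ q m z + R.relStress F ρ q z)
      (((volume : Measure ℝ).restrict (Ioo 0 T)).prod ((volume : Measure (E d)).restrict (cell d))) := by
    rw [← volume_restrict_Q]
    exact (R.integrableOn_conv h hw hi).add (R.integrableOn_stress h hi)
  have hEc : ContinuousOn (fun t => ∫ x in cell d, energy F ρ q m t x) (Icc 0 T) := by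
    simpa only [mul_one] using hE'.continuousOn_integral_mul (BddMeas.const 1) continuous_const
  have key := le_of_forall_timeCutoff hT
    (J := fun t => (∫ x in cell d, energy F ρ q m t x) + ∫ x in cell d, R.linear F ρ q m (t, x))
    (g := fun t => ∫ x in cell d, (R.relConv F ρ q m (t, x) + R.relStress F ρ q (t, x))) (hEc.add hl2)
    hQ.integral_prod_left (fun θ hθ hθ0 => ?_) ht
  · rw [integral_add (hE'.1 t ht) (hl1 t ht),
      integral_add (hE'.1 0 ⟨le_rfl, hT.le⟩) (hl1 0 ⟨le_rfl, hT.le⟩)]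
    refine key.trans (le_of_eq (congrArg _ ?_))
    have hsub : Q d t ⊆ Q d T := prod_mono (Ioo_subset_Ioo_right ht.2) subset_rfl
    rw [← volume_restrict_Q] at hQ
    have h1 := IntegrableOn.mono_set hQ hsub
    rw [IntegrableOn, volume_restrict_Q] at h1
    rw [volume_restrict_Q, integral_prod _ h1]
  · obtain ⟨hN, hN0⟩ := R.relative_identity h hw hi hθ bP wP hP
    have iθ : IntegrableOn (fun z : ℝ × E d => θ z.1 * (R.relConv F ρ q m z + R.relStress F ρ q z)) (Q d T) := by
      rw [← volume_restrict_Q] at hQ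
      exact (integrableOn_mul_bddMeas hQ (hθ.bddMeas (d := d))).congr
        (Eventually.of_forall fun z => mul_comm _ _)
    have iθ' : IntegrableOn (fun z : ℝ × E d => deriv θ z.1 * R.linear F ρ q m z) (Q d T) :=
      (integrableOn_mul_bddMeas (R.integrableOn_linear h hi) (hθ.bddMeas_deriv (d := d))).congr
          (Eventually.of_forall fun z => mul_comm _ _)
    rw [integral_sub iθ iθ', sub_eq_zero] at hN0
    have e1 : ∫ z in Q d T, θ z.1 * (R.relConv F ρ q m z + R.relStress F ρ q z)
        = ∫ τ in Ioo 0 T, θ τ * ∫ x in cell d, (R.relConv F ρ q m (τ, x) + R.relStress F ρ q (τ, x)) := by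
      rw [IntegrableOn, volume_restrict_Q] at iθ
      rw [volume_restrict_Q, integral_prod _ iθ]
      simp only [integral_const_mul]
    have e2 : ∫ z in Q d T, deriv θ z.1 * R.linear F ρ q m z
        = ∫ τ in Ioo 0 T, (∫ x in cell d, R.linear F ρ q m (τ, x)) * deriv θ τ := by
      rw [IntegrableOn, volume_restrict_Q] at iθ'
      rw [volume_restrict_Q, integral_prod _ iθ']
      simp only [integral_const_mul, mul_comm]
    -- The cutoff vanishes at time `0`, so no initial energy appears here; the initial value enters
    -- later through continuity in time.
    have hb := hbal θ ⟨ContDiff.lipschitzWith_of_hasCompactSupport hθ.compact hθ.smooth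
      (by simp), fun τ _ => hθ0 τ, tsupport θ, hθ.compact, fun τ hτ => (hθ.sub hτ).1.le,
      fun τ _ hτ => TimeCutoff.eq_zero hτ⟩
    rw [hθ.zero_at_zero, mul_zero] at hb
    have e3 : ∫ τ in Ioi 0, (∫ x in cell d, energy F ρ q m τ x) * deriv θ τ
        = ∫ τ in Ioo 0 T, (∫ x in cell d, energy F ρ q m τ x) * deriv θ τ :=
      setIntegral_eq_of_subset_of_forall_sdiff_eq_zero measurableSet_Ioi Ioo_subset_Ioi_self
        fun τ hτ => by rw [hθ.deriv_eq_zero' hτ.2, mul_zero]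
    rw [e3] at hb
    simp only [add_mul]
    rw [integral_add (integrableOn_Ioo_mul hEc hθ.continuous_deriv)
      (integrableOn_Ioo_mul hl2 hθ.continuous_deriv), ← e2, ← hN0, e1]
    linarith

end Final

end EulerKorteweg

/-! ### Return from the representatives to the given fields. -/

open EulerKorteweg in
theorem mainTheorem1 (d : ℕ) (hd : 1 ≤ d) (T : ℝ) (hT : 0 < T)
    (F : ℝ × E d → ℝ) (hF : ContDiffOn ℝ ∞ F (Ioi 0 ×ˢ univ))
    -- the weak solution, with its gradient and its stress
    (ρ : ℝ → E d → ℝ) (q m : ℝ → E d → E d) (S : ℝ → E d → Matrix (Fin d) (Fin d) ℝ)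
    (hweak : IsDissipativeWeakSolution F ρ q m S ∨ IsConservativeWeakSolution F ρ q m S)
    (K₁ K₂ : ℝ)
    (hK₁ : ∀ t ∈ Ioo 0 T, ∫ x in cell d, ρ t x ≤ K₁)
    (hK₂ : ∀ t ∈ Ioo 0 T, ∫ x in cell d, energy F ρ q m t x ≤ K₂)
    (hA : ContL1 (Icc 0 T) ρ ∧ ContL1 (Icc 0 T) q)
    -- the strong solution, with `qb = ∇ρb`, `Dub = ∇ub`, `Gb = ∇ div ub`
    (ρb : ℝ → E d → ℝ) (qb ub : ℝ → E d → E d)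
    (Dub : ℝ → E d → Matrix (Fin d) (Fin d) ℝ) (Gb : ℝ → E d → E d)
    (hstrong : IsStrongSolution F T ρb qb ub Dub Gb)
    -- `F` has to be smooth up to `ρ = 0` only if the strong solution reaches the vacuum
    (hvac : (∀ t ∈ Icc 0 T, ∀ x, 0 < ρb t x) ∨ ContDiffOn ℝ ∞ F (Ici 0 ×ˢ univ))
    (t : ℝ) (ht : t ∈ Icc 0 T) :
    IntegrableOn (relEnergy F ρ q m ρb qb ub 0) (cell d) ∧
    IntegrableOn (relEnergy F ρ q m ρb qb ub t) (cell d) ∧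
    IntegrableOn (fun z : ℝ × E d => convTerm F ρ q m ρb qb ub Dub z.1 z.2)
      (Ico 0 t ×ˢ cell d) ∧
    IntegrableOn (fun z : ℝ × E d => stressTerm F ρ q ρb qb Dub Gb z.1 z.2)
      (Ico 0 t ×ˢ cell d) ∧
    ∫ x in cell d, relEnergy F ρ q m ρb qb ub t x
      ≤ (∫ x in cell d, relEnergy F ρ q m ρb qb ub 0 x)
        - (∫ z in Ico 0 t ×ˢ cell d, convTerm F ρ q m ρb qb ub Dub z.1 z.2)
        - ∫ z in Ico 0 t ×ˢ cell d, stressTerm F ρ q ρb qb Dub Gb z.1 z.2 := by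
  obtain ⟨hw, hE, hbal⟩ : IsWeakSolution F ρ q m S ∧ HasContinuousEnergy F ρ q m ∧
      EnergyInequality (Ici 0) (energy F ρ q m) := by
    rcases hweak with h | h
    · exact ⟨h.weak, h.contEnergy, h.balance⟩
    · exact ⟨h.weak, h.contEnergy, fun θ hθ => (h.balance θ hθ).le⟩
  obtain ⟨Ω, K, h, hK⟩ := exists_phaseDomain hT.le hF hstrong.periodic_ρ hstrong.periodic_q
    hstrong.cont_ρ hstrong.cont_q hstrong.nonneg hvac
  obtain ⟨R, hRρ, hRq, hRu, hDu, hG, P, bP, wP, hP⟩ := exists_strongRep hT h hstrong hK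
  have hi := hw.weakIntegrable hA.1 hA.2
  have hZ : ∀ τ ∈ Icc 0 T, ∀ x, R.Z (τ, x) = (ρb τ x, qb τ x) := fun τ hτ x => by
    refine Prod.ext ?_ ?_
    · show R.ρ (τ, x) = _
      rw [hRρ, clampTime_eq _ hτ]
    · ext i
      show R.q i (τ, x) = _
      rw [hRq]
      exact congrArg (fun v : E d => v i) (clampTime_eq qb (z := (τ, x)) hτ)
  have hu : ∀ τ ∈ Icc 0 T, ∀ x i, R.u i (τ, x) = ub τ x i := fun τ hτ x i => by
    rw [hRu]
    exact congrArg (fun v : E d => v i) (clampTime_eq ub (z := (τ, x)) hτ)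
  -- This holds at every time, and only almost everywhere in space, since expanding the kinetic part
  -- needs `m = 0` in the vacuum.
  have hrel : ∀ τ ∈ Icc 0 T, (fun x => energy F ρ q m τ x + R.linear F ρ q m (τ, x))
      =ᵐ[volume.restrict (cell d)] relEnergy F ρ q m ρb qb ub τ := fun τ hτ => by
    filter_upwards [hE.vacuum τ hτ.1] with x hx
    exact R.relEnergy_eq h (hZ τ hτ x) (hu τ hτ x) hx
  have h0 : (0 : ℝ) ∈ Icc 0 T := ⟨le_rfl, hT.le⟩
  have hint : ∀ τ ∈ Icc 0 T, IntegrableOn (relEnergy F ρ q m ρb qb ub τ) (cell d) :=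
    fun τ hτ => ((hE.cont.1 τ hτ.1).add ((R.linear_slice h hA.1 hA.2
      (hw.cont_m.mono (Icc_subset_Ici_self : Icc 0 T ⊆ Ici 0))).1 τ hτ)).congr (hrel τ hτ)
  -- The open and half-open time intervals differ by the null slice at time `0`.
  have hae : Q d t =ᵐ[volume] Ico 0 t ×ˢ cell d :=
    Measure.set_prod_ae_eq Ioo_ae_eq_Ico (ae_eq_refl _)
  have hsub : Q d t ⊆ Q d T := prod_mono (Ioo_subset_Ioo_right ht.2) subset_rfl
  have hpt : ∀ᵐ z ∂(volume.restrict (Q d t)), R.Z z = (ρb z.1 z.2, qb z.1 z.2) ∧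
      (∀ i, R.u i z = ub z.1 z.2 i) ∧ (∀ i j, Dub z.1 z.2 i j = R.Du i j z) ∧
      ∀ k, Gb z.1 z.2 k = R.G k z := by
    filter_upwards [ae_restrict_of_ae_restrict_of_subset hsub
      (eventually_all.2 fun i => eventually_all.2 (hDu i)),
      ae_restrict_of_ae_restrict_of_subset hsub (eventually_all.2 hG),
      ae_restrict_mem (measurableSet_Q t)] with z h1 h2 h3
    have h4 := Ioo_subset_Icc_self (hsub h3).1
    exact ⟨hZ z.1 h4 z.2, hu z.1 h4 z.2, h1, h2⟩
  have hconv := (R.integrableOn_conv h hw hi).mono_set hsub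
  have hstress := (R.integrableOn_stress h hi).mono_set hsub
  have econv : R.relConv F ρ q m =ᵐ[volume.restrict (Q d t)]
      fun z : ℝ × E d => convTerm F ρ q m ρb qb ub Dub z.1 z.2 := by
    filter_upwards [hpt] with z hz
    simp only [StrongRep.relConv, convTerm, hz.1, hz.2.1, hz.2.2.1]
  have estress : R.relStress F ρ q =ᵐ[volume.restrict (Q d t)]
      fun z : ℝ × E d => stressTerm F ρ q ρb qb Dub Gb z.1 z.2 := by
    filter_upwards [hpt] with z hz
    simp only [StrongRep.relStress, stressTerm, hz.1, hz.2.2.1, hz.2.2.2]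
  refine ⟨hint 0 h0, hint t ht, IntegrableOn.congr_set_ae (hconv.congr econv) hae.symm,
    IntegrableOn.congr_set_ae (hstress.congr estress) hae.symm, ?_⟩
  have key := R.relative_inequality h hT hw hi hE.cont hbal hA.1 hA.2 bP wP hP ht
  rw [integral_congr_ae (hrel t ht), integral_congr_ae (hrel 0 h0)] at key
  rw [← setIntegral_congr_set hae, ← setIntegral_congr_set hae, ← integral_congr_ae econv,
    ← integral_congr_ae estress, sub_sub, ← integral_add hconv hstress]
  exact key
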